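/- Let $\Bbbk$ be a field, $H$ a Hopf algebra over $\Bbbk$ with bijective antipode, and $(V,\delta)$ a finite-dimensional Yetter–Drinfeld module over $H$, with left action $\triangleright$ and left coaction $\delta(v)=v^{(-1)}\otimes v^{(0)}$. Let $\Psi(v\otimes w)=(v^{(-1)}\triangleright w)\otimes v^{(0)}$ be the induced braiding on $V$, let $\Psi^*$ be the dual map on $V^*\otimes V^*$ (identified with $(V\otimes V)^*$ by $\langle f\otimes g,v\otimes w\rangle=\langle f,v\rangle\langle g,w\rangle$), and let $V^*$ carry the right action $\langle f\triangleleft h,v\rangle=\langle f,h\triangleright v\rangle$. For a linear endomorphism $\Psi$ of $V\otimes V$, write $\Psi_{i,i+1}$ for $\Psi$ acting in positions $i,i+1$ of $V^{\otimes n}$, put $$[n]_\Psi=\mathrm{id}+\Psi_{n-1,n}+\Psi_{n-1,n}\Psi_{n-2,n-1}+\dots+\Psi_{n-1,n}\cdots\Psi_{1,2},\qquad [n]!_\Psi=([1]_\Psi\otimes\mathrm{id}^{\otimes n-1})\circ([2]_\Psi\otimes\mathrm{id}^{\otimes n-2})\circ\dots\circ[n]_\Psi,$$ and let the Woronowicz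 symmetriser $\mathrm{Wor}(\Psi)\colon T(V)\to T(V)$ be the map equal to $[n]!_\Psi$ on $V^{\otimes n}$. Let $\widetilde A(V,\delta)$ be the algebra generated by $V$, $H$, $V^*$ subject to the relations of $H$ and to $hv=(h_{(1)}\triangleright v)h_{(2)}$, $fh=h_{(1)}(f\triangleleft h_{(2)})$, $fv-vf=v^{(-1)}\langle f,v^{(0)}\rangle$ for $v\in V$, $h\in H$, $f\in V^*$. A triangular ideal is a two-sided ideal of $\widetilde A(V,\delta)$ of the form $I^-\otimes H\otimes T(V^*)+T(V)\otimes H\otimes I^+$ with subspaces $I^-\subseteq T^{>0}(V)$, $I^+\subseteq T^{>0}(V^*)$ (tensors are viewed in $\widetilde A(V,\delta)$ through multiplication). Let $I(V,\delta)$ and $I(V^*,\delta)$ be the components of the sum of all triangular ideals, let $U(V,\delta)=T(V)/I(V,\delta)$ and $U(V^*,\delta)=T(V^*)/I(V^*,\delta)$, and let the minimal double $\bar A(V,\delta)$ be the quotient of $\widetilde A(V,\delta)$ by that sum. Then the sum of all triangular ideals is a triangular ideal with components $I(V,\delta)$, $I(V^*,\delta)$; the kernels of $\mathrm{Wor}(\Psi)$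 and $\mathrm{Wor}(\Psi^*)$ are two-sided ideals; $I(V,\delta)=\ker\mathrm{Wor}(\Psi)$ and $I(V^*,\delta)=\ker\mathrm{Wor}(\Psi^*)$, so that $$U(V,\delta)=\mathcal B(V,\Psi):=T(V)/\ker\mathrm{Wor}(\Psi),\qquad U(V^*,\delta)=\mathcal B(V^*,\Psi^*):=T(V^*)/\ker\mathrm{Wor}(\Psi^*)$$ are the Nichols–Woronowicz algebras; and the minimal double has triangular decomposition $$\bar A(V,\delta)=\mathcal B(V,\Psi)\rtimes H\ltimes\mathcal B(V^*,\Psi^*).$$ That is, multiplication induces a linear isomorphism $\mathcal B(V,\Psi)\otimes H\otimes\mathcal B(V^*,\Psi^*)\to\bar A(V,\delta)$; the actions of $H$ on $T(V)$ (left) and $T(V^*)$ (right) descend to covariant actions on $\mathcal B(V,\Psi)$ and $\mathcal B(V^*,\Psi^*)$; products in $\bar A(V,\delta)$ obey the semidirect product rules $hb=(h_{(1)}\triangleright b)h_{(2)}$ and $\varphi h=h_{(1)}(\varphi\triangleleft h_{(2)})$ for $b\in\mathcal B(V,\Psi)$, $\varphi\in\mathcal B(V^*,\Psi^*)$, $h\in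 H$; and the projections of $T(V)$, $T(V^*)$ to degree $0$ induce $H$-equivariant characters of $\mathcal B(V,\Psi)$, $\mathcal B(V^*,\Psi^*)$. -/

import Mathlib

open scoped TensorProduct

noncomputable section

namespace BraidedDouble

/-! ### Yetter–Drinfeld modules -/

section YetterDrinfeld

variable (k : Type*) [Field k] (H : Type*) [Ring H] [HopfAlgebra k H]
  (V : Type*) [AddCommGroup V] [Module k V] [Module H V] [IsScalarTower k H V]

/-- The left action `h ↦ (v ↦ h ▷ v)` of `H` on `V`, as a linear map. -/
def leftAction : H →ₗ[k] V →ₗ[k] V :=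
  (Algebra.lsmul k k V).toLinearMap

/-- The right action of `H` on `V^*`, `⟨f ◁ h, v⟩ = ⟨f, h ▷ v⟩`, written as `h ↦ (f ↦ f ◁ h)`. -/
def dualAction : H →ₗ[k] Module.Dual k V →ₗ[k] Module.Dual k V :=
  Module.Dual.transpose ∘ₗ leftAction k H V

variable {k H V}

/-- `δ : V → H ⊗ V`, `δ v = v⁽⁻¹⁾ ⊗ v⁽⁰⁾`, together with the given action of `H` on `V`, is a
(left-left) Yetter–Drinfeld structure on `V`. -/
structure IsYetterDrinfeld (δ : V →ₗ[k] H ⊗[k] V) : Prop where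
  /-- `δ` is coassociative. -/
  coassoc : ∀ v : V, TensorProduct.assoc k H H V
      (LinearMap.rTensor V (Coalgebra.comul (R := k) (A := H)) (δ v)) = LinearMap.lTensor H δ (δ v)
  /-- `δ` is counital. -/
  counit : ∀ v : V, LinearMap.rTensor V (Coalgebra.counit (R := k) (A := H)) (δ v) = 1 ⊗ₜ[k] v
  /-- The Yetter–Drinfeld compatibility condition
  `(h₁ ▷ v)⁽⁻¹⁾ h₂ ⊗ (h₁ ▷ v)⁽⁰⁾ = h₁ v⁽⁻¹⁾ ⊗ h₂ ▷ v⁽⁰⁾`. -/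
  compat : ∀ (h : H) (v : V),
    TensorProduct.lift
        ((LinearMap.rTensorHom V ∘ₗ (LinearMap.mul k H).flip).flip ∘ₗ
          δ ∘ₗ (leftAction k H V).flip v)
        (Coalgebra.comul (R := k) h) =
      TensorProduct.map₂ (LinearMap.mul k H) (leftAction k H V) (Coalgebra.comul (R := k) h) (δ v)

/-- The braiding `Ψ(v ⊗ w) = v⁽⁻¹⁾ ▷ w ⊗ v⁽⁰⁾` induced by `δ`. -/
def inducedBraiding (δ : V →ₗ[k] H ⊗[k] V) : V ⊗[k] V →ₗ[k] V ⊗[k] V :=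
  TensorProduct.lift ((LinearMap.rTensorHom V ∘ₗ (leftAction k H V).flip).flip ∘ₗ δ)

/-- The `H`-valued pairing `β(f, v) = v⁽⁻¹⁾ ⟨f, v⁽⁰⁾⟩`. -/
def pairing (δ : V →ₗ[k] H ⊗[k] V) (f : Module.Dual k V) (v : V) : H :=
  TensorProduct.rid k H (LinearMap.lTensor H f (δ v))

end YetterDrinfeld

/-! ### Actions on tensor algebras and triangular decomposition over `H` -/

section Triangular

variable {k : Type*} [Field k] {H : Type*} [Ring H] [HopfAlgebra k H]

/-- The extension of an action `h ↦ (v ↦ h · v)` from `V` to `T(V)` via the coproduct of `H`, that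
is, `h · (x y) = (h₁ · x) (h₂ · y)` and `h · 1 = ε(h) 1`. These two rules say that
`x ↦ (h ↦ h · x)` is the algebra map from `T(V)` to the convolution algebra `Hom(H, T(V))` that
extends `v ↦ (h ↦ h · v)`. The same formulas extend a right action of `H` (in which case `h · x`
stands for `x ◁ h`). -/
def tensorAction {V : Type*} [AddCommGroup V] [Module k V] (α : H →ₗ[k] V →ₗ[k] V) :
    H →ₗ[k] TensorAlgebra k V →ₗ[k] TensorAlgebra k V :=
  ((WithConv.linearEquiv k (H →ₗ[k] TensorAlgebra k V)).toLinearMap ∘ₗ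
    (TensorAlgebra.lift k
      ((WithConv.linearEquiv k (H →ₗ[k] TensorAlgebra k V)).symm.toLinearMap ∘ₗ
        (α.compr₂ (TensorAlgebra.ι k)).flip)).toLinearMap).flip

/-- The augmentation ideal `T^{>0}(V)` of the tensor algebra, as a subspace. -/
def tensorPos (k : Type*) [Field k] (V : Type*) [AddCommGroup V] [Module k V] :
    Submodule k (TensorAlgebra k V) :=
  LinearMap.ker (TensorAlgebra.algebraMapInv (R := k) (M := V)).toLinearMap

/-- For linear maps `i, j : H → A` into an algebra, the element `i(h₁) j(h₂)` of `A`. -/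
def sweedlerMul {A : Type*} [Ring A] [Algebra k A] (i j : H →ₗ[k] A) (h : H) : A :=
  LinearMap.mul' k A (TensorProduct.map i j (Coalgebra.comul (R := k) h))

/-- The multiplication map `U⁻ ⊗ H ⊗ U⁺ → A`, `x ⊗ h ⊗ y ↦ x h y`. -/
def tripleMul {Um Up A : Type*} [Ring Um] [Algebra k Um] [Ring Up] [Algebra k Up] [Ring A]
    [Algebra k A] (im : Um →ₐ[k] A) (iH : H →ₐ[k] A) (ip : Up →ₐ[k] A) :
    (Um ⊗[k] H) ⊗[k] Up →ₗ[k] A :=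
  LinearMap.mul' k A ∘ₗ TensorProduct.map
    (LinearMap.mul' k A ∘ₗ TensorProduct.map im.toLinearMap iH.toLinearMap) ip.toLinearMap

/-- `α : h ↦ (x ↦ h ▷ x)` is a covariant left action of `H` on the algebra `U`. -/
structure IsLeftModuleAlgebra {U : Type*} [Ring U] [Algebra k U]
    (α : H →ₗ[k] U →ₗ[k] U) : Prop where
  one_act : ∀ x, α 1 x = x
  mul_act : ∀ g h x, α (g * h) x = α g (α h x)
  act_one : ∀ h, α h 1 = algebraMap k U (Coalgebra.counit h)
  act_mul : ∀ h x y, α h (x * y) = sweedlerMul (α.flip x) (α.flip y) h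

/-- `α : h ↦ (x ↦ x ◁ h)` is a covariant right action of `H` on the algebra `U`. -/
structure IsRightModuleAlgebra {U : Type*} [Ring U] [Algebra k U]
    (α : H →ₗ[k] U →ₗ[k] U) : Prop where
  one_act : ∀ x, α 1 x = x
  mul_act : ∀ g h x, α (g * h) x = α h (α g x)
  act_one : ∀ h, α h 1 = algebraMap k U (Coalgebra.counit h)
  act_mul : ∀ h x y, α h (x * y) = sweedlerMul (α.flip x) (α.flip y) h

/-- Triangular decomposition `A = U⁻ ⋊ H ⋉ U⁺` over `H`: the algebra maps `im`, `iH`, `ip` of `U⁻`,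
`H`, `U⁺` to `A` induce, by multiplication, a linear isomorphism `U⁻ ⊗ H ⊗ U⁺ → A`; `H` acts
covariantly on `U⁻` from the left (by `αm`) and on `U⁺` from the right (by `αp`); the products
in `A` of `H` with `U⁻` and of `U⁺` with `H` are those of the semidirect products `U⁻ ⋊ H` and
`H ⋉ U⁺`; and `εm`, `εp` are `H`-equivariant characters of `U⁻`, `U⁺`. -/
structure IsTriangularDecomposition {Um Up A : Type*} [Ring Um] [Algebra k Um] [Ring Up]
    [Algebra k Up] [Ring A] [Algebra k A]
    (im : Um →ₐ[k] A) (iH : H →ₐ[k] A) (ip : Up →ₐ[k] A)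
    (αm : H →ₗ[k] Um →ₗ[k] Um) (αp : H →ₗ[k] Up →ₗ[k] Up)
    (εm : Um →ₐ[k] k) (εp : Up →ₐ[k] k) : Prop where
  left_action : IsLeftModuleAlgebra αm
  right_action : IsRightModuleAlgebra αp
  bijective : Function.Bijective (tripleMul im iH ip)
  /-- `h x = (h₁ ▷ x) h₂` for `x` in `U⁻`. -/
  left_semidirect : ∀ h x,
    iH h * im x = sweedlerMul (im.toLinearMap ∘ₗ αm.flip x) iH.toLinearMap h
  /-- `y h = h₁ (y ◁ h₂)` for `y` in `U⁺`. -/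
  right_semidirect : ∀ h y,
    ip y * iH h = sweedlerMul iH.toLinearMap (ip.toLinearMap ∘ₗ αp.flip y) h
  left_equivariant : ∀ h x, εm (αm h x) = Coalgebra.counit (R := k) h * εm x
  right_equivariant : ∀ h y, εp (αp h y) = Coalgebra.counit (R := k) h * εp y

end Triangular

/-! ### The free double -/

section FreeDouble

variable {k : Type*} [Field k] {H : Type*} [Ring H] [HopfAlgebra k H]
  {V : Type*} [AddCommGroup V] [Module k V] [Module H V] [IsScalarTower k H V]

variable (k H V) in
/-- The free algebra on the vector space of generators `V ⊕ H ⊕ V^*`. -/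
abbrev Gen : Type _ := TensorAlgebra k (V × H × Module.Dual k V)

variable (k H V) in
/-- The generators `v ∈ V`. -/
def genV : V →ₗ[k] Gen k H V :=
  TensorAlgebra.ι k ∘ₗ LinearMap.inl k V (H × Module.Dual k V)

variable (k H V) in
/-- The generators `h ∈ H`. -/
def genH : H →ₗ[k] Gen k H V :=
  TensorAlgebra.ι k ∘ₗ LinearMap.inr k V (H × Module.Dual k V) ∘ₗ
    LinearMap.inl k H (Module.Dual k V)

variable (k H V) in
/-- The generators `f ∈ V^*`. -/
def genD : Module.Dual k V →ₗ[k] Gen k H V :=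
  TensorAlgebra.ι k ∘ₗ LinearMap.inr k V (H × Module.Dual k V) ∘ₗ
    LinearMap.inr k H (Module.Dual k V)

/-- The defining relations of the free double: those of the algebra `H` (with its unity), and
`h v = (h₁ ▷ v) h₂`, `f h = h₁ (f ◁ h₂)`, `f v - v f = β(f, v)`. -/
inductive Rel (δ : V →ₗ[k] H ⊗[k] V) : Gen k H V → Gen k H V → Prop
  | one : Rel δ (genH k H V 1) 1
  | mul (g h : H) : Rel δ (genH k H V (g * h)) (genH k H V g * genH k H V h)
  | left (h : H) (v : V) : Rel δ (genH k H V h * genV k H V v)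
      (sweedlerMul (genV k H V ∘ₗ (leftAction k H V).flip v) (genH k H V) h)
  | right (f : Module.Dual k V) (h : H) : Rel δ (genD k H V f * genH k H V h)
      (sweedlerMul (genH k H V) (genD k H V ∘ₗ (dualAction k H V).flip f) h)
  | comm (f : Module.Dual k V) (v : V) :
      Rel δ (genD k H V f * genV k H V v - genV k H V v * genD k H V f)
        (genH k H V (pairing δ f v))

/-- The free double `Ã(V, δ)`, by generators and relations. -/
abbrev FreeDouble (δ : V →ₗ[k] H ⊗[k] V) : Type _ := RingQuot (Rel δ)

/-- `T(V) → Ã(V, δ)`. -/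
def freeV (δ : V →ₗ[k] H ⊗[k] V) : TensorAlgebra k V →ₐ[k] FreeDouble δ :=
  TensorAlgebra.lift k ((RingQuot.mkAlgHom k (Rel δ)).toLinearMap ∘ₗ genV k H V)

/-- `H → Ã(V, δ)`. -/
def freeH (δ : V →ₗ[k] H ⊗[k] V) : H →ₐ[k] FreeDouble δ :=
  AlgHom.ofLinearMap ((RingQuot.mkAlgHom k (Rel δ)).toLinearMap ∘ₗ genH k H V)
    (by
      have h := RingQuot.mkAlgHom_rel k (Rel.one (δ := δ))
      simpa using h)
    (by
      intro x y
      have h := RingQuot.mkAlgHom_rel k (Rel.mul (δ := δ) x y)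
      simpa using h)

/-- `T(V^*) → Ã(V, δ)`. -/
def freeD (δ : V →ₗ[k] H ⊗[k] V) : TensorAlgebra k (Module.Dual k V) →ₐ[k] FreeDouble δ :=
  TensorAlgebra.lift k ((RingQuot.mkAlgHom k (Rel δ)).toLinearMap ∘ₗ genD k H V)

/-! ### Triangular ideals and the minimal double -/

/-- The subspace `I⁻ ⊗ H ⊗ T(V^*) + T(V) ⊗ H ⊗ I⁺` of `Ã(V, δ)`, where `T(V) ⊗ H ⊗ T(V^*)` is
mapped to `Ã(V, δ)` by multiplication. -/
def triangularSubspace (δ : V →ₗ[k] H ⊗[k] V) (Im : Submodule k (TensorAlgebra k V))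
    (Ip : Submodule k (TensorAlgebra k (Module.Dual k V))) : Submodule k (FreeDouble δ) :=
  Submodule.map (tripleMul (freeV δ) (freeH δ) (freeD δ))
    (LinearMap.range (TensorProduct.map (TensorProduct.map Im.subtype (LinearMap.id (M := H)))
        (LinearMap.id (M := TensorAlgebra k (Module.Dual k V)))) ⊔
      LinearMap.range (TensorProduct.map
        (LinearMap.id (M := TensorAlgebra k V ⊗[k] H)) Ip.subtype))

/-- `J` is the triangular ideal of `Ã(V, δ)` with components `I⁻ ⊆ T^{>0}(V)`,
`I⁺ ⊆ T^{>0}(V^*)`. -/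
structure IsTriangularWith (δ : V →ₗ[k] H ⊗[k] V) (J : TwoSidedIdeal (FreeDouble δ))
    (Im : Submodule k (TensorAlgebra k V))
    (Ip : Submodule k (TensorAlgebra k (Module.Dual k V))) : Prop where
  left_le : Im ≤ tensorPos k V
  right_le : Ip ≤ tensorPos k (Module.Dual k V)
  coe_eq : (J : Set (FreeDouble δ)) = triangularSubspace δ Im Ip

/-- The two-sided ideal `J` of `Ã(V, δ)` is triangular. -/
def IsTriangular (δ : V →ₗ[k] H ⊗[k] V) (J : TwoSidedIdeal (FreeDouble δ)) : Prop :=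
  ∃ Im Ip, IsTriangularWith δ J Im Ip

/-- The sum of all triangular ideals of `Ã(V, δ)`. -/
def maxTriangular (δ : V →ₗ[k] H ⊗[k] V) : TwoSidedIdeal (FreeDouble δ) :=
  sSup {J | IsTriangular δ J}

/-- `I(V, δ)`: the component in `T(V)` of the sum of all triangular ideals. -/
def idealV (δ : V →ₗ[k] H ⊗[k] V) : Submodule k (TensorAlgebra k V) :=
  sSup {Im | ∃ J Ip, IsTriangularWith δ J Im Ip}

/-- `I(V^*, δ)`: the component in `T(V^*)` of the sum of all triangular ideals. -/
def idealD (δ : V →ₗ[k] H ⊗[k] V) : Submodule k (TensorAlgebra k (Module.Dual k V)) :=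
  sSup {Ip | ∃ J Im, IsTriangularWith δ J Im Ip}

/-- The minimal double `Ā(V, δ)`, the quotient of `Ã(V, δ)` by its largest triangular ideal. -/
abbrev MinimalDouble (δ : V →ₗ[k] H ⊗[k] V) : Type _ := (maxTriangular δ).ringCon.Quotient

/-- The quotient map `Ã(V, δ) → Ā(V, δ)`. -/
def toMinimal (δ : V →ₗ[k] H ⊗[k] V) : FreeDouble δ →ₐ[k] MinimalDouble δ :=
  (maxTriangular δ).ringCon.mkₐ k

end FreeDouble

/-! ### Quotient algebras -/

section Quotient

variable {k : Type*} [Field k] {A : Type*} [Ring A] [Algebra k A]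

/-- The quotient of `A` by the two-sided ideal generated by the subspace `S`. -/
abbrev QuotientBy (S : Submodule k A) : Type _ := (TwoSidedIdeal.span (S : Set A)).ringCon.Quotient

/-- The quotient map. -/
def toQuotient (S : Submodule k A) : A →ₐ[k] QuotientBy S :=
  (TwoSidedIdeal.span (S : Set A)).ringCon.mkₐ k

/-- The subspace `S` of `A` is a two-sided ideal. -/
def IsTwoSidedIdeal (S : Submodule k A) : Prop :=
  ∀ a : A, ∀ s ∈ S, a * s ∈ S ∧ s * a ∈ S

end Quotient

section U

variable {k : Type*} [Field k] {H : Type*} [Ring H] [HopfAlgebra k H]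
  {V : Type*} [AddCommGroup V] [Module k V] [Module H V] [IsScalarTower k H V]

/-- `U(V, δ) = T(V)/I(V, δ)`. -/
abbrev UV (δ : V →ₗ[k] H ⊗[k] V) : Type _ := QuotientBy (idealV δ)

/-- `U(V^*, δ) = T(V^*)/I(V^*, δ)`. -/
abbrev UD (δ : V →ₗ[k] H ⊗[k] V) : Type _ := QuotientBy (idealD δ)

end U

/-! ### The Woronowicz symmetriser and Nichols–Woronowicz algebras -/

section Woronowicz

variable {k : Type*} [Field k] {V : Type*} [AddCommGroup V] [Module k V]

/-- The bilinear map `(x, y) ↦ v₁ ⊗ ⋯ ⊗ x ⊗ ⋯ ⊗ y ⊗ ⋯ ⊗ vₙ`, with `x` at the position `i` and `y` at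
the position `j ≠ i`. -/
def insertPair {n : ℕ} {i j : Fin n} (hij : i ≠ j) (v : Fin n → V) :
    V →ₗ[k] V →ₗ[k] ⨂[k]^n V :=
  LinearMap.mk₂ k
    (fun x y => PiTensorProduct.tprod k (Function.update (Function.update v i x) j y))
    (fun x x' y => by
      simp only [Function.update_comm hij, MultilinearMap.map_update_add])
    (fun c x y => by
      simp only [Function.update_comm hij, MultilinearMap.map_update_smul])
    (fun x y y' => by simp only [MultilinearMap.map_update_add])
    (fun c x y => by simp only [MultilinearMap.map_update_smul])

theorem insertPair_apply {n : ℕ} {i j : Fin n} (hij : i ≠ j) (v : Fin n → V) (x y : V) :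
    insertPair (k := k) hij v x y =
      PiTensorProduct.tprod k (Function.update (Function.update v i x) j y) := rfl

theorem insertPair_update_left {n : ℕ} {i j : Fin n} (hij : i ≠ j) (v : Fin n → V) (x : V) :
    insertPair (k := k) hij (Function.update v i x) = insertPair hij v := by
  ext a b
  simp only [insertPair_apply, Function.update_idem]

theorem insertPair_update_right {n : ℕ} {i j : Fin n} (hij : i ≠ j) (v : Fin n → V) (x : V) :
    insertPair (k := k) hij (Function.update v j x) = insertPair hij v := by
  ext a b
  simp only [insertPair_apply, Function.update_comm hij, Function.update_idem]

theorem insertPair_update_add {n : ℕ} {i j l : Fin n} (hij : i ≠ j) (hi : l ≠ i) (hj : l ≠ j)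
    (v : Fin n → V) (x y : V) :
    insertPair (k := k) hij (Function.update v l (x + y)) =
      insertPair hij (Function.update v l x) + insertPair hij (Function.update v l y) := by
  ext a b
  simp only [insertPair_apply, LinearMap.add_apply, Function.update_comm hi,
    Function.update_comm hj, MultilinearMap.map_update_add]

theorem insertPair_update_smul {n : ℕ} {i j l : Fin n} (hij : i ≠ j) (hi : l ≠ i) (hj : l ≠ j)
    (v : Fin n → V) (c : k) (x : V) :
    insertPair (k := k) hij (Function.update v l (c • x)) =
      c • insertPair hij (Function.update v l x) := by
  ext a b
  simp only [insertPair_apply, LinearMap.smul_apply, Function.update_comm hi,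
    Function.update_comm hj, MultilinearMap.map_update_smul]

theorem lift_add' {M N P : Type*} [AddCommGroup M] [Module k M] [AddCommGroup N] [Module k N]
    [AddCommGroup P] [Module k P] (f g : M →ₗ[k] N →ₗ[k] P) :
    TensorProduct.lift (f + g) = TensorProduct.lift f + TensorProduct.lift g := by
  ext a b
  simp

theorem lift_smul' {M N P : Type*} [AddCommGroup M] [Module k M] [AddCommGroup N] [Module k N]
    [AddCommGroup P] [Module k P] (c : k) (f : M →ₗ[k] N →ₗ[k] P) :
    TensorProduct.lift (c • f) = c • TensorProduct.lift f := by
  ext a b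
  simp

/-- Leg notation: the operator `Ψ_{i,j}` on `V^{⊗n}`, which applies `Ψ` at the positions `i`, `j`. -/
def leg (Ψ : V ⊗[k] V →ₗ[k] V ⊗[k] V) {n : ℕ} {i j : Fin n} (hij : i ≠ j) :
    ⨂[k]^n V →ₗ[k] ⨂[k]^n V :=
  PiTensorProduct.lift
    { toFun := fun v => TensorProduct.lift (insertPair hij v) (Ψ (v i ⊗ₜ[k] v j))
      map_update_add' := by
        intro inst v l x y
        obtain rfl := Subsingleton.elim inst (instDecidableEqFin n)
        rcases eq_or_ne l i with rfl | hi
        · simp [insertPair_update_left, Function.update_of_ne hij.symm, TensorProduct.add_tmul]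
        · rcases eq_or_ne l j with rfl | hj
          · simp [insertPair_update_right, Function.update_of_ne hij, TensorProduct.tmul_add]
          · simp [insertPair_update_add hij hi hj, Function.update_of_ne hi.symm,
              Function.update_of_ne hj.symm, lift_add']
      map_update_smul' := by
        intro inst v l c x
        obtain rfl := Subsingleton.elim inst (instDecidableEqFin n)
        rcases eq_or_ne l i with rfl | hi
        · simp [insertPair_update_left, Function.update_of_ne hij.symm, ← TensorProduct.smul_tmul']
        · rcases eq_or_ne l j with rfl | hj
          · simp [insertPair_update_right, Function.update_of_ne hij]
          · simp [insertPair_update_smul hij hi hj, Function.update_of_ne hi.symm,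
              Function.update_of_ne hj.symm, lift_smul'] }

/-- `Ψ_{i+1,i+2}` on `V^{⊗(n+1)}` (with factors numbered from `1`), for `i = 0, …, n-1`. -/
def adjLeg (Ψ : V ⊗[k] V →ₗ[k] V ⊗[k] V) {n : ℕ} (i : Fin n) :
    Module.End k (⨂[k]^(n + 1) V) :=
  leg Ψ (Fin.castSucc_lt_succ (i := i)).ne

/-- The braided integer
`[n+1]_Ψ = id + Ψ_{n,n+1} + Ψ_{n,n+1} Ψ_{n-1,n} + ⋯ + Ψ_{n,n+1} Ψ_{n-1,n} ⋯ Ψ_{1,2}`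
on `V^{⊗(n+1)}`; the summand with `j` factors is the product of the first `j` terms of the list
`Ψ_{n,n+1}, Ψ_{n-1,n}, …, Ψ_{1,2}`. -/
def braidedInt (Ψ : V ⊗[k] V →ₗ[k] V ⊗[k] V) (n : ℕ) : Module.End k (⨂[k]^(n + 1) V) :=
  ∑ j ∈ Finset.range (n + 1), (((List.finRange n).reverse.map (adjLeg Ψ)).take j).prod

/-- `F ⊗ id_V` on `V^{⊗(n+1)} = V^{⊗n} ⊗ V`. -/
def tensorId {n : ℕ} (F : Module.End k (⨂[k]^n V)) : Module.End k (⨂[k]^(n + 1) V) :=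
  TensorPower.mulEquiv.toLinearMap ∘ₗ LinearMap.rTensor (⨂[k]^1 V) F ∘ₗ
    TensorPower.mulEquiv.symm.toLinearMap

/-- The braided factorial `[n]!_Ψ = ([1]_Ψ ⊗ id^{n-1}) ∘ ([2]_Ψ ⊗ id^{n-2}) ∘ ⋯ ∘ [n]_Ψ`. -/
def braidedFactorial (Ψ : V ⊗[k] V →ₗ[k] V ⊗[k] V) : (n : ℕ) → Module.End k (⨂[k]^n V)
  | 0 => LinearMap.id
  | n + 1 => tensorId (braidedFactorial Ψ n) ∘ₗ braidedInt Ψ n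

/-- The Woronowicz symmetriser `Wor(Ψ) : T(V) → T(V)`, equal to `[n]!_Ψ` on `V^{⊗n}`. -/
def woronowicz (Ψ : V ⊗[k] V →ₗ[k] V ⊗[k] V) : TensorAlgebra k V →ₗ[k] TensorAlgebra k V :=
  TensorAlgebra.equivDirectSum.symm.toLinearMap ∘ₗ
    DirectSum.lmap (braidedFactorial Ψ) ∘ₗ TensorAlgebra.equivDirectSum.toLinearMap

/-- The Nichols–Woronowicz algebra `B(V, Ψ) = T(V)/ker Wor(Ψ)`. -/
abbrev Nichols (Ψ : V ⊗[k] V →ₗ[k] V ⊗[k] V) : Type _ := QuotientBy (LinearMap.ker (woronowicz Ψ))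

/-- `Ψ^*` on `V^* ⊗ V^*`, where `V^* ⊗ V^*` is identified with the dual of `V ⊗ V` by
`⟨f ⊗ g, v ⊗ w⟩ = ⟨f, v⟩ ⟨g, w⟩`. -/
def dualBraiding [FiniteDimensional k V] (Ψ : V ⊗[k] V →ₗ[k] V ⊗[k] V) :
    Module.Dual k V ⊗[k] Module.Dual k V →ₗ[k] Module.Dual k V ⊗[k] Module.Dual k V :=
  (TensorProduct.dualDistribEquiv k V V).symm.toLinearMap ∘ₗ Ψ.dualMap ∘ₗ
    (TensorProduct.dualDistribEquiv k V V).toLinearMap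

end Woronowicz

end BraidedDouble

end

/-!
By the Yetter–Drinfeld compatibility the free double acts on `T(V) ⊗ H ⊗ T(V^*)`, where `f ∈ V^*`
moves past `T(V)` by a skew derivation; applying this representation to `1` shows that the
multiplication map `T(V) ⊗ H ⊗ T(V^*) → Ã(V, δ)` is bijective. The functional
`x h y ↦ ε(x) ε(h) ε(y)` on `Ã(V, δ)` therefore exists, and its values on the products `y x` form a
pairing of `T(V^*)` with `T(V)`. A triangular ideal is killed by this functional, and is stable
under multiplication, so its components lie in the radicals of the pairing; conversely the radicals
are themselves the components of a triangular ideal, because a commutator `[f, x]` with `x` in the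
radical stays in the radical.

On `V^{⊗n}` the skew derivation is the braided integer `[n]_Ψ` followed by splitting off the last
factor. Hence the pairing of `V^{*⊗n}` with `V^{⊗n}` is the canonical one twisted by `[n]!_Ψ`, whose
adjoint is `[n]!_{Ψ^*}`, and the two radicals are the kernels of `Wor(Ψ)` and `Wor(Ψ^*)`.
-/

noncomputable section

namespace BraidedDouble

open WithConv
open scoped Coalgebra

/-! ### Tensor algebras and convolution -/

section TensorAlgebra

variable {R : Type*} [CommSemiring R] {V : Type*} [AddCommMonoid V] [Module R V]

theorem tensorAlgebra_mem_of_ι_mul_mem (S : Submodule R (TensorAlgebra R V)) (one_mem : 1 ∈ S)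
    (ι_mul_mem : ∀ v, ∀ x ∈ S, TensorAlgebra.ι R v * x ∈ S) (x : TensorAlgebra R V) : x ∈ S := by
  suffices h : ∀ x : TensorAlgebra R V, ∀ y ∈ S, x * y ∈ S by simpa using h x 1 one_mem
  intro x
  induction x using TensorAlgebra.induction with
  | algebraMap r => intro y hy; simpa [Algebra.algebraMap_eq_smul_one] using S.smul_mem r hy
  | ι v => exact ι_mul_mem v
  | mul a b ha hb => intro y hy; rw [mul_assoc]; exact ha _ (hb _ hy)
  | add a b ha hb => intro y hy; rw [add_mul]; exact S.add_mem (ha _ hy) (hb _ hy)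

theorem tensorAlgebra_linearMap_ext_ι_mul {M : Type*} [AddCommMonoid M] [Module R M]
    (F G : TensorAlgebra R V →ₗ[R] M) (map_one : F 1 = G 1)
    (map_ι_mul : ∀ v x, F x = G x → F (TensorAlgebra.ι R v * x) = G (TensorAlgebra.ι R v * x)) :
    F = G :=
  LinearMap.ext <| tensorAlgebra_mem_of_ι_mul_mem (LinearMap.eqLocus F G) map_one map_ι_mul

theorem tensorAlgebra_semiconjBy {B : Type*} [Semiring B] [Algebra R B]
    (f g : TensorAlgebra R V →ₐ[R] B) (b : B)
    (semiconjBy_ι : ∀ v, SemiconjBy b (f (TensorAlgebra.ι R v)) (g (TensorAlgebra.ι R v)))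
    (x : TensorAlgebra R V) : SemiconjBy b (f x) (g x) := by
  induction x using TensorAlgebra.induction with
  | algebraMap r =>
    rw [AlgHom.commutes, AlgHom.commutes]
    exact Algebra.commute_algebraMap_right r b
  | ι v => exact semiconjBy_ι v
  | mul x y hx hy => simpa only [map_mul] using hx.mul_right hy
  | add x y hx hy => simpa only [map_add] using hx.add_right hy

variable {M : Type*} [AddCommMonoid M] [Module R M]

/-- The operator `(x, m) ↦ (v x, B(v, x) + L(v) m)` on `T(V) × M`, one step of the recursion
`tensorRec`. -/
def tensorRecStep (B : V →ₗ[R] TensorAlgebra R V →ₗ[R] M) (L : V →ₗ[R] Module.End R M) :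
    V →ₗ[R] Module.End R (TensorAlgebra R V × M) where
  toFun v := ((LinearMap.mulLeft R (TensorAlgebra.ι R v)) ∘ₗ LinearMap.fst R _ _).prod
    (B v ∘ₗ LinearMap.fst R _ _ + L v ∘ₗ LinearMap.snd R _ _)
  map_add' v w := by ext <;> simp [add_mul]
  map_smul' c v := by ext <;> simp

/-- The linear map `D : T(V) → M` determined by `D(1) = 0` and `D(v x) = B(v, x) + L(v) D(x)`. -/
def tensorRec (B : V →ₗ[R] TensorAlgebra R V →ₗ[R] M) (L : V →ₗ[R] Module.End R M) :
    TensorAlgebra R V →ₗ[R] M :=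
  LinearMap.snd R _ _ ∘ₗ LinearMap.applyₗ ((1 : TensorAlgebra R V), (0 : M)) ∘ₗ
    (TensorAlgebra.lift R (tensorRecStep B L)).toLinearMap

variable (B : V →ₗ[R] TensorAlgebra R V →ₗ[R] M) (L : V →ₗ[R] Module.End R M)

theorem lift_tensorRecStep_fst (x : TensorAlgebra R V) :
    (TensorAlgebra.lift R (tensorRecStep B L) x (1, 0)).1 = x := by
  refine LinearMap.congr_fun (tensorAlgebra_linearMap_ext_ι_mul
    (LinearMap.fst R _ _ ∘ₗ LinearMap.applyₗ ((1 : TensorAlgebra R V), (0 : M)) ∘ₗ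
      (TensorAlgebra.lift R (tensorRecStep B L)).toLinearMap)
    LinearMap.id (by simp) fun v x hx => ?_) x
  simp only [LinearMap.comp_apply, LinearMap.applyₗ_apply_apply, AlgHom.toLinearMap_apply,
    LinearMap.fst_apply, LinearMap.id_apply, map_mul, TensorAlgebra.lift_ι_apply,
    Module.End.mul_apply] at hx ⊢
  exact congrArg (TensorAlgebra.ι R v * ·) hx

theorem tensorRec_one : tensorRec B L 1 = 0 := by
  simp [tensorRec]

theorem tensorRec_ι_mul (v : V) (x : TensorAlgebra R V) :
    tensorRec B L (TensorAlgebra.ι R v * x) = B v x + L v (tensorRec B L x) := by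
  have step : tensorRec B L (TensorAlgebra.ι R v * x) =
      B v (TensorAlgebra.lift R (tensorRecStep B L) x (1, 0)).1 + L v (tensorRec B L x) := by
    simp only [tensorRec, LinearMap.comp_apply, AlgHom.toLinearMap_apply, map_mul,
      TensorAlgebra.lift_ι_apply]
    rfl
  rw [step, lift_tensorRecStep_fst]

end TensorAlgebra

section Convolution

variable {R : Type*} [CommSemiring R] {C : Type*} [AddCommMonoid C] [Module R C] [Coalgebra R C]
  {A B : Type*} [Semiring A] [Algebra R A] [Semiring B] [Algebra R B]

theorem comul_eq_sum (c : C) :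
    Coalgebra.comul (R := R) c = ∑ p ∈ (ℛ R c).index, (ℛ R c).left p ⊗ₜ[R] (ℛ R c).right p :=
  (ℛ R c).eq.symm

theorem sum_counit_right_smul_map {M : Type*} [AddCommMonoid M] [Module R M] (F : C →ₗ[R] M)
    (c : C) :
    ∑ p ∈ (ℛ R c).index, Coalgebra.counit (R := R) ((ℛ R c).right p) • F ((ℛ R c).left p) =
      F c := by
  simpa only [map_sum, TensorProduct.rid_tmul, one_smul] using
    congrArg (TensorProduct.rid R M) (Coalgebra.sum_map_tmul_counit_eq F c (repr := ℛ R c))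

theorem sum_counit_left_smul_map {M : Type*} [AddCommMonoid M] [Module R M] (F : C →ₗ[R] M)
    (c : C) :
    ∑ p ∈ (ℛ R c).index, Coalgebra.counit (R := R) ((ℛ R c).left p) • F ((ℛ R c).right p) =
      F c := by
  simpa only [map_sum, TensorProduct.lid_tmul, one_smul] using
    congrArg (TensorProduct.lid R M) (Coalgebra.sum_counit_tmul_map_eq F c (repr := ℛ R c))

variable (R C) in
/-- The constants `a ↦ (c ↦ ε(c) a)` of the convolution algebra `Hom(C, A)`. -/
def convConst : A →ₐ[R] WithConv (C →ₗ[R] A) :=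
  AlgHom.ofLinearMap
    ((WithConv.linearEquiv R (C →ₗ[R] A)).symm.toLinearMap ∘ₗ
      LinearMap.smulRightₗ (Coalgebra.counit (R := R) (A := C)))
    (WithConv.ext <| LinearMap.ext fun c => by simp [Algebra.algebraMap_eq_smul_one])
    fun a b => WithConv.ext <| LinearMap.ext fun c => by
      have h := sum_counit_left_smul_map (Coalgebra.counit (R := R)) c
      simp [Coalgebra.Repr.convMul_apply (ℛ R c), smul_smul, ← Finset.sum_smul, ← h, mul_comm]

theorem convConst_apply (a : A) (c : C) :
    convConst R C a c = Coalgebra.counit (R := R) c • a := rfl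

theorem convMul_convConst_apply (F : WithConv (C →ₗ[R] A)) (a : A) (c : C) :
    (F * convConst R C a) c = F c * a := by
  have h := sum_counit_right_smul_map (LinearMap.mulRight R a ∘ₗ F.ofConv) c
  rw [Coalgebra.Repr.convMul_apply (ℛ R c)]
  simpa [convConst_apply] using h

theorem convConst_convMul_apply (F : WithConv (C →ₗ[R] A)) (a : A) (c : C) :
    (convConst R C a * F) c = a * F c := by
  have h := sum_counit_left_smul_map (LinearMap.mulLeft R a ∘ₗ F.ofConv) c
  rw [Coalgebra.Repr.convMul_apply (ℛ R c)]
  simpa [convConst_apply] using h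

variable (C) in
/-- The map of convolution algebras `Hom(C, A) → Hom(C, B)` induced by `φ : A → B`. -/
def convMap (φ : A →ₐ[R] B) : WithConv (C →ₗ[R] A) →ₐ[R] WithConv (C →ₗ[R] B) :=
  AlgHom.ofLinearMap
    ((WithConv.linearEquiv R (C →ₗ[R] B)).symm.toLinearMap ∘ₗ φ.toLinearMap.compRight R ∘ₗ
      (WithConv.linearEquiv R (C →ₗ[R] A)).toLinearMap)
    (WithConv.ext <| LinearMap.ext fun c => by simp)
    fun F G => WithConv.ext <| LinearMap.algHom_comp_convMul_distrib φ F G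

end Convolution

/-! ### Actions of `H` on tensor algebras -/

section Action

variable {k : Type*} [Field k] {H : Type*} [Ring H] [HopfAlgebra k H]

theorem sweedlerMul_eq_sum {A : Type*} [Ring A] [Algebra k A] (i j : H →ₗ[k] A) (h : H) :
    sweedlerMul i j h = ∑ p ∈ (ℛ k h).index, i ((ℛ k h).left p) * j ((ℛ k h).right p) :=
  Coalgebra.Repr.convMul_apply (ℛ k h) (toConv i) (toConv j)

theorem sweedlerMul_mul {A : Type*} [Ring A] [Algebra k A] (i j : H →ₗ[k] A) (g h : H) :
    sweedlerMul i j (g * h) = ∑ p ∈ (ℛ k g).index, ∑ q ∈ (ℛ k h).index,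
      i ((ℛ k g).left p * (ℛ k h).left q) * j ((ℛ k g).right p * (ℛ k h).right q) := by
  rw [sweedlerMul, Bialgebra.comul_mul, comul_eq_sum g, comul_eq_sum h]
  simp only [Finset.sum_mul_sum, Algebra.TensorProduct.tmul_mul_tmul, map_sum,
    TensorProduct.map_tmul, LinearMap.mul'_apply]

theorem map_sweedlerMul {A B : Type*} [Ring A] [Algebra k A] [Ring B] [Algebra k B]
    (φ : A →ₐ[k] B) (i j : H →ₗ[k] A) (h : H) :
    φ (sweedlerMul i j h) = sweedlerMul (φ.toLinearMap ∘ₗ i) (φ.toLinearMap ∘ₗ j) h := by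
  simp only [sweedlerMul_eq_sum, map_sum, map_mul, LinearMap.comp_apply, AlgHom.toLinearMap_apply]

variable {V : Type*} [AddCommGroup V] [Module k V] (α : H →ₗ[k] V →ₗ[k] V)

/-- The algebra map `x ↦ (h ↦ h · x)` from `T(V)` to the convolution algebra `Hom(H, T(V))`. -/
def tensorConv : TensorAlgebra k V →ₐ[k] WithConv (H →ₗ[k] TensorAlgebra k V) :=
  TensorAlgebra.lift k
    ((WithConv.linearEquiv k (H →ₗ[k] TensorAlgebra k V)).symm.toLinearMap ∘ₗ
      (α.compr₂ (TensorAlgebra.ι k)).flip)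

theorem tensorConv_apply (x : TensorAlgebra k V) (h : H) :
    tensorConv α x h = tensorAction α h x := rfl

@[simp]
theorem tensorAction_ι (h : H) (v : V) :
    tensorAction α h (TensorAlgebra.ι k v) = TensorAlgebra.ι k (α h v) := by
  rw [← tensorConv_apply]
  simp [tensorConv]

theorem tensorAction_one (h : H) :
    tensorAction α h 1 = algebraMap k _ (Coalgebra.counit (R := k) h) := by
  rw [← tensorConv_apply, map_one]
  rfl

theorem tensorAction_mul (h : H) (x y : TensorAlgebra k V) :
    tensorAction α h (x * y) =
      sweedlerMul ((tensorAction α).flip x) ((tensorAction α).flip y) h := by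
  rw [← tensorConv_apply, map_mul]
  rfl

theorem tensorAction_mul_eq_sum (h : H) (x y : TensorAlgebra k V) :
    tensorAction α h (x * y) = ∑ p ∈ (ℛ k h).index,
      tensorAction α ((ℛ k h).left p) x * tensorAction α ((ℛ k h).right p) y := by
  simp only [tensorAction_mul, sweedlerMul_eq_sum, LinearMap.flip_apply]

theorem one_tensorAction (one_act : ∀ v, α 1 v = v) (x : TensorAlgebra k V) :
    tensorAction α 1 x = x := by
  refine LinearMap.congr_fun (tensorAlgebra_linearMap_ext_ι_mul (tensorAction α 1) LinearMap.id
    (by simp [tensorAction_one]) fun v x hx => ?_) x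
  rw [LinearMap.id_apply] at hx
  simp [tensorAction_mul, sweedlerMul, Algebra.TensorProduct.one_def, one_act, hx]

theorem mul_tensorAction_of_left (mul_act : ∀ g h v, α (g * h) v = α g (α h v)) (g h : H)
    (x : TensorAlgebra k V) :
    tensorAction α (g * h) x = tensorAction α g (tensorAction α h x) := by
  induction x using TensorAlgebra.induction generalizing g h with
  | algebraMap r =>
    simp [Algebra.algebraMap_eq_smul_one, tensorAction_one, smul_smul, mul_comm, mul_left_comm]
  | ι v => simp [mul_act]
  | mul a b ha hb =>
    rw [tensorAction_mul, sweedlerMul_mul, tensorAction_mul_eq_sum, map_sum, Finset.sum_comm]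
    simp only [tensorAction_mul_eq_sum, LinearMap.flip_apply, ha, hb]
  | add a b ha hb => simp only [map_add, ha, hb]

theorem mul_tensorAction_of_right (mul_act : ∀ g h v, α (g * h) v = α h (α g v)) (g h : H)
    (x : TensorAlgebra k V) :
    tensorAction α (g * h) x = tensorAction α h (tensorAction α g x) := by
  induction x using TensorAlgebra.induction generalizing g h with
  | algebraMap r =>
    simp [Algebra.algebraMap_eq_smul_one, tensorAction_one, smul_smul, mul_assoc]
  | ι v => simp [mul_act]
  | mul a b ha hb =>
    rw [tensorAction_mul, sweedlerMul_mul, tensorAction_mul_eq_sum, map_sum]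
    simp only [tensorAction_mul_eq_sum, LinearMap.flip_apply, ha, hb]
  | add a b ha hb => simp only [map_add, ha, hb]

theorem algebraMapInv_tensorAction (h : H) (x : TensorAlgebra k V) :
    TensorAlgebra.algebraMapInv (tensorAction α h x) =
      Coalgebra.counit (R := k) h * TensorAlgebra.algebraMapInv x := by
  have key : (convMap H TensorAlgebra.algebraMapInv).comp (tensorConv α) =
      (convConst k H).comp TensorAlgebra.algebraMapInv := by
    ext v h
    simp [convMap, tensorConv, TensorAlgebra.algebraMapInv]
  exact LinearMap.congr_fun (congrArg ofConv (AlgHom.congr_fun key x)) h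

theorem isLeftModuleAlgebra_tensorAction (one_act : ∀ v, α 1 v = v)
    (mul_act : ∀ g h v, α (g * h) v = α g (α h v)) : IsLeftModuleAlgebra (tensorAction α) where
  one_act := one_tensorAction α one_act
  mul_act := mul_tensorAction_of_left α mul_act
  act_one := tensorAction_one α
  act_mul := tensorAction_mul α

theorem isRightModuleAlgebra_tensorAction (one_act : ∀ v, α 1 v = v)
    (mul_act : ∀ g h v, α (g * h) v = α h (α g v)) : IsRightModuleAlgebra (tensorAction α) where
  one_act := one_tensorAction α one_act
  mul_act := mul_tensorAction_of_right α mul_act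
  act_one := tensorAction_one α
  act_mul := tensorAction_mul α

end Action

section Pairing

variable {k : Type*} [Field k] {H : Type*} [Ring H] [HopfAlgebra k H]
  {V : Type*} [AddCommGroup V] [Module k V]

/-- The pairing `β(f, v) = v⁽⁻¹⁾ ⟨f, v⁽⁰⁾⟩` as a bilinear map. -/
def pairingLin (δ : V →ₗ[k] H ⊗[k] V) : Module.Dual k V →ₗ[k] V →ₗ[k] H :=
  LinearMap.lcomp k H δ ∘ₗ
    LinearMap.llcomp k (H ⊗[k] V) (H ⊗[k] k) H (TensorProduct.rid k H).toLinearMap ∘ₗ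
      LinearMap.lTensorHom H

@[simp]
theorem pairingLin_apply (δ : V →ₗ[k] H ⊗[k] V) (f : Module.Dual k V) (v : V) :
    pairingLin δ f v = pairing δ f v := rfl

end Pairing

section YetterDrinfeld

variable {k : Type*} [Field k] {H : Type*} [Ring H] [HopfAlgebra k H]
  {V : Type*} [AddCommGroup V] [Module k V] [Module H V] [IsScalarTower k H V]

@[simp]
theorem leftAction_apply (h : H) (v : V) : leftAction k H V h v = h • v := rfl

@[simp]
theorem dualAction_apply (h : H) (f : Module.Dual k V) (v : V) :
    dualAction k H V h f v = f (h • v) := rfl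

variable (k H V) in
/-- The left action of `H` on `T(V)`. -/
abbrev leftT : H →ₗ[k] TensorAlgebra k V →ₗ[k] TensorAlgebra k V :=
  tensorAction (leftAction k H V)

variable (k H V) in
/-- The right action of `H` on `T(V^*)`. -/
abbrev dualT : H →ₗ[k] TensorAlgebra k (Module.Dual k V) →ₗ[k]
    TensorAlgebra k (Module.Dual k V) :=
  tensorAction (dualAction k H V)

theorem isLeftModuleAlgebra_leftT : IsLeftModuleAlgebra (leftT k H V) :=
  isLeftModuleAlgebra_tensorAction _ (fun v => by simp) (fun g h v => by simp [mul_smul])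

theorem isRightModuleAlgebra_dualT : IsRightModuleAlgebra (dualT k H V) :=
  isRightModuleAlgebra_tensorAction _ (fun f => by ext; simp) (fun g h f => by ext; simp [mul_smul])

variable {δ : V →ₗ[k] H ⊗[k] V} (hδ : IsYetterDrinfeld δ)

include hδ

theorem rTensor_comp_comul_coaction {M : Type*} [AddCommMonoid M] [Module k M]
    (F : H ⊗[k] H →ₗ[k] M) (v : V) :
    LinearMap.rTensor V (F ∘ₗ Coalgebra.comul (R := k)) (δ v) =
      LinearMap.rTensor V F ((TensorProduct.assoc k H H V).symm (LinearMap.lTensor H δ (δ v))) := by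
  rw [← hδ.coassoc, LinearEquiv.symm_apply_apply, LinearMap.rTensor_comp, LinearMap.comp_apply]

theorem comul_pairing (f : Module.Dual k V) (v : V) :
    Coalgebra.comul (R := k) (pairing δ f v) = LinearMap.lTensor H (pairingLin δ f) (δ v) := by
  have comul_contract : Coalgebra.comul (R := k) ∘ₗ (TensorProduct.rid k H).toLinearMap ∘ₗ
      LinearMap.lTensor H f =
      LinearMap.lTensor H ((TensorProduct.rid k H).toLinearMap ∘ₗ LinearMap.lTensor H f) ∘ₗ
        (TensorProduct.assoc k H H V).toLinearMap ∘ₗ LinearMap.rTensor V Coalgebra.comul := by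
    refine TensorProduct.ext' fun h v => ?_
    simp [comul_eq_sum h, TensorProduct.sum_tmul, Finset.smul_sum]
  refine (LinearMap.congr_fun comul_contract (δ v)).trans ?_
  simp only [LinearMap.comp_apply, LinearEquiv.coe_coe, hδ.coassoc]
  rw [← LinearMap.comp_apply, ← LinearMap.lTensor_comp]
  rfl

theorem counit_pairing (f : Module.Dual k V) (v : V) :
    Coalgebra.counit (R := k) (pairing δ f v) = f v := by
  have counit_contract : Coalgebra.counit (R := k) ∘ₗ (TensorProduct.rid k H).toLinearMap ∘ₗ
      LinearMap.lTensor H f = (TensorProduct.lid k k).toLinearMap ∘ₗ LinearMap.lTensor k f ∘ₗ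
        LinearMap.rTensor V Coalgebra.counit :=
    TensorProduct.ext' fun h v => by simp [mul_comm]
  refine (LinearMap.congr_fun counit_contract (δ v)).trans ?_
  simp only [LinearMap.comp_apply, hδ.counit]
  simp

theorem compat_sum (h : H) (v : V) :
    ∑ p ∈ (ℛ k h).index,
      LinearMap.rTensor V ((LinearMap.mul k H).flip ((ℛ k h).right p)) (δ ((ℛ k h).left p • v)) =
    ∑ p ∈ (ℛ k h).index,
      TensorProduct.map (LinearMap.mul k H ((ℛ k h).left p))
        (leftAction k H V ((ℛ k h).right p)) (δ v) := by
  have compat := hδ.compat h v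
  rw [comul_eq_sum h] at compat
  simpa only [map_sum, LinearMap.sum_apply, TensorProduct.lift.tmul,
    TensorProduct.map₂_apply_tmul, LinearMap.comp_apply, LinearMap.flip_apply,
    leftAction_apply, LinearMap.coe_rTensorHom] using compat

theorem sweedlerMul_pairing (f : Module.Dual k V) (v : V) :
    sweedlerMul (pairingLin δ f ∘ₗ (leftAction k H V).flip v) LinearMap.id =
      sweedlerMul LinearMap.id ((pairingLin δ).flip v ∘ₗ (dualAction k H V).flip f) := by
  have contract_mul_right (g : H) : (TensorProduct.rid k H).toLinearMap ∘ₗ LinearMap.lTensor H f ∘ₗ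
      LinearMap.rTensor V ((LinearMap.mul k H).flip g) = LinearMap.mulRight k g ∘ₗ
        (TensorProduct.rid k H).toLinearMap ∘ₗ LinearMap.lTensor H f :=
    TensorProduct.ext' fun h v => by simp
  have contract_mul_left (g g' : H) : (TensorProduct.rid k H).toLinearMap ∘ₗ
      LinearMap.lTensor H f ∘ₗ TensorProduct.map (LinearMap.mul k H g) (leftAction k H V g') =
      LinearMap.mulLeft k g ∘ₗ (TensorProduct.rid k H).toLinearMap ∘ₗ
        LinearMap.lTensor H (dualAction k H V g' f) :=
    TensorProduct.ext' fun h v => by simp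
  funext h
  have contracted := congrArg ((TensorProduct.rid k H).toLinearMap ∘ₗ LinearMap.lTensor H f)
    (compat_sum hδ h v)
  simp only [map_sum] at contracted
  rw [sweedlerMul_eq_sum, sweedlerMul_eq_sum]
  refine (Finset.sum_congr rfl fun p _ => ?_).trans
    (contracted.trans (Finset.sum_congr rfl fun p _ => ?_))
  · exact (LinearMap.congr_fun (contract_mul_right _) _).symm
  · exact LinearMap.congr_fun (contract_mul_left _ _) _

end YetterDrinfeld

/-! ### Skew derivations of `T(V)` -/

section Diagonal

variable {k : Type*} [Field k] {H : Type*} [Ring H] [HopfAlgebra k H]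
  {V : Type*} [AddCommGroup V] [Module k V] [Module H V] [IsScalarTower k H V]
  {N : Type*} [AddCommGroup N] [Module k N]

variable (k H V) in
/-- `leftT` as a representation of `H` on `T(V)`. -/
def leftTHom : H →ₐ[k] Module.End k (TensorAlgebra k V) :=
  AlgHom.ofLinearMap (leftT k H V) (LinearMap.ext isLeftModuleAlgebra_leftT.one_act)
    fun g h => LinearMap.ext (isLeftModuleAlgebra_leftT.mul_act g h)

/-- The diagonal representation `h (x ⊗ n) = h₁ x ⊗ h₂ n` of `H` on `T(V) ⊗ N`. -/
def diagAction (ρ : H →ₐ[k] Module.End k N) : H →ₐ[k] Module.End k (TensorAlgebra k V ⊗[k] N) :=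
  (Module.endTensorEndAlgHom (R := k) (S := k) (A := k)).comp
    ((Algebra.TensorProduct.map (leftTHom k H V) ρ).comp (Bialgebra.comulAlgHom k H))

theorem diagAction_apply (ρ : H →ₐ[k] Module.End k N) (h : H) (t : TensorAlgebra k V ⊗[k] N) :
    diagAction ρ h t = ∑ p ∈ (ℛ k h).index,
      TensorProduct.map (leftT k H V ((ℛ k h).left p)) (ρ ((ℛ k h).right p)) t := by
  simp only [diagAction, AlgHom.comp_apply, Bialgebra.comulAlgHom_apply, comul_eq_sum h, map_sum,
    LinearMap.sum_apply]
  rfl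

theorem toConv_diagAction (ρ : H →ₐ[k] Module.End k N) :
    toConv (diagAction ρ (V := V)).toLinearMap =
      toConv (LinearMap.rTensorHom N ∘ₗ leftT k H V) *
        toConv (LinearMap.lTensorHom (TensorAlgebra k V) ∘ₗ ρ.toLinearMap) := by
  refine WithConv.ext <| LinearMap.ext fun h => TensorProduct.ext' fun x n => ?_
  exact (diagAction_apply ρ h (x ⊗ₜ n)).trans <| by
    simp [Coalgebra.Repr.convMul_apply (ℛ k h)]

/-- Covariance of `T(V) ⊗ N` as a `T(V)`-module: `h (x t) = (h₁ x) (h₂ t)`. -/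
theorem diagAction_semiconjBy (ρ : H →ₐ[k] Module.End k N) (x : TensorAlgebra k V) :
    SemiconjBy (toConv (diagAction ρ).toLinearMap)
      (convConst k H (Algebra.lsmul k k (TensorAlgebra k V ⊗[k] N) x))
      (convMap H (Algebra.lsmul k k (TensorAlgebra k V ⊗[k] N))
        (tensorConv (leftAction k H V) x)) := by
  have left_semiconjBy : SemiconjBy (toConv (LinearMap.rTensorHom N ∘ₗ leftT k H V))
      (convConst k H (Algebra.lsmul k k (TensorAlgebra k V ⊗[k] N) x))
      (convMap H (Algebra.lsmul k k (TensorAlgebra k V ⊗[k] N))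
        (tensorConv (leftAction k H V) x)) := by
    refine WithConv.ext <| LinearMap.ext fun h => TensorProduct.ext' fun z n => ?_
    rw [convMul_convConst_apply, Coalgebra.Repr.convMul_apply (ℛ k h)]
    simp [convMap, TensorProduct.smul_tmul', tensorAction_mul_eq_sum, TensorProduct.sum_tmul,
      tensorConv_apply]
  have right_commute : Commute
      (toConv (LinearMap.lTensorHom (TensorAlgebra k V) ∘ₗ ρ.toLinearMap))
      (convConst k H (Algebra.lsmul k k (TensorAlgebra k V ⊗[k] N) x)) := by
    refine WithConv.ext <| LinearMap.ext fun h => TensorProduct.ext' fun z n => ?_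
    rw [convMul_convConst_apply, convConst_convMul_apply]
    simp [TensorProduct.smul_tmul']
  rw [toConv_diagAction]
  exact left_semiconjBy.mul_left right_commute

theorem diagAction_smul (ρ : H →ₐ[k] Module.End k N) (h : H) (x : TensorAlgebra k V)
    (t : TensorAlgebra k V ⊗[k] N) :
    diagAction ρ h (x • t) = ∑ p ∈ (ℛ k h).index,
      leftT k H V ((ℛ k h).left p) x • diagAction ρ ((ℛ k h).right p) t := by
  have semiconj := LinearMap.congr_fun (congrArg ofConv (diagAction_semiconjBy ρ x)) h
  rw [convMul_convConst_apply, Coalgebra.Repr.convMul_apply (ℛ k h)] at semiconj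
  simpa [convMap, tensorConv_apply] using LinearMap.congr_fun semiconj t

end Diagonal

section SkewDerivation

variable {k : Type*} [Field k] {V : Type*} [AddCommGroup V] [Module k V]

/-- The operator `x ⊗ v ↦ x Ψ(v ⊗ w)` from `T(V) ⊗ V` to `T(V) ⊗ V`. -/
def mulBraid (Ψ : V ⊗[k] V →ₗ[k] V ⊗[k] V) (w : V) :
    TensorAlgebra k V ⊗[k] V →ₗ[TensorAlgebra k V] TensorAlgebra k V ⊗[k] V :=
  TensorProduct.AlgebraTensorModule.lift <| (LinearMap.toSpanSingleton (TensorAlgebra k V)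
      (V →ₗ[k] TensorAlgebra k V ⊗[k] V)
      (LinearMap.rTensor V (TensorAlgebra.ι k) ∘ₗ Ψ ∘ₗ (TensorProduct.mk k V V).flip w))

theorem mulBraid_tmul (Ψ : V ⊗[k] V →ₗ[k] V ⊗[k] V) (w v : V) (x : TensorAlgebra k V) :
    mulBraid Ψ w (x ⊗ₜ v) = x • LinearMap.rTensor V (TensorAlgebra.ι k) (Ψ (v ⊗ₜ w)) := rfl

variable {H : Type*} [Ring H] [HopfAlgebra k H] [Module H V] [IsScalarTower k H V]

theorem inducedBraiding_tmul (δ : V →ₗ[k] H ⊗[k] V) (v w : V) :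
    inducedBraiding δ (v ⊗ₜ[k] w) = LinearMap.rTensor V ((leftAction k H V).flip w) (δ v) := rfl

/-- `(v, x) ↦ (v⁽⁻¹⁾ ▷ x) ⊗ v⁽⁰⁾`, which moves `v` to the right across `x ∈ T(V)`. -/
def moveRight (δ : V →ₗ[k] H ⊗[k] V) :
    V →ₗ[k] TensorAlgebra k V →ₗ[k] TensorAlgebra k V ⊗[k] V :=
  (LinearMap.rTensorHom V ∘ₗ (leftT k H V).flip).flip ∘ₗ δ

theorem moveRight_apply (δ : V →ₗ[k] H ⊗[k] V) (v : V) (x : TensorAlgebra k V) :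
    moveRight δ v x = LinearMap.rTensor V ((leftT k H V).flip x) (δ v) := rfl

/-- The skew derivation `D : T(V) → T(V) ⊗ V` with `D(1) = 0` and
`D(v x) = (v⁽⁻¹⁾ ▷ x) ⊗ v⁽⁰⁾ + v D(x)`. On `V^{⊗n}` it is the braided integer `[n]_Ψ`. -/
def skewDer (δ : V →ₗ[k] H ⊗[k] V) : TensorAlgebra k V →ₗ[k] TensorAlgebra k V ⊗[k] V :=
  tensorRec (moveRight δ)
    ((Algebra.lsmul k k (TensorAlgebra k V ⊗[k] V)).toLinearMap ∘ₗ TensorAlgebra.ι k)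

@[simp]
theorem skewDer_one (δ : V →ₗ[k] H ⊗[k] V) : skewDer δ 1 = 0 :=
  tensorRec_one _ _

theorem skewDer_ι_mul (δ : V →ₗ[k] H ⊗[k] V) (v : V) (x : TensorAlgebra k V) :
    skewDer δ (TensorAlgebra.ι k v * x) =
      moveRight δ v x + TensorAlgebra.ι k v • skewDer δ x :=
  tensorRec_ι_mul _ _ v x

variable {δ : V →ₗ[k] H ⊗[k] V} (hδ : IsYetterDrinfeld δ)

include hδ

theorem moveRight_one (v : V) : moveRight δ v 1 = 1 ⊗ₜ v := by
  have flip_one : (leftT k H V).flip 1 =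
      Algebra.linearMap k (TensorAlgebra k V) ∘ₗ Coalgebra.counit (R := k) := by
    ext h
    simp [tensorAction_one]
  rw [moveRight_apply, flip_one, LinearMap.rTensor_comp, LinearMap.comp_apply, hδ.counit]
  simp

theorem skewDer_ι (v : V) : skewDer δ (TensorAlgebra.ι k v) = 1 ⊗ₜ v := by
  simpa [moveRight_one hδ] using skewDer_ι_mul δ v 1

theorem moveRight_mul_ι (v w : V) (x : TensorAlgebra k V) :
    moveRight δ v (x * TensorAlgebra.ι k w) =
      mulBraid (inducedBraiding δ) w (moveRight δ v x) := by
  have flip_mul : (leftT k H V).flip (x * TensorAlgebra.ι k w) =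
      (LinearMap.mul' k _ ∘ₗ TensorProduct.map ((leftT k H V).flip x)
        (TensorAlgebra.ι k ∘ₗ (leftAction k H V).flip w)) ∘ₗ Coalgebra.comul (R := k) := by
    ext h
    simp [tensorAction_mul_eq_sum, comul_eq_sum h]
  have braid_move : LinearMap.rTensor V (LinearMap.mul' k _ ∘ₗ
      TensorProduct.map ((leftT k H V).flip x) (TensorAlgebra.ι k ∘ₗ (leftAction k H V).flip w)) ∘ₗ
        (TensorProduct.assoc k H H V).symm.toLinearMap ∘ₗ LinearMap.lTensor H δ =
      (mulBraid (inducedBraiding δ) w).restrictScalars k ∘ₗ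
        LinearMap.rTensor V ((leftT k H V).flip x) := by
    refine TensorProduct.ext' fun h v => ?_
    simp only [LinearMap.comp_apply, LinearMap.lTensor_tmul, LinearMap.rTensor_tmul,
      LinearMap.restrictScalars_apply, mulBraid_tmul, inducedBraiding_tmul]
    induction δ v with
    | zero => simp
    | add a b ha hb => simp only [map_add, TensorProduct.tmul_add, smul_add, ha, hb]
    | tmul g u => simp [TensorProduct.smul_tmul']
  rw [moveRight_apply, flip_mul, rTensor_comp_comul_coaction hδ]
  exact LinearMap.congr_fun braid_move (δ v)

theorem skewDer_mul_ι (w : V) (x : TensorAlgebra k V) :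
    skewDer δ (x * TensorAlgebra.ι k w) =
      x ⊗ₜ w + mulBraid (inducedBraiding δ) w (skewDer δ x) := by
  refine LinearMap.congr_fun (tensorAlgebra_linearMap_ext_ι_mul
    (skewDer δ ∘ₗ LinearMap.mulRight k (TensorAlgebra.ι k w))
    ((TensorProduct.mk k _ V).flip w +
      (mulBraid (inducedBraiding δ) w).restrictScalars k ∘ₗ skewDer δ)
    (by simp [skewDer_ι hδ]) fun v x hx => ?_) x
  simp only [LinearMap.comp_apply, LinearMap.mulRight_apply, LinearMap.add_apply,
    LinearMap.flip_apply, TensorProduct.mk_apply, LinearMap.restrictScalars_apply] at hx ⊢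
  rw [mul_assoc, skewDer_ι_mul, hx, skewDer_ι_mul, moveRight_mul_ι hδ, map_add, map_smul,
    smul_add, TensorProduct.smul_tmul', smul_eq_mul]
  abel

theorem diagAction_moveRight (h : H) (v : V) (x : TensorAlgebra k V) :
    diagAction (Algebra.lsmul k k V) h (moveRight δ v x) = ∑ p ∈ (ℛ k h).index,
      moveRight δ ((ℛ k h).left p • v) (leftT k H V ((ℛ k h).right p) x) := by
  have moved := congrArg (LinearMap.rTensor V ((leftT k H V).flip x)) (compat_sum hδ h v)
  simp only [map_sum] at moved
  have flip_leftT (g : H) : (leftT k H V).flip (leftT k H V g x) =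
      (leftT k H V).flip x ∘ₗ (LinearMap.mul k H).flip g :=
    LinearMap.ext fun g' => (isLeftModuleAlgebra_leftT.mul_act g' g x).symm
  have map_comp_flip (g g' : H) :
      TensorProduct.map (leftT k H V g) (Algebra.lsmul k k V g') ∘ₗ
        LinearMap.rTensor V ((leftT k H V).flip x) =
      LinearMap.rTensor V ((leftT k H V).flip x) ∘ₗ
        TensorProduct.map (LinearMap.mul k H g) (leftAction k H V g') :=
    TensorProduct.ext' fun a w => by simp [isLeftModuleAlgebra_leftT.mul_act]
  simp only [moveRight_apply, diagAction_apply, flip_leftT, LinearMap.rTensor_comp,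
    LinearMap.comp_apply]
  exact (Finset.sum_congr rfl fun p _ => LinearMap.congr_fun (map_comp_flip _ _) (δ v)).trans
    moved.symm

theorem skewDer_leftT (h : H) (x : TensorAlgebra k V) :
    skewDer δ (leftT k H V h x) = diagAction (Algebra.lsmul k k V) h (skewDer δ x) := by
  have mem_equivariant := tensorAlgebra_mem_of_ι_mul_mem
    (⨅ h : H, LinearMap.eqLocus (skewDer δ ∘ₗ leftT k H V h)
      (diagAction (Algebra.lsmul k k V) h ∘ₗ skewDer δ))
    (Submodule.mem_iInf _ |>.2 fun h => by
      simp [LinearMap.mem_eqLocus, tensorAction_one, Algebra.algebraMap_eq_smul_one])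
    (fun v x hx => Submodule.mem_iInf _ |>.2 fun h => by
      simp only [Submodule.mem_iInf, LinearMap.mem_eqLocus, LinearMap.comp_apply] at hx ⊢
      simp only [tensorAction_mul_eq_sum, tensorAction_ι, map_sum, skewDer_ι_mul, map_add,
        diagAction_moveRight hδ, diagAction_smul, Finset.sum_add_distrib, hx, leftAction_apply]) x
  exact (Submodule.mem_iInf _).1 mem_equivariant h

end SkewDerivation

/-! ### Relations of the free double -/

section FreeRelations

variable {k : Type*} [Field k] {H : Type*} [Ring H] [HopfAlgebra k H]
  {V : Type*} [AddCommGroup V] [Module k V] [Module H V] [IsScalarTower k H V]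
  (δ : V →ₗ[k] H ⊗[k] V)

theorem freeV_ι (v : V) :
    freeV δ (TensorAlgebra.ι k v) = RingQuot.mkAlgHom k (Rel δ) (genV k H V v) := by
  simp [freeV]

theorem freeD_ι (f : Module.Dual k V) :
    freeD δ (TensorAlgebra.ι k f) = RingQuot.mkAlgHom k (Rel δ) (genD k H V f) := by
  simp [freeD]

theorem freeH_apply (h : H) :
    freeH δ h = RingQuot.mkAlgHom k (Rel δ) (genH k H V h) := rfl

theorem freeD_ι_mul_freeV_ι (f : Module.Dual k V) (v : V) :
    freeD δ (TensorAlgebra.ι k f) * freeV δ (TensorAlgebra.ι k v) =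
      freeV δ (TensorAlgebra.ι k v) * freeD δ (TensorAlgebra.ι k f) +
        freeH δ (pairing δ f v) := by
  have h := RingQuot.mkAlgHom_rel k (Rel.comm (δ := δ) f v)
  rw [map_sub, map_mul, map_mul, ← freeV_ι, ← freeD_ι, ← freeH_apply, sub_eq_iff_eq_add'] at h
  exact h

theorem toConv_freeH_semiconjBy (x : TensorAlgebra k V) :
    SemiconjBy (toConv (freeH δ).toLinearMap) (convConst k H (freeV δ x))
      (convMap H (freeV δ) (tensorConv (leftAction k H V) x)) := by
  refine tensorAlgebra_semiconjBy ((convConst k H).comp (freeV δ))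
    ((convMap H (freeV δ)).comp (tensorConv (leftAction k H V))) _ (fun v => ?_) x
  refine WithConv.ext <| LinearMap.ext fun h => ?_
  refine (convMul_convConst_apply _ _ h).trans ?_
  have rel := RingQuot.mkAlgHom_rel k (Rel.left (δ := δ) h v)
  rw [map_mul, map_sweedlerMul, ← freeV_ι, ← freeH_apply] at rel
  refine rel.trans ?_
  change sweedlerMul _ _ h = sweedlerMul ((freeV δ).toLinearMap ∘ₗ (leftT k H V).flip _) _ h
  congr 1
  ext g
  simp [freeV_ι]

theorem toConv_freeH_semiconjBy_freeD (y : TensorAlgebra k (Module.Dual k V)) :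
    SemiconjBy (toConv (freeH δ).toLinearMap)
      (convMap H (freeD δ) (tensorConv (dualAction k H V) y)) (convConst k H (freeD δ y)) := by
  refine tensorAlgebra_semiconjBy ((convMap H (freeD δ)).comp (tensorConv (dualAction k H V)))
    ((convConst k H).comp (freeD δ)) _ (fun f => ?_) y
  refine WithConv.ext <| LinearMap.ext fun h => ?_
  refine Eq.trans ?_ (convConst_convMul_apply _ _ h).symm
  have rel := RingQuot.mkAlgHom_rel k (Rel.right (δ := δ) f h)
  rw [map_mul, map_sweedlerMul, ← freeD_ι, ← freeH_apply] at rel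
  refine Eq.trans ?_ rel.symm
  change sweedlerMul _ ((freeD δ).toLinearMap ∘ₗ (dualT k H V).flip _) h = sweedlerMul _ _ h
  congr 1
  ext g
  simp [freeD_ι]

theorem freeH_mul_freeV (h : H) (x : TensorAlgebra k V) :
    freeH δ h * freeV δ x = sweedlerMul ((freeV δ).toLinearMap ∘ₗ (leftT k H V).flip x)
      (freeH δ).toLinearMap h :=
  (convMul_convConst_apply _ _ h).symm.trans
    (congrArg (fun F : WithConv (H →ₗ[k] FreeDouble δ) => F h) (toConv_freeH_semiconjBy δ x))

theorem freeD_mul_freeH (y : TensorAlgebra k (Module.Dual k V)) (h : H) :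
    freeD δ y * freeH δ h = sweedlerMul (freeH δ).toLinearMap
      ((freeD δ).toLinearMap ∘ₗ (dualT k H V).flip y) h :=
  (convConst_convMul_apply _ _ h).symm.trans
    (congrArg (fun F : WithConv (H →ₗ[k] FreeDouble δ) => F h)
      (toConv_freeH_semiconjBy_freeD δ y).symm)

theorem freeH_mul_freeV_eq_sum (h : H) (x : TensorAlgebra k V) :
    freeH δ h * freeV δ x = ∑ p ∈ (ℛ k h).index,
      freeV δ (leftT k H V ((ℛ k h).left p) x) * freeH δ ((ℛ k h).right p) := by
  rw [freeH_mul_freeV, sweedlerMul_eq_sum]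
  rfl

theorem freeD_mul_freeH_eq_sum (y : TensorAlgebra k (Module.Dual k V)) (h : H) :
    freeD δ y * freeH δ h = ∑ p ∈ (ℛ k h).index,
      freeH δ ((ℛ k h).left p) * freeD δ (dualT k H V ((ℛ k h).right p) y) := by
  rw [freeD_mul_freeH, sweedlerMul_eq_sum]
  rfl

/-- The map `x ⊗ v ↦ x β(f, v)` from `T(V) ⊗ V` to the free double. -/
def contract (f : Module.Dual k V) : TensorAlgebra k V ⊗[k] V →ₗ[k] FreeDouble δ :=
  LinearMap.mul' k _ ∘ₗ
    TensorProduct.map (freeV δ).toLinearMap ((freeH δ).toLinearMap ∘ₗ pairingLin δ f)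

@[simp]
theorem contract_tmul (f : Module.Dual k V) (x : TensorAlgebra k V) (v : V) :
    contract δ f (x ⊗ₜ v) = freeV δ x * freeH δ (pairing δ f v) := rfl

theorem contract_smul (f : Module.Dual k V) (a : TensorAlgebra k V)
    (t : TensorAlgebra k V ⊗[k] V) : contract δ f (a • t) = freeV δ a * contract δ f t := by
  induction t with
  | zero => simp
  | add s t hs ht => simp only [smul_add, map_add, hs, ht, mul_add]
  | tmul x v => simp [TensorProduct.smul_tmul', mul_assoc]

/-- The skew derivation of `T(V^*)` that governs `y v - v y` for `y ∈ T(V^*)`, `v ∈ V`: its value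
at `y` is a linear map `G : V → T(V^*)` with `y v - v y = v⁽⁻¹⁾ G(v⁽⁰⁾)` in the free double. -/
def dualSkewDer :
    TensorAlgebra k (Module.Dual k V) →ₗ[k] V →ₗ[k] TensorAlgebra k (Module.Dual k V) :=
  tensorRec LinearMap.smulRightₗ
    ((TensorProduct.mapBilinear (RingHom.id k) H V _ _).compr₂
      (LinearMap.lcomp k _ δ ∘ₗ LinearMap.llcomp k _ _ _ (LinearMap.mul' k _)) ∘ₗ
        LinearMap.llcomp k _ _ _ (TensorAlgebra.ι k) ∘ₗ (dualAction k H V).flip)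

@[simp]
theorem dualSkewDer_one : dualSkewDer δ 1 = 0 :=
  tensorRec_one _ _

theorem dualSkewDer_ι_mul (f : Module.Dual k V) (y : TensorAlgebra k (Module.Dual k V)) :
    dualSkewDer δ (TensorAlgebra.ι k f * y) = f.smulRight y + LinearMap.mul' k _ ∘ₗ
      TensorProduct.map ((dualT k H V).flip (TensorAlgebra.ι k f)) (dualSkewDer δ y) ∘ₗ δ := by
  have flip_ι : (dualT k H V).flip (TensorAlgebra.ι k f) =
      TensorAlgebra.ι k ∘ₗ (dualAction k H V).flip f := by
    ext h
    simp
  rw [flip_ι]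
  exact tensorRec_ι_mul _ _ f y

variable {δ} (hδ : IsYetterDrinfeld δ)

include hδ

theorem contract_moveRight (f : Module.Dual k V) (v : V) (x : TensorAlgebra k V) :
    contract δ f (moveRight δ v x) = freeH δ (pairing δ f v) * freeV δ x := by
  rw [freeH_mul_freeV, sweedlerMul, comul_pairing hδ, moveRight_apply]
  have key : contract δ f ∘ₗ LinearMap.rTensor V ((leftT k H V).flip x) =
      LinearMap.mul' k _ ∘ₗ TensorProduct.map ((freeV δ).toLinearMap ∘ₗ (leftT k H V).flip x)
        (freeH δ).toLinearMap ∘ₗ LinearMap.lTensor H (pairingLin δ f) :=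
    TensorProduct.ext' fun h v => by simp
  exact LinearMap.congr_fun key (δ v)

theorem freeD_ι_mul_freeV (f : Module.Dual k V) (x : TensorAlgebra k V) :
    freeD δ (TensorAlgebra.ι k f) * freeV δ x =
      freeV δ x * freeD δ (TensorAlgebra.ι k f) + contract δ f (skewDer δ x) := by
  refine LinearMap.congr_fun (tensorAlgebra_linearMap_ext_ι_mul
    (LinearMap.mulLeft k (freeD δ (TensorAlgebra.ι k f)) ∘ₗ (freeV δ).toLinearMap)
    (LinearMap.mulRight k (freeD δ (TensorAlgebra.ι k f)) ∘ₗ (freeV δ).toLinearMap +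
      contract δ f ∘ₗ skewDer δ) (by simp) fun v x hx => ?_) x
  simp only [LinearMap.comp_apply, LinearMap.mulLeft_apply, LinearMap.add_apply,
    LinearMap.mulRight_apply, AlgHom.toLinearMap_apply] at hx ⊢
  rw [map_mul, ← mul_assoc, freeD_ι_mul_freeV_ι, add_mul, mul_assoc, hx, skewDer_ι_mul, map_add,
    contract_moveRight hδ, contract_smul, mul_add, mul_assoc]
  abel

theorem freeD_ι_mul_map_coaction (f : Module.Dual k V)
    (G : V →ₗ[k] TensorAlgebra k (Module.Dual k V)) (v : V) :
    freeD δ (TensorAlgebra.ι k f) * LinearMap.mul' k (FreeDouble δ)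
        (TensorProduct.map (freeH δ).toLinearMap ((freeD δ).toLinearMap ∘ₗ G) (δ v)) =
      LinearMap.mul' k (FreeDouble δ) (TensorProduct.map (freeH δ).toLinearMap
        ((freeD δ).toLinearMap ∘ₗ LinearMap.mul' k _ ∘ₗ
          TensorProduct.map ((dualT k H V).flip (TensorAlgebra.ι k f)) G ∘ₗ δ) (δ v)) := by
  set straighten : H ⊗[k] H →ₗ[k] FreeDouble δ := LinearMap.mul' k _ ∘ₗ TensorProduct.map
    (freeH δ).toLinearMap ((freeD δ).toLinearMap ∘ₗ (dualT k H V).flip (TensorAlgebra.ι k f))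
  set append : FreeDouble δ ⊗[k] V →ₗ[k] FreeDouble δ :=
    LinearMap.mul' k _ ∘ₗ LinearMap.lTensor _ ((freeD δ).toLinearMap ∘ₗ G)
  have before : LinearMap.mulLeft k (freeD δ (TensorAlgebra.ι k f)) ∘ₗ LinearMap.mul' k _ ∘ₗ
      TensorProduct.map (freeH δ).toLinearMap ((freeD δ).toLinearMap ∘ₗ G) =
      append ∘ₗ LinearMap.rTensor V (straighten ∘ₗ Coalgebra.comul (R := k)) :=
    TensorProduct.ext' fun h w => by
      have straighten_comul : straighten (Coalgebra.comul (R := k) h) =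
          freeD δ (TensorAlgebra.ι k f) * freeH δ h := (freeD_mul_freeH δ _ h).symm
      simp [append, straighten_comul, mul_assoc]
  have after : append ∘ₗ LinearMap.rTensor V straighten ∘ₗ
      (TensorProduct.assoc k H H V).symm.toLinearMap =
      LinearMap.mul' k (FreeDouble δ) ∘ₗ TensorProduct.map (freeH δ).toLinearMap
        ((freeD δ).toLinearMap ∘ₗ LinearMap.mul' k _ ∘ₗ
          TensorProduct.map ((dualT k H V).flip (TensorAlgebra.ι k f)) G) :=
    TensorProduct.ext_threefold' fun g h w => by simp [append, straighten, mul_assoc]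
  calc _ = append (LinearMap.rTensor V (straighten ∘ₗ Coalgebra.comul (R := k)) (δ v)) :=
        LinearMap.congr_fun before (δ v)
    _ = append (LinearMap.rTensor V straighten
          ((TensorProduct.assoc k H H V).symm (LinearMap.lTensor H δ (δ v)))) := by
        rw [rTensor_comp_comul_coaction hδ]
    _ = _ := (LinearMap.congr_fun after (LinearMap.lTensor H δ (δ v))).trans
        (congrArg (LinearMap.mul' k _) (LinearMap.map_lTensor _ _ _ _ _))

theorem freeD_mul_freeV_ι (y : TensorAlgebra k (Module.Dual k V)) (v : V) :
    freeD δ y * freeV δ (TensorAlgebra.ι k v) = freeV δ (TensorAlgebra.ι k v) * freeD δ y +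
      LinearMap.mul' k (FreeDouble δ) (TensorProduct.map (freeH δ).toLinearMap
        ((freeD δ).toLinearMap ∘ₗ dualSkewDer δ y) (δ v)) := by
  refine LinearMap.congr_fun (tensorAlgebra_linearMap_ext_ι_mul
    (LinearMap.mulRight k (freeV δ (TensorAlgebra.ι k v)) ∘ₗ (freeD δ).toLinearMap)
    (LinearMap.mulLeft k (freeV δ (TensorAlgebra.ι k v)) ∘ₗ (freeD δ).toLinearMap +
      LinearMap.mul' k _ ∘ₗ LinearMap.applyₗ (δ v) ∘ₗ
        TensorProduct.mapBilinear (RingHom.id k) H V _ _ (freeH δ).toLinearMap ∘ₗ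
          LinearMap.llcomp k V _ _ (freeD δ).toLinearMap ∘ₗ dualSkewDer δ)
    (by simp) fun f y hy => ?_) y
  have constant_term : LinearMap.mul' k (FreeDouble δ) ∘ₗ TensorProduct.map (freeH δ).toLinearMap
      ((freeD δ).toLinearMap ∘ₗ f.smulRight y) = LinearMap.mulRight k (freeD δ y) ∘ₗ
        (freeH δ).toLinearMap ∘ₗ (TensorProduct.rid k H).toLinearMap ∘ₗ LinearMap.lTensor H f :=
    TensorProduct.ext' fun h w => by simp
  have constant_term_apply := LinearMap.congr_fun constant_term (δ v)
  simp only [LinearMap.comp_apply, LinearMap.mulLeft_apply, LinearMap.add_apply,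
    LinearMap.mulRight_apply, AlgHom.toLinearMap_apply, LinearMap.applyₗ_apply_apply,
    TensorProduct.mapBilinear_apply, LinearMap.llcomp_apply'] at hy constant_term_apply ⊢
  rw [map_mul, mul_assoc, hy, mul_add, freeD_ι_mul_map_coaction hδ, ← mul_assoc,
    freeD_ι_mul_freeV_ι, add_mul, dualSkewDer_ι_mul, LinearMap.comp_add,
    TensorProduct.map_add_right, LinearMap.add_apply, map_add, constant_term_apply, mul_assoc,
    add_assoc]
  rfl

end FreeRelations

section Spanning

theorem range_le_iff_forall_tmul {R M N P Q : Type*} [CommRing R] [AddCommGroup M] [Module R M]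
    [AddCommGroup N] [Module R N] [AddCommGroup P] [Module R P] [AddCommGroup Q] [Module R Q]
    (F : (M ⊗[R] N) ⊗[R] P →ₗ[R] Q) (S : Submodule R Q) :
    LinearMap.range F ≤ S ↔ ∀ x y z, F ((x ⊗ₜ y) ⊗ₜ z) ∈ S := by
  refine ⟨fun h x y z => h ⟨_, rfl⟩, fun h => ?_⟩
  rw [← S.ker_mkQ, LinearMap.range_le_ker_iff]
  exact TensorProduct.ext_threefold fun x y z => (Submodule.Quotient.mk_eq_zero S).2 (h x y z)

variable {k : Type*} [Field k] {H : Type*} [Ring H] [HopfAlgebra k H]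
  {V : Type*} [AddCommGroup V] [Module k V] [Module H V] [IsScalarTower k H V]
  {δ : V →ₗ[k] H ⊗[k] V}

theorem freeDouble_induction {p : FreeDouble δ → Prop}
    (algebraMap : ∀ r, p (algebraMap k _ r)) (freeV : ∀ v, p (freeV δ (TensorAlgebra.ι k v)))
    (freeH : ∀ h, p (freeH δ h)) (freeD : ∀ f, p (freeD δ (TensorAlgebra.ι k f)))
    (mul : ∀ a b, p a → p b → p (a * b)) (add : ∀ a b, p a → p b → p (a + b))
    (a : FreeDouble δ) : p a := by
  obtain ⟨a, rfl⟩ := RingQuot.mkAlgHom_surjective k (Rel δ) a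
  induction a using TensorAlgebra.induction with
  | algebraMap r => simpa only [AlgHom.commutes] using algebraMap r
  | mul a b ha hb => simpa only [map_mul] using mul _ _ ha hb
  | add a b ha hb => simpa only [map_add] using add _ _ ha hb
  | ι w =>
    obtain ⟨v, h, f⟩ := w
    have ι_eq : TensorAlgebra.ι k (v, h, f) = genV k H V v + (genH k H V h + genD k H V f) := by
      simp only [genV, genH, genD, LinearMap.comp_apply, ← map_add]
      simp
    rw [ι_eq, map_add, map_add, ← freeV_ι, ← freeD_ι, ← freeH_apply]
    exact add _ _ (freeV v) (add _ _ (freeH h) (freeD f))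

theorem mul_mem_of_generators {S : Submodule k (FreeDouble δ)}
    (freeV : ∀ v, ∀ s ∈ S, freeV δ (TensorAlgebra.ι k v) * s ∈ S)
    (freeH : ∀ h, ∀ s ∈ S, freeH δ h * s ∈ S)
    (freeD : ∀ f, ∀ s ∈ S, freeD δ (TensorAlgebra.ι k f) * s ∈ S) (a : FreeDouble δ) :
    ∀ s ∈ S, a * s ∈ S := by
  refine freeDouble_induction (p := fun a => ∀ s ∈ S, a * s ∈ S) (fun r s hs => ?_) freeV freeH
    freeD (fun a b ha hb s hs => ?_) (fun a b ha hb s hs => ?_) a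
  · simpa only [← Algebra.smul_def] using S.smul_mem r hs
  · simpa only [mul_assoc] using ha _ (hb _ hs)
  · simpa only [add_mul] using S.add_mem (ha s hs) (hb s hs)

theorem mem_mul_of_generators {S : Submodule k (FreeDouble δ)}
    (freeV : ∀ v, ∀ s ∈ S, s * freeV δ (TensorAlgebra.ι k v) ∈ S)
    (freeH : ∀ h, ∀ s ∈ S, s * freeH δ h ∈ S)
    (freeD : ∀ f, ∀ s ∈ S, s * freeD δ (TensorAlgebra.ι k f) ∈ S) (a : FreeDouble δ) :
    ∀ s ∈ S, s * a ∈ S := by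
  refine freeDouble_induction (p := fun a => ∀ s ∈ S, s * a ∈ S) (fun r s hs => ?_) freeV freeH
    freeD (fun a b ha hb s hs => ?_) (fun a b ha hb s hs => ?_) a
  · simpa only [← Algebra.commutes, ← Algebra.smul_def] using S.smul_mem r hs
  · simpa only [mul_assoc] using hb _ (ha _ hs)
  · simpa only [mul_add] using S.add_mem (ha s hs) (hb s hs)

theorem triple_mem_range_tripleMul (x : TensorAlgebra k V) (h : H)
    (y : TensorAlgebra k (Module.Dual k V)) :
    freeV δ x * freeH δ h * freeD δ y ∈
      LinearMap.range (tripleMul (freeV δ) (freeH δ) (freeD δ)) := ⟨(x ⊗ₜ h) ⊗ₜ y, rfl⟩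

theorem mul_mem_range_tripleMul {a : FreeDouble δ}
    (triple : ∀ x h y, a * (freeV δ x * freeH δ h * freeD δ y) ∈
      LinearMap.range (tripleMul (freeV δ) (freeH δ) (freeD δ))) :
    ∀ s ∈ LinearMap.range (tripleMul (freeV δ) (freeH δ) (freeD δ)),
      a * s ∈ LinearMap.range (tripleMul (freeV δ) (freeH δ) (freeD δ)) :=
  fun _ hs => (range_le_iff_forall_tmul _ ((LinearMap.range
    (tripleMul (freeV δ) (freeH δ) (freeD δ))).comap (LinearMap.mulLeft k a))).2 triple hs

theorem freeH_mul_triple_mem_range_tripleMul (g : H) (x : TensorAlgebra k V) (h : H)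
    (y : TensorAlgebra k (Module.Dual k V)) :
    freeH δ g * (freeV δ x * freeH δ h * freeD δ y) ∈
      LinearMap.range (tripleMul (freeV δ) (freeH δ) (freeD δ)) := by
  rw [← mul_assoc, ← mul_assoc, freeH_mul_freeV_eq_sum, Finset.sum_mul, Finset.sum_mul]
  refine Submodule.sum_mem _ fun p _ => ?_
  rw [mul_assoc (freeV δ _), ← map_mul]
  exact triple_mem_range_tripleMul _ _ _

theorem freeD_ι_mul_triple_mem_range_tripleMul (hδ : IsYetterDrinfeld δ) (f : Module.Dual k V)
    (x : TensorAlgebra k V) (h : H) (y : TensorAlgebra k (Module.Dual k V)) :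
    freeD δ (TensorAlgebra.ι k f) * (freeV δ x * freeH δ h * freeD δ y) ∈
      LinearMap.range (tripleMul (freeV δ) (freeH δ) (freeD δ)) := by
  rw [← mul_assoc, ← mul_assoc, freeD_ι_mul_freeV hδ, add_mul, add_mul]
  refine Submodule.add_mem _ ?_ ?_
  · rw [mul_assoc (freeV δ x), freeD_mul_freeH_eq_sum, Finset.mul_sum, Finset.sum_mul]
    refine Submodule.sum_mem _ fun p _ => ?_
    rw [← mul_assoc, mul_assoc, ← map_mul]
    exact triple_mem_range_tripleMul _ _ _
  · generalize skewDer δ x = t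
    induction t with
    | zero => simp
    | add t t' ht ht' => rw [map_add, add_mul, add_mul]; exact Submodule.add_mem _ ht ht'
    | tmul x v =>
      rw [contract_tmul, mul_assoc (freeV δ x), ← map_mul]
      exact triple_mem_range_tripleMul _ _ _

theorem tripleMul_surjective (hδ : IsYetterDrinfeld δ) :
    Function.Surjective (tripleMul (freeV δ) (freeH δ) (freeD δ)) := fun a => by
  have one_mem := triple_mem_range_tripleMul (δ := δ) 1 1 1
  rw [map_one, map_one, map_one, one_mul, one_mul] at one_mem
  have mul_one_mem := mul_mem_of_generators
    (fun v => mul_mem_range_tripleMul fun x h y => by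
      rw [← mul_assoc, ← mul_assoc, ← map_mul]
      exact triple_mem_range_tripleMul _ _ _)
    (fun g => mul_mem_range_tripleMul (freeH_mul_triple_mem_range_tripleMul g))
    (fun f => mul_mem_range_tripleMul (freeD_ι_mul_triple_mem_range_tripleMul hδ f)) a 1 one_mem
  rwa [mul_one] at mul_one_mem

theorem freeDouble_triple_induction (hδ : IsYetterDrinfeld δ)
    {p : FreeDouble δ → Prop} (triple : ∀ x h y, p (freeV δ x * freeH δ h * freeD δ y))
    (add : ∀ a b, p a → p b → p (a + b)) (a : FreeDouble δ) : p a := by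
  obtain ⟨t, rfl⟩ := tripleMul_surjective hδ a
  have zero : p 0 := by simpa using triple 0 1 1
  induction t with
  | zero => rwa [map_zero]
  | add s t hs ht => rw [map_add]; exact add _ _ hs ht
  | tmul t y =>
    induction t with
    | zero => rwa [TensorProduct.zero_tmul, map_zero]
    | add s t hs ht => rw [TensorProduct.add_tmul, map_add]; exact add _ _ hs ht
    | tmul x h => exact triple x h y

theorem triangularSubspace_le {Im : Submodule k (TensorAlgebra k V)}
    {Ip : Submodule k (TensorAlgebra k (Module.Dual k V))} {S : Submodule k (FreeDouble δ)}
    (left : ∀ x ∈ Im, ∀ h y, freeV δ x * freeH δ h * freeD δ y ∈ S)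
    (right : ∀ x h, ∀ y ∈ Ip, freeV δ x * freeH δ h * freeD δ y ∈ S) :
    triangularSubspace δ Im Ip ≤ S := by
  rw [triangularSubspace, Submodule.map_sup, ← LinearMap.range_comp, ← LinearMap.range_comp]
  exact sup_le ((range_le_iff_forall_tmul _ _).2 fun x h y => left x x.2 h y)
    ((range_le_iff_forall_tmul _ _).2 fun x h y => right x h y y.2)

theorem mem_triangularSubspace_left {Im : Submodule k (TensorAlgebra k V)}
    (Ip : Submodule k (TensorAlgebra k (Module.Dual k V))) {x : TensorAlgebra k V} (hx : x ∈ Im)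
    (h : H) (y : TensorAlgebra k (Module.Dual k V)) :
    freeV δ x * freeH δ h * freeD δ y ∈ triangularSubspace δ Im Ip :=
  ⟨(x ⊗ₜ h) ⊗ₜ y, Submodule.mem_sup_left ⟨((⟨x, hx⟩ : Im) ⊗ₜ h) ⊗ₜ y, rfl⟩, rfl⟩

theorem mem_triangularSubspace_right (Im : Submodule k (TensorAlgebra k V))
    {Ip : Submodule k (TensorAlgebra k (Module.Dual k V))} (x : TensorAlgebra k V) (h : H)
    {y : TensorAlgebra k (Module.Dual k V)} (hy : y ∈ Ip) :
    freeV δ x * freeH δ h * freeD δ y ∈ triangularSubspace δ Im Ip :=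
  ⟨(x ⊗ₜ h) ⊗ₜ y, Submodule.mem_sup_right ⟨(x ⊗ₜ h) ⊗ₜ (⟨y, hy⟩ : Ip), rfl⟩, rfl⟩

end Spanning

/-! ### Representing the free double -/

section FreeLift

variable {k : Type*} [Field k] {H : Type*} [Ring H] [HopfAlgebra k H]
  {V : Type*} [AddCommGroup V] [Module k V] {A : Type*} [Ring A] [Algebra k A]
  {i : V →ₗ[k] A} {j : H →ₐ[k] A} {d : Module.Dual k V →ₗ[k] A}

variable (i j d) in
/-- The map of the free algebra on `V ⊕ H ⊕ V^*` given by `i`, `j` and `d` on generators. -/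
def genLift : Gen k H V →ₐ[k] A :=
  TensorAlgebra.lift k (i.coprod (j.toLinearMap.coprod d))

theorem genLift_comp_genV : (genLift i j d).toLinearMap ∘ₗ genV k H V = i := by
  ext v
  simp [genLift, genV]

theorem genLift_comp_genH : (genLift i j d).toLinearMap ∘ₗ genH k H V = j.toLinearMap := by
  ext h
  simp [genLift, genH]

theorem genLift_comp_genD : (genLift i j d).toLinearMap ∘ₗ genD k H V = d := by
  ext f
  simp [genLift, genD]

variable [Module H V] [IsScalarTower k H V] {δ : V →ₗ[k] H ⊗[k] V}

/-- Linear maps `i`, `d` of `V`, `V^*` and an algebra map `j` of `H` to an algebra `A` obey the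
defining relations of the free double. -/
structure IsFreeDoubleData (δ : V →ₗ[k] H ⊗[k] V) (i : V →ₗ[k] A) (j : H →ₐ[k] A)
    (d : Module.Dual k V →ₗ[k] A) : Prop where
  left : ∀ h v, j h * i v = sweedlerMul (i ∘ₗ (leftAction k H V).flip v) j.toLinearMap h
  right : ∀ f h, d f * j h = sweedlerMul j.toLinearMap (d ∘ₗ (dualAction k H V).flip f) h
  comm : ∀ f v, d f * i v - i v * d f = j (pairing δ f v)

namespace IsFreeDoubleData

variable (data : IsFreeDoubleData δ i j d)

include data in
theorem genLift_eq_of_rel {a b : Gen k H V} (rel : Rel δ a b) :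
    genLift i j d a = genLift i j d b := by
  have map_genV := LinearMap.congr_fun (genLift_comp_genV (i := i) (j := j) (d := d))
  have map_genH := LinearMap.congr_fun (genLift_comp_genH (i := i) (j := j) (d := d))
  have map_genD := LinearMap.congr_fun (genLift_comp_genD (i := i) (j := j) (d := d))
  simp only [LinearMap.comp_apply, AlgHom.toLinearMap_apply] at map_genV map_genH map_genD
  cases rel with
  | one => rw [map_genH, map_one, map_one]
  | mul g h => simp only [map_mul, map_genH]
  | left h v =>
    rw [map_mul, map_sweedlerMul, ← LinearMap.comp_assoc, genLift_comp_genV, genLift_comp_genH,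
      map_genH, map_genV, data.left]
  | right f h =>
    rw [map_mul, map_sweedlerMul, ← LinearMap.comp_assoc, genLift_comp_genD, genLift_comp_genH,
      map_genH, map_genD, data.right]
  | comm f v => simp only [map_sub, map_mul, map_genV, map_genD, map_genH, data.comm]

/-- The algebra map from the free double to `A` that extends the data. -/
def lift : FreeDouble δ →ₐ[k] A :=
  RingQuot.liftAlgHom k ⟨genLift i j d, fun _ _ => data.genLift_eq_of_rel⟩

theorem lift_freeV_ι (v : V) : data.lift (freeV δ (TensorAlgebra.ι k v)) = i v := by
  rw [freeV_ι, lift, RingQuot.liftAlgHom_mkAlgHom_apply]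
  exact LinearMap.congr_fun genLift_comp_genV v

theorem lift_freeH (h : H) : data.lift (freeH δ h) = j h := by
  rw [freeH_apply, lift, RingQuot.liftAlgHom_mkAlgHom_apply]
  exact LinearMap.congr_fun genLift_comp_genH h

theorem lift_freeD_ι (f : Module.Dual k V) :
    data.lift (freeD δ (TensorAlgebra.ι k f)) = d f := by
  rw [freeD_ι, lift, RingQuot.liftAlgHom_mkAlgHom_apply]
  exact LinearMap.congr_fun genLift_comp_genD f

end IsFreeDoubleData

end FreeLift

section Induced

variable {k : Type*} [Field k] {H : Type*} [Ring H] [HopfAlgebra k H]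
  {V : Type*} [AddCommGroup V] [Module k V] {N : Type*} [AddCommGroup N] [Module k N]

variable (k V N) in
/-- The action of `V` on `T(V) ⊗ N` by left multiplication. -/
def inducedV : V →ₗ[k] Module.End k (TensorAlgebra k V ⊗[k] N) :=
  (Algebra.lsmul k k (TensorAlgebra k V ⊗[k] N)).toLinearMap ∘ₗ TensorAlgebra.ι k

@[simp]
theorem inducedV_apply (v : V) (t : TensorAlgebra k V ⊗[k] N) :
    inducedV k V N v t = TensorAlgebra.ι k v • t := rfl

/-- The map `(x ⊗ v) ⊗ n ↦ x ⊗ β(f, v) n` on `(T(V) ⊗ V) ⊗ N`, for a representation of `H`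
on `N`. -/
def contractAct (δ : V →ₗ[k] H ⊗[k] V) (ρ : H →ₐ[k] Module.End k N) (f : Module.Dual k V) :
    (TensorAlgebra k V ⊗[k] V) ⊗[k] N →ₗ[k] TensorAlgebra k V ⊗[k] N :=
  LinearMap.lTensor _ (TensorProduct.lift (ρ.toLinearMap ∘ₗ pairingLin δ f)) ∘ₗ
    (TensorProduct.assoc k _ V N).toLinearMap

@[simp]
theorem contractAct_tmul (δ : V →ₗ[k] H ⊗[k] V) (ρ : H →ₐ[k] Module.End k N)
    (f : Module.Dual k V) (x : TensorAlgebra k V) (v : V) (n : N) :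
    contractAct δ ρ f ((x ⊗ₜ v) ⊗ₜ n) = x ⊗ₜ ρ (pairing δ f v) n := rfl

variable [Module H V] [IsScalarTower k H V]

/-- The operators by which `V^*` acts on the module `T(V) ⊗ N` over the free double that is induced
from a module `N` over `H ⋉ T(V^*)`: they extend the operators `σ` on `N = 1 ⊗ N` so that
`f v - v f = β(f, v)`. -/
def inducedD (δ : V →ₗ[k] H ⊗[k] V) (ρ : H →ₐ[k] Module.End k N)
    (σ : Module.Dual k V →ₗ[k] Module.End k N) :
    Module.Dual k V →ₗ[k] Module.End k (TensorAlgebra k V ⊗[k] N) where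
  toFun f := LinearMap.lTensor _ (σ f) + contractAct δ ρ f ∘ₗ LinearMap.rTensor N (skewDer δ)
  map_add' f g := by
    simp only [contractAct, map_add, LinearMap.comp_add, lift_add', LinearMap.lTensor_add,
      LinearMap.add_comp]
    abel
  map_smul' c f := by
    simp only [contractAct, map_smul, LinearMap.comp_smul, lift_smul', LinearMap.lTensor_smul,
      LinearMap.smul_comp, smul_add, RingHom.id_apply]

theorem inducedD_tmul (δ : V →ₗ[k] H ⊗[k] V) (ρ : H →ₐ[k] Module.End k N)
    (σ : Module.Dual k V →ₗ[k] Module.End k N) (f : Module.Dual k V) (x : TensorAlgebra k V)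
    (n : N) : inducedD δ ρ σ f (x ⊗ₜ n) = x ⊗ₜ σ f n + contractAct δ ρ f (skewDer δ x ⊗ₜ n) := rfl

theorem diagAction_tmul (ρ : H →ₐ[k] Module.End k N) (h : H) (x : TensorAlgebra k V) (n : N) :
    diagAction ρ h (x ⊗ₜ n) = TensorProduct.map ((leftT k H V).flip x) (ρ.toLinearMap.flip n)
      (Coalgebra.comul (R := k) h) := by
  simp [diagAction_apply, comul_eq_sum h]

theorem diagAction_mul_inducedV (ρ : H →ₐ[k] Module.End k N) (h : H) (v : V) :
    diagAction ρ h * inducedV k V N v = sweedlerMul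
      (inducedV k V N ∘ₗ (leftAction k H V).flip v) (diagAction ρ).toLinearMap h := by
  refine LinearMap.ext fun t => ?_
  rw [sweedlerMul_eq_sum, LinearMap.sum_apply]
  simpa using diagAction_smul ρ h (TensorAlgebra.ι k v) t

variable {δ : V →ₗ[k] H ⊗[k] V} (hδ : IsYetterDrinfeld δ)

include hδ

theorem contractAct_diagAction (ρ : H →ₐ[k] Module.End k N) (f : Module.Dual k V) (h : H)
    (s : TensorAlgebra k V ⊗[k] V) (n : N) :
    ∑ p ∈ (ℛ k h).index, contractAct δ ρ f
      (diagAction (Algebra.lsmul k k V) ((ℛ k h).left p) s ⊗ₜ ρ ((ℛ k h).right p) n) =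
    ∑ p ∈ (ℛ k h).index, diagAction ρ ((ℛ k h).left p)
      (contractAct δ ρ (dualAction k H V ((ℛ k h).right p) f) (s ⊗ₜ n)) := by
  induction s with
  | zero => simp
  | add s t hs ht => simp only [TensorProduct.add_tmul, map_add, Finset.sum_add_distrib, hs, ht]
  | tmul x v =>
    obtain ⟨act, act_tmul⟩ : ∃ act : H →ₐ[k] Module.End k (TensorAlgebra k V ⊗[k] N),
        ∀ g z m, act g (z ⊗ₜ m) = z ⊗ₜ ρ g m :=
      ⟨(Module.End.lTensorAlgHom k N (TensorAlgebra k V)).comp ρ, fun _ _ _ => rfl⟩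
    have exchange : toConv (act.toLinearMap ∘ₗ pairingLin δ f ∘ₗ (leftAction k H V).flip v) *
        toConv act.toLinearMap = toConv act.toLinearMap *
          toConv (act.toLinearMap ∘ₗ (pairingLin δ).flip v ∘ₗ (dualAction k H V).flip f) :=
      WithConv.ext <| LinearMap.ext fun g => by
        simpa [sweedlerMul_eq_sum, Coalgebra.Repr.convMul_apply (ℛ k g)] using
          congrArg act (congrFun (sweedlerMul_pairing hδ f v) g)
    have assoc := mul_assoc (toConv (LinearMap.rTensorHom N ∘ₗ leftT k H V)) _ _ |>.trans
      (congrArg _ exchange) |>.trans (mul_assoc _ _ _).symm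
    have key := LinearMap.congr_fun
      (congrArg (fun F : WithConv (H →ₗ[k] Module.End k (TensorAlgebra k V ⊗[k] N)) => F h) assoc)
      (x ⊗ₜ n)
    simpa [Coalgebra.Repr.convMul_apply (ℛ k _), act_tmul, diagAction_apply,
      TensorProduct.sum_tmul] using key

theorem inducedD_mul_diagAction (ρ : H →ₐ[k] Module.End k N)
    (σ : Module.Dual k V →ₗ[k] Module.End k N)
    (right : ∀ f h, σ f * ρ h =
      sweedlerMul ρ.toLinearMap (σ ∘ₗ (dualAction k H V).flip f) h) (f : Module.Dual k V) (h : H) :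
    inducedD δ ρ σ f * diagAction ρ h = sweedlerMul (A := Module.End k (TensorAlgebra k V ⊗[k] N))
      (diagAction ρ).toLinearMap (inducedD δ ρ σ ∘ₗ (dualAction k H V).flip f) h := by
  have right_sum (f : Module.Dual k V) (h : H) (n : N) : σ f (ρ h n) =
      ∑ p ∈ (ℛ k h).index, ρ ((ℛ k h).left p) (σ (dualAction k H V ((ℛ k h).right p) f) n) := by
    simpa [sweedlerMul_eq_sum] using LinearMap.congr_fun (right f h) n
  have lTensor_right : convConst k H (LinearMap.lTensor (TensorAlgebra k V) (σ f)) *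
      toConv (diagAction ρ).toLinearMap = toConv (diagAction ρ).toLinearMap *
        toConv (LinearMap.lTensorHom (TensorAlgebra k V) ∘ₗ σ ∘ₗ (dualAction k H V).flip f) := by
    have commute : Commute (convConst k H (LinearMap.lTensor (TensorAlgebra k V) (σ f)))
        (toConv (LinearMap.rTensorHom N ∘ₗ leftT k H V)) := by
      refine WithConv.ext <| LinearMap.ext fun h => TensorProduct.ext' fun z n => ?_
      rw [convMul_convConst_apply, convConst_convMul_apply]
      simp
    rw [toConv_diagAction, ← mul_assoc, commute.eq, mul_assoc, mul_assoc]
    congr 1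
    refine WithConv.ext <| LinearMap.ext fun h => TensorProduct.ext' fun z n => ?_
    rw [convConst_convMul_apply, Coalgebra.Repr.convMul_apply (ℛ k h)]
    simp [right_sum, TensorProduct.tmul_sum]
  refine TensorProduct.ext' fun x n => ?_
  have free_part := LinearMap.congr_fun (congrArg
    (fun F : WithConv (H →ₗ[k] Module.End k (TensorAlgebra k V ⊗[k] N)) => F h) lTensor_right)
    (x ⊗ₜ n)
  rw [convConst_convMul_apply, Coalgebra.Repr.convMul_apply (ℛ k h)] at free_part
  have skew_part := contractAct_diagAction hδ ρ f h (skewDer δ x) n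
  simp only [← skewDer_leftT hδ] at skew_part
  rw [sweedlerMul_eq_sum]
  simp only [Module.End.mul_apply, LinearMap.sum_apply, LinearMap.comp_apply,
    LinearMap.flip_apply, AlgHom.toLinearMap_apply, LinearMap.coe_lTensorHom,
    LinearMap.lTensor_tmul, inducedD_tmul, map_add, Finset.sum_add_distrib] at free_part ⊢
  rw [← free_part, ← skew_part]
  simp [diagAction_apply, inducedD_tmul, Finset.sum_add_distrib]

theorem contractAct_moveRight (ρ : H →ₐ[k] Module.End k N) (f : Module.Dual k V) (v : V)
    (x : TensorAlgebra k V) (n : N) :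
    contractAct δ ρ f (moveRight δ v x ⊗ₜ n) = diagAction ρ (pairing δ f v) (x ⊗ₜ n) := by
  have contract_map : contractAct δ ρ f ∘ₗ (TensorProduct.mk k _ N).flip n ∘ₗ
      LinearMap.rTensor V ((leftT k H V).flip x) =
      TensorProduct.map ((leftT k H V).flip x) (ρ.toLinearMap.flip n) ∘ₗ
        LinearMap.lTensor H (pairingLin δ f) :=
    TensorProduct.ext' fun h u => by simp
  rw [diagAction_tmul, comul_pairing hδ]
  exact LinearMap.congr_fun contract_map (δ v)

theorem inducedD_commutator (ρ : H →ₐ[k] Module.End k N)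
    (σ : Module.Dual k V →ₗ[k] Module.End k N) (f : Module.Dual k V) (v : V) :
    inducedD δ ρ σ f * inducedV k V N v - inducedV k V N v * inducedD δ ρ σ f =
      diagAction ρ (pairing δ f v) := by
  refine TensorProduct.ext' fun x n => ?_
  have contractAct_smul (s : TensorAlgebra k V ⊗[k] V) :
      contractAct δ ρ f ((TensorAlgebra.ι k v • s) ⊗ₜ n) =
        TensorAlgebra.ι k v • contractAct δ ρ f (s ⊗ₜ n) := by
    induction s with
    | zero => simp
    | add s t hs ht => simp only [smul_add, TensorProduct.add_tmul, map_add, hs, ht]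
    | tmul y u => simp [TensorProduct.smul_tmul']
  simp only [LinearMap.sub_apply, Module.End.mul_apply, inducedV_apply,
    TensorProduct.smul_tmul', smul_eq_mul, inducedD_tmul, skewDer_ι_mul, TensorProduct.add_tmul,
    map_add, contractAct_moveRight hδ, contractAct_smul]
  abel

end Induced

section TriangularDecomposition

variable {k : Type*} [Field k] {H : Type*} [Ring H] [HopfAlgebra k H]
  {V : Type*} [AddCommGroup V] [Module k V] [Module H V] [IsScalarTower k H V]

variable (k H V) in
/-- The space `T(V) ⊗ (H ⊗ T(V^*))` on which the free double is represented. -/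
abbrev TripleModule : Type _ :=
  TensorAlgebra k V ⊗[k] (H ⊗[k] TensorAlgebra k (Module.Dual k V))

variable (k H V) in
/-- The action of `V^*` on the module `H ⊗ T(V^*)` over `H ⋉ T(V^*)`, where
`f · (h ⊗ y) = h₁ ⊗ (f ◁ h₂) y`. -/
def posD : Module.Dual k V →ₗ[k] Module.End k (H ⊗[k] TensorAlgebra k (Module.Dual k V)) where
  toFun f := LinearMap.lTensor H (LinearMap.mul' k _ ∘ₗ
      LinearMap.rTensor _ (TensorAlgebra.ι k ∘ₗ (dualAction k H V).flip f)) ∘ₗ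
    (TensorProduct.assoc k H H _).toLinearMap ∘ₗ LinearMap.rTensor _ (Coalgebra.comul (R := k))
  map_add' f g := by
    simp only [map_add, LinearMap.comp_add, LinearMap.rTensor_add, LinearMap.lTensor_add,
      LinearMap.add_comp]
  map_smul' c f := by
    simp only [map_smul, LinearMap.comp_smul, LinearMap.rTensor_smul, LinearMap.lTensor_smul,
      LinearMap.smul_comp, RingHom.id_apply]

theorem posD_tmul (f : Module.Dual k V) (h : H) (y : TensorAlgebra k (Module.Dual k V)) :
    posD k H V f (h ⊗ₜ y) = LinearMap.lTensor H (LinearMap.mulRight k y ∘ₗ TensorAlgebra.ι k ∘ₗ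
      (dualAction k H V).flip f) (Coalgebra.comul (R := k) h) := by
  simp [posD, comul_eq_sum h, TensorProduct.sum_tmul]

theorem posD_mul_lsmul (f : Module.Dual k V) (h : H) :
    posD k H V f * Algebra.lsmul k k _ h =
      sweedlerMul (A := Module.End k (H ⊗[k] TensorAlgebra k (Module.Dual k V)))
        (Algebra.lsmul k k _).toLinearMap (posD k H V ∘ₗ (dualAction k H V).flip f) h := by
  refine TensorProduct.ext' fun g y => ?_
  have dualAction_mul (a b : H) : dualAction k H V (a * b) f =
      dualAction k H V b (dualAction k H V a f) := by
    ext v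
    simp [mul_smul]
  simp [sweedlerMul_eq_sum, TensorProduct.smul_tmul', posD_tmul, comul_eq_sum h, comul_eq_sum g,
    Finset.sum_mul_sum, dualAction_mul]

variable {δ : V →ₗ[k] H ⊗[k] V} (hδ : IsYetterDrinfeld δ)

include hδ in
theorem isFreeDoubleData_induced :
    IsFreeDoubleData (A := Module.End k (TripleModule k H V)) δ (inducedV k V _)
      (diagAction (Algebra.lsmul k k _)) (inducedD δ (Algebra.lsmul k k _) (posD k H V)) where
  left := diagAction_mul_inducedV _
  right := inducedD_mul_diagAction hδ _ _ posD_mul_lsmul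
  comm := inducedD_commutator hδ _ _

/-- The representation of the free double on `T(V) ⊗ (H ⊗ T(V^*))`: the module induced from the
`H ⋉ T(V^*)`-module `H ⊗ T(V^*)`. -/
def tripleRep : FreeDouble δ →ₐ[k] Module.End k (TripleModule k H V) :=
  (isFreeDoubleData_induced hδ).lift

theorem tripleRep_freeV (x : TensorAlgebra k V) (t : TripleModule k H V) :
    tripleRep hδ (freeV δ x) t = x • t := by
  have comp_freeV : (tripleRep hδ).comp (freeV δ) = Algebra.lsmul k k _ :=
    TensorAlgebra.hom_ext <| LinearMap.ext (isFreeDoubleData_induced hδ).lift_freeV_ι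
  exact LinearMap.congr_fun (DFunLike.congr_fun comp_freeV x) t

theorem tripleRep_freeH (h : H) :
    tripleRep hδ (freeH δ h) = diagAction (Algebra.lsmul k k _) h :=
  (isFreeDoubleData_induced hδ).lift_freeH h

theorem tripleRep_freeD_one (y : TensorAlgebra k (Module.Dual k V)) :
    tripleRep hδ (freeD δ y) (1 ⊗ₜ (1 ⊗ₜ 1)) = 1 ⊗ₜ (1 ⊗ₜ y) := by
  refine LinearMap.congr_fun (tensorAlgebra_linearMap_ext_ι_mul
    (LinearMap.applyₗ ((1 : TensorAlgebra k V) ⊗ₜ ((1 : H) ⊗ₜ 1)) ∘ₗ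
      ((tripleRep hδ).comp (freeD δ)).toLinearMap)
    (TensorProduct.mk k _ _ 1 ∘ₗ TensorProduct.mk k _ _ 1) (by simp) fun f y hy => ?_) y
  have dualAction_one : dualAction k H V 1 f = f := by
    ext v
    simp
  simp only [LinearMap.comp_apply, LinearMap.applyₗ_apply_apply, AlgHom.toLinearMap_apply,
    AlgHom.comp_apply, TensorProduct.mk_apply, map_mul, Module.End.mul_apply] at hy ⊢
  rw [hy, tripleRep, (isFreeDoubleData_induced hδ).lift_freeD_ι, inducedD_tmul, skewDer_one,
    posD_tmul, Bialgebra.comul_one, Algebra.TensorProduct.one_def]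
  simp [dualAction_one]

theorem tripleRep_tripleMul
    (t : (TensorAlgebra k V ⊗[k] H) ⊗[k] TensorAlgebra k (Module.Dual k V)) :
    tripleRep hδ (tripleMul (freeV δ) (freeH δ) (freeD δ) t) (1 ⊗ₜ (1 ⊗ₜ 1)) =
      TensorProduct.assoc k _ _ _ t := by
  suffices LinearMap.applyₗ (1 ⊗ₜ (1 ⊗ₜ 1)) ∘ₗ (tripleRep hδ).toLinearMap ∘ₗ
      tripleMul (freeV δ) (freeH δ) (freeD δ) = (TensorProduct.assoc k _ _ _).toLinearMap from
    LinearMap.congr_fun this t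
  refine TensorProduct.ext_threefold fun x h y => ?_
  have counit_smul := sum_counit_left_smul_map (TensorProduct.mk k (TensorAlgebra k V) _ x ∘ₗ
    (TensorProduct.mk k H (TensorAlgebra k (Module.Dual k V))).flip y) h
  simpa [tripleMul, tripleRep_freeD_one hδ, tripleRep_freeH, tripleRep_freeV, diagAction_apply,
    TensorProduct.smul_tmul', tensorAction_one, Algebra.algebraMap_eq_smul_one]
    using counit_smul

include hδ in
theorem tripleMul_bijective :
    Function.Bijective (tripleMul (freeV δ) (freeH δ) (freeD δ)) := by
  refine ⟨fun s t hst => (TensorProduct.assoc k _ _ _).injective ?_, tripleMul_surjective hδ⟩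
  rw [← tripleRep_tripleMul hδ s, hst, tripleRep_tripleMul]

end TriangularDecomposition

/-! ### The Harish-Chandra pairing -/

section HarishChandra

variable {k : Type*} [Field k] {H : Type*} [Ring H] [HopfAlgebra k H]
  {V : Type*} [AddCommGroup V] [Module k V] [Module H V] [IsScalarTower k H V]
  {δ : V →ₗ[k] H ⊗[k] V} (hδ : IsYetterDrinfeld δ)

/-- The Harish-Chandra functional `x h y ↦ ε(x) ε(h) ε(y)` on the free double. -/
def hcFun : FreeDouble δ →ₗ[k] k :=
  LinearMap.mul' k k ∘ₗ TensorProduct.map TensorAlgebra.algebraMapInv.toLinearMap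
    (LinearMap.mul' k k ∘ₗ TensorProduct.map (Coalgebra.counit (R := k) (A := H))
      TensorAlgebra.algebraMapInv.toLinearMap) ∘ₗ
    LinearMap.applyₗ (1 ⊗ₜ (1 ⊗ₜ 1)) ∘ₗ (tripleRep hδ).toLinearMap

theorem hcFun_triple (x : TensorAlgebra k V) (h : H) (y : TensorAlgebra k (Module.Dual k V)) :
    hcFun hδ (freeV δ x * freeH δ h * freeD δ y) = TensorAlgebra.algebraMapInv x *
      (Coalgebra.counit (R := k) h * TensorAlgebra.algebraMapInv y) := by
  have rep_triple := tripleRep_tripleMul hδ ((x ⊗ₜ h) ⊗ₜ y)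
  simp only [tripleMul, LinearMap.comp_apply, TensorProduct.map_tmul, LinearMap.mul'_apply,
    AlgHom.toLinearMap_apply, TensorProduct.assoc_tmul] at rep_triple
  simp only [hcFun, LinearMap.comp_apply, LinearMap.applyₗ_apply_apply, AlgHom.toLinearMap_apply,
    rep_triple]
  simp

theorem hcFun_freeV (x : TensorAlgebra k V) :
    hcFun hδ (freeV δ x) = TensorAlgebra.algebraMapInv x := by
  simpa using hcFun_triple hδ x 1 1

theorem hcFun_freeD (y : TensorAlgebra k (Module.Dual k V)) :
    hcFun hδ (freeD δ y) = TensorAlgebra.algebraMapInv y := by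
  simpa using hcFun_triple hδ 1 1 y

theorem hcFun_freeV_mul (x : TensorAlgebra k V) (a : FreeDouble δ) :
    hcFun hδ (freeV δ x * a) = TensorAlgebra.algebraMapInv x * hcFun hδ a := by
  induction a using freeDouble_triple_induction hδ with
  | add a b ha hb => rw [mul_add, map_add, map_add, ha, hb, mul_add]
  | triple x' h y =>
    rw [← mul_assoc, ← mul_assoc, ← map_mul, hcFun_triple, hcFun_triple, map_mul, mul_assoc]

theorem hcFun_mul_freeD (y : TensorAlgebra k (Module.Dual k V)) (a : FreeDouble δ) :
    hcFun hδ (a * freeD δ y) = hcFun hδ a * TensorAlgebra.algebraMapInv y := by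
  induction a using freeDouble_triple_induction hδ with
  | add a b ha hb => rw [add_mul, map_add, map_add, ha, hb, add_mul]
  | triple x h y' =>
    rw [mul_assoc, ← map_mul, hcFun_triple, hcFun_triple, map_mul]
    ring

theorem hcFun_freeH_mul (h : H) (a : FreeDouble δ) :
    hcFun hδ (freeH δ h * a) = Coalgebra.counit (R := k) h * hcFun hδ a := by
  induction a using freeDouble_triple_induction hδ with
  | add a b ha hb => rw [mul_add, map_add, map_add, ha, hb, mul_add]
  | triple x g y =>
    rw [← mul_assoc, ← mul_assoc, freeH_mul_freeV_eq_sum, Finset.sum_mul, Finset.sum_mul,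
      map_sum, hcFun_triple, ← sum_counit_left_smul_map (Coalgebra.counit (R := k)) h,
      Finset.sum_mul]
    refine Finset.sum_congr rfl fun p _ => ?_
    rw [mul_assoc (freeV δ _), ← map_mul, hcFun_triple, algebraMapInv_tensorAction,
      Bialgebra.counit_mul, smul_eq_mul]
    ring

theorem hcFun_mul_freeH (h : H) (a : FreeDouble δ) :
    hcFun hδ (a * freeH δ h) = hcFun hδ a * Coalgebra.counit (R := k) h := by
  induction a using freeDouble_triple_induction hδ with
  | add a b ha hb => rw [add_mul, map_add, map_add, ha, hb, add_mul]
  | triple x g y =>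
    rw [mul_assoc, freeD_mul_freeH_eq_sum, Finset.mul_sum, map_sum, hcFun_triple,
      ← sum_counit_left_smul_map (Coalgebra.counit (R := k)) h, Finset.mul_sum]
    refine Finset.sum_congr rfl fun p _ => ?_
    rw [← mul_assoc, mul_assoc (freeV δ _), ← map_mul, hcFun_triple, algebraMapInv_tensorAction,
      Bialgebra.counit_mul, smul_eq_mul]
    ring

/-- The pairing `(y, x) ↦ E(y x)` of `T(V^*)` with `T(V)`, where `E` is the Harish-Chandra
functional. -/
def hcPairing : TensorAlgebra k (Module.Dual k V) →ₗ[k] TensorAlgebra k V →ₗ[k] k :=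
  ((LinearMap.mul k (FreeDouble δ)).compl₁₂ (freeD δ).toLinearMap (freeV δ).toLinearMap).compr₂
    (hcFun hδ)

@[simp]
theorem hcPairing_apply (y : TensorAlgebra k (Module.Dual k V)) (x : TensorAlgebra k V) :
    hcPairing hδ y x = hcFun hδ (freeD δ y * freeV δ x) := rfl

/-- The radical of the Harish-Chandra pairing in `T(V)`. -/
def radV : Submodule k (TensorAlgebra k V) := LinearMap.ker (hcPairing hδ).flip

/-- The radical of the Harish-Chandra pairing in `T(V^*)`. -/
def radD : Submodule k (TensorAlgebra k (Module.Dual k V)) := LinearMap.ker (hcPairing hδ)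

variable {hδ}

theorem mem_radV {x : TensorAlgebra k V} :
    x ∈ radV hδ ↔ ∀ y, hcFun hδ (freeD δ y * freeV δ x) = 0 :=
  LinearMap.mem_ker.trans LinearMap.ext_iff

theorem mem_radD {y : TensorAlgebra k (Module.Dual k V)} :
    y ∈ radD hδ ↔ ∀ x, hcFun hδ (freeD δ y * freeV δ x) = 0 :=
  LinearMap.mem_ker.trans LinearMap.ext_iff

theorem hcFun_mul_freeV_of_mem_radV {x : TensorAlgebra k V} (hx : x ∈ radV hδ)
    (a : FreeDouble δ) : hcFun hδ (a * freeV δ x) = 0 := by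
  induction a using freeDouble_triple_induction hδ with
  | add a b ha hb => rw [add_mul, map_add, ha, hb, add_zero]
  | triple x' h y =>
    rw [mul_assoc, mul_assoc, hcFun_freeV_mul, hcFun_freeH_mul, mem_radV.1 hx, mul_zero, mul_zero]

theorem hcFun_freeD_mul_of_mem_radD {y : TensorAlgebra k (Module.Dual k V)} (hy : y ∈ radD hδ)
    (a : FreeDouble δ) : hcFun hδ (freeD δ y * a) = 0 := by
  induction a using freeDouble_triple_induction hδ with
  | add a b ha hb => rw [mul_add, map_add, ha, hb, add_zero]
  | triple x h y' =>
    rw [← mul_assoc, ← mul_assoc, hcFun_mul_freeD, hcFun_mul_freeH, mem_radD.1 hy, zero_mul,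
      zero_mul]

theorem radV_le_tensorPos : radV hδ ≤ tensorPos k V := fun x hx => by
  have hcFun_eq := hcFun_mul_freeV_of_mem_radV hx 1
  rwa [one_mul, hcFun_freeV] at hcFun_eq

theorem radD_le_tensorPos : radD hδ ≤ tensorPos k (Module.Dual k V) := fun y hy => by
  have hcFun_eq := hcFun_freeD_mul_of_mem_radD hy 1
  rwa [mul_one, hcFun_freeD] at hcFun_eq

theorem mul_mem_radV (a : TensorAlgebra k V) {x : TensorAlgebra k V} (hx : x ∈ radV hδ) :
    a * x ∈ radV hδ := mem_radV.2 fun y => by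
  rw [map_mul (freeV δ), ← mul_assoc]
  exact hcFun_mul_freeV_of_mem_radV hx _

theorem mem_radD_mul {y : TensorAlgebra k (Module.Dual k V)} (hy : y ∈ radD hδ)
    (b : TensorAlgebra k (Module.Dual k V)) : y * b ∈ radD hδ := mem_radD.2 fun x => by
  rw [map_mul (freeD δ), mul_assoc]
  exact hcFun_freeD_mul_of_mem_radD hy _

theorem leftT_mem_radV (h : H) {x : TensorAlgebra k V} (hx : x ∈ radV hδ) :
    leftT k H V h x ∈ radV hδ := mem_radV.2 fun y => by
  have counit_sum := sum_counit_right_smul_map (hcFun hδ ∘ₗ LinearMap.mulLeft k (freeD δ y) ∘ₗ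
    (freeV δ).toLinearMap ∘ₗ (leftT k H V).flip x) h
  have hcFun_eq := hcFun_mul_freeV_of_mem_radV hx (freeD δ y * freeH δ h)
  rw [mul_assoc, freeH_mul_freeV_eq_sum, Finset.mul_sum, map_sum] at hcFun_eq
  simp only [← mul_assoc, hcFun_mul_freeH, mul_comm _ (Coalgebra.counit _)] at hcFun_eq
  exact counit_sum.symm.trans hcFun_eq

theorem dualT_mem_radD (h : H) {y : TensorAlgebra k (Module.Dual k V)} (hy : y ∈ radD hδ) :
    dualT k H V h y ∈ radD hδ := mem_radD.2 fun x => by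
  have counit_sum := sum_counit_left_smul_map (hcFun hδ ∘ₗ LinearMap.mulRight k (freeV δ x) ∘ₗ
    (freeD δ).toLinearMap ∘ₗ (dualT k H V).flip y) h
  have hcFun_eq := hcFun_freeD_mul_of_mem_radD hy (freeH δ h * freeV δ x)
  rw [← mul_assoc, freeD_mul_freeH_eq_sum, Finset.sum_mul, map_sum] at hcFun_eq
  simp only [mul_assoc, hcFun_freeH_mul] at hcFun_eq
  exact counit_sum.symm.trans hcFun_eq

theorem hcFun_mul_contract (a : FreeDouble δ) (f : Module.Dual k V)
    (t : TensorAlgebra k V ⊗[k] V) : hcFun hδ (a * contract δ f t) =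
      hcFun hδ (a * freeV δ (TensorProduct.rid k _ (LinearMap.lTensor _ f t))) := by
  have hcFun_comp : hcFun hδ ∘ₗ LinearMap.mulLeft k a ∘ₗ contract δ f =
      hcFun hδ ∘ₗ LinearMap.mulLeft k a ∘ₗ (freeV δ).toLinearMap ∘ₗ
        (TensorProduct.rid k _).toLinearMap ∘ₗ LinearMap.lTensor _ f :=
    TensorProduct.ext' fun x v => by
      simp [← mul_assoc, hcFun_mul_freeH, counit_pairing hδ, mul_comm]
  exact LinearMap.congr_fun hcFun_comp t

theorem rid_lTensor_skewDer_mem_radV {x : TensorAlgebra k V} (hx : x ∈ radV hδ)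
    (f : Module.Dual k V) :
    TensorProduct.rid k _ (LinearMap.lTensor _ f (skewDer δ x)) ∈ radV hδ := mem_radV.2 fun y => by
  have hcFun_eq := hcFun_mul_freeV_of_mem_radV hx (freeD δ y * freeD δ (TensorAlgebra.ι k f))
  rwa [mul_assoc, freeD_ι_mul_freeV hδ, mul_add, map_add, ← mul_assoc, hcFun_mul_freeD,
    mem_radV.1 hx, zero_mul, zero_add, hcFun_mul_contract] at hcFun_eq

theorem dualSkewDer_mem_radD {y : TensorAlgebra k (Module.Dual k V)} (hy : y ∈ radD hδ) (v : V) :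
    dualSkewDer δ y v ∈ radD hδ := mem_radD.2 fun x => by
  have hcFun_comp : hcFun hδ ∘ₗ LinearMap.mulRight k (freeV δ x) ∘ₗ
      LinearMap.mul' k (FreeDouble δ) ∘ₗ TensorProduct.map (freeH δ).toLinearMap
        ((freeD δ).toLinearMap ∘ₗ dualSkewDer δ y) =
      hcFun hδ ∘ₗ LinearMap.mulRight k (freeV δ x) ∘ₗ (freeD δ).toLinearMap ∘ₗ dualSkewDer δ y ∘ₗ
        (TensorProduct.lid k V).toLinearMap ∘ₗ LinearMap.rTensor V (Coalgebra.counit (R := k)) :=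
    TensorProduct.ext' fun h v => by simp [mul_assoc, hcFun_freeH_mul]
  have hcFun_coaction := LinearMap.congr_fun hcFun_comp (δ v)
  simp only [LinearMap.comp_apply, LinearEquiv.coe_coe, hδ.counit, TensorProduct.lid_tmul,
    one_smul, LinearMap.mulRight_apply, AlgHom.toLinearMap_apply] at hcFun_coaction
  have hcFun_eq := hcFun_freeD_mul_of_mem_radD hy (freeV δ (TensorAlgebra.ι k v) * freeV δ x)
  rwa [← mul_assoc, freeD_mul_freeV_ι hδ, add_mul, map_add, mul_assoc, hcFun_freeV_mul,
    mem_radD.1 hy, mul_zero, zero_add, hcFun_coaction] at hcFun_eq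

end HarishChandra

/-! ### The largest triangular ideal -/

section MaximalTriangularIdeal

variable {k : Type*} [Field k] {H : Type*} [Ring H] [HopfAlgebra k H]
  {V : Type*} [AddCommGroup V] [Module k V] [Module H V] [IsScalarTower k H V]
  {δ : V →ₗ[k] H ⊗[k] V} (hδ : IsYetterDrinfeld δ)

/-- The right ideal of the free double generated by the radical of the Harish-Chandra pairing in
`T(V)`. -/
def radVIdeal : Submodule k (FreeDouble δ) := (radV hδ).map (freeV δ).toLinearMap * ⊤

/-- The left ideal of the free double generated by the radical of the Harish-Chandra pairing in
`T(V^*)`. -/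
def radDIdeal : Submodule k (FreeDouble δ) := ⊤ * (radD hδ).map (freeD δ).toLinearMap

variable {hδ}

theorem freeV_mul_mem_radVIdeal {x : TensorAlgebra k V} (hx : x ∈ radV hδ) (a : FreeDouble δ) :
    freeV δ x * a ∈ radVIdeal hδ := Submodule.mul_mem_mul ⟨x, hx, rfl⟩ trivial

theorem mul_freeD_mem_radDIdeal {y : TensorAlgebra k (Module.Dual k V)} (hy : y ∈ radD hδ)
    (a : FreeDouble δ) : a * freeD δ y ∈ radDIdeal hδ := Submodule.mul_mem_mul trivial ⟨y, hy, rfl⟩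

theorem freeV_mem_radVIdeal {x : TensorAlgebra k V} (hx : x ∈ radV hδ) :
    freeV δ x ∈ radVIdeal hδ := by
  simpa using freeV_mul_mem_radVIdeal hx 1

theorem freeD_mem_radDIdeal {y : TensorAlgebra k (Module.Dual k V)} (hy : y ∈ radD hδ) :
    freeD δ y ∈ radDIdeal hδ := by
  simpa using mul_freeD_mem_radDIdeal hy 1

theorem radVIdeal_le {S : Submodule k (FreeDouble δ)}
    (freeV_mul_mem : ∀ x ∈ radV hδ, ∀ a, freeV δ x * a ∈ S) : radVIdeal hδ ≤ S := by
  rw [radVIdeal, Submodule.mul_le]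
  rintro _ ⟨x, hx, rfl⟩ a -
  exact freeV_mul_mem x hx a

theorem radDIdeal_le {S : Submodule k (FreeDouble δ)}
    (mul_freeD_mem : ∀ y ∈ radD hδ, ∀ a, a * freeD δ y ∈ S) : radDIdeal hδ ≤ S := by
  rw [radDIdeal, Submodule.mul_le]
  rintro a - _ ⟨y, hy, rfl⟩
  exact mul_freeD_mem y hy a

theorem mem_radVIdeal_mul {q : FreeDouble δ} (hq : q ∈ radVIdeal hδ) (a : FreeDouble δ) :
    q * a ∈ radVIdeal hδ :=
  radVIdeal_le (S := (radVIdeal hδ).comap (LinearMap.mulRight k a)) (fun x hx b => by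
    simpa [mul_assoc] using freeV_mul_mem_radVIdeal hx (b * a)) hq

theorem mul_mem_radDIdeal {q : FreeDouble δ} (hq : q ∈ radDIdeal hδ) (a : FreeDouble δ) :
    a * q ∈ radDIdeal hδ :=
  radDIdeal_le (S := (radDIdeal hδ).comap (LinearMap.mulLeft k a)) (fun y hy b => by
    simpa [mul_assoc] using mul_freeD_mem_radDIdeal hy (a * b)) hq

theorem mul_mem_radVIdeal_of_mul_freeV {a : FreeDouble δ}
    (mul_freeV_mem : ∀ x ∈ radV hδ, a * freeV δ x ∈ radVIdeal hδ) :
    ∀ q ∈ radVIdeal hδ, a * q ∈ radVIdeal hδ := fun _ hq =>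
  radVIdeal_le (S := (radVIdeal hδ).comap (LinearMap.mulLeft k a)) (fun x hx b => by
    simpa [mul_assoc] using mem_radVIdeal_mul (mul_freeV_mem x hx) b) hq

theorem mem_radDIdeal_mul_of_freeD_mul {a : FreeDouble δ}
    (freeD_mul_mem : ∀ y ∈ radD hδ, freeD δ y * a ∈ radDIdeal hδ) :
    ∀ q ∈ radDIdeal hδ, q * a ∈ radDIdeal hδ := fun _ hq =>
  radDIdeal_le (S := (radDIdeal hδ).comap (LinearMap.mulRight k a)) (fun y hy b => by
    simpa [mul_assoc] using mul_mem_radDIdeal (freeD_mul_mem y hy) b) hq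

theorem contract_skewDer_mem_radVIdeal {x : TensorAlgebra k V} (hx : x ∈ radV hδ)
    (f : Module.Dual k V) : contract δ f (skewDer δ x) ∈ radVIdeal hδ := by
  let b := Module.Basis.ofVectorSpace k V
  classical
  rw [← (TensorProduct.equivFinsuppOfBasisRight b).symm_apply_apply (skewDer δ x),
    TensorProduct.equivFinsuppOfBasisRight_symm_apply, Finsupp.sum, map_sum]
  refine Submodule.sum_mem _ fun i _ => ?_
  rw [contract_tmul, TensorProduct.equivFinsuppOfBasisRight_apply]
  exact freeV_mul_mem_radVIdeal (rid_lTensor_skewDer_mem_radV hx _) _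

theorem mul_mem_radVIdeal (a : FreeDouble δ) : ∀ q ∈ radVIdeal hδ, a * q ∈ radVIdeal hδ := by
  refine mul_mem_of_generators (fun v => mul_mem_radVIdeal_of_mul_freeV fun x hx => ?_)
    (fun h => mul_mem_radVIdeal_of_mul_freeV fun x hx => ?_)
    (fun f => mul_mem_radVIdeal_of_mul_freeV fun x hx => ?_) a
  · rw [← map_mul]
    exact freeV_mem_radVIdeal (mul_mem_radV _ hx)
  · rw [freeH_mul_freeV_eq_sum]
    exact Submodule.sum_mem _ fun _ _ => freeV_mul_mem_radVIdeal (leftT_mem_radV _ hx) _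
  · rw [freeD_ι_mul_freeV hδ]
    exact Submodule.add_mem _ (freeV_mul_mem_radVIdeal hx _) (contract_skewDer_mem_radVIdeal hx f)

theorem freeD_mul_freeV_ι_mem_radDIdeal {y : TensorAlgebra k (Module.Dual k V)}
    (hy : y ∈ radD hδ) (v : V) : freeD δ y * freeV δ (TensorAlgebra.ι k v) ∈ radDIdeal hδ := by
  rw [freeD_mul_freeV_ι hδ]
  refine Submodule.add_mem _ (mul_freeD_mem_radDIdeal hy _) ?_
  obtain ⟨s, sum_eq⟩ := TensorProduct.exists_finset (δ v)
  rw [sum_eq, map_sum, map_sum]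
  exact Submodule.sum_mem _ fun p _ => mul_freeD_mem_radDIdeal (dualSkewDer_mem_radD hy p.2) _

theorem mem_radDIdeal_mul (a : FreeDouble δ) : ∀ q ∈ radDIdeal hδ, q * a ∈ radDIdeal hδ := by
  refine mem_mul_of_generators
    (fun v => mem_radDIdeal_mul_of_freeD_mul fun y hy => freeD_mul_freeV_ι_mem_radDIdeal hy v)
    (fun h => mem_radDIdeal_mul_of_freeD_mul fun y hy => ?_)
    (fun f => mem_radDIdeal_mul_of_freeD_mul fun y hy => ?_) a
  · rw [freeD_mul_freeH_eq_sum]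
    exact Submodule.sum_mem _ fun _ _ => mul_freeD_mem_radDIdeal (dualT_mem_radD _ hy) _
  · rw [← map_mul]
    exact freeD_mem_radDIdeal (mem_radD_mul hy _)

theorem radVIdeal_le_ker_hcFun : radVIdeal hδ ≤ LinearMap.ker (hcFun hδ) :=
  radVIdeal_le fun x hx a => by
    rw [LinearMap.mem_ker, hcFun_freeV_mul,
      show TensorAlgebra.algebraMapInv x = 0 from radV_le_tensorPos hx, zero_mul]

theorem radDIdeal_le_ker_hcFun : radDIdeal hδ ≤ LinearMap.ker (hcFun hδ) :=
  radDIdeal_le fun y hy a => by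
    rw [LinearMap.mem_ker, hcFun_mul_freeD,
      show TensorAlgebra.algebraMapInv y = 0 from radD_le_tensorPos hy, mul_zero]

theorem mem_radV_mul {x : TensorAlgebra k V} (hx : x ∈ radV hδ) (b : TensorAlgebra k V) :
    x * b ∈ radV hδ := mem_radV.2 fun y => by
  rw [map_mul (freeV δ)]
  exact radVIdeal_le_ker_hcFun (mul_mem_radVIdeal _ _ (freeV_mul_mem_radVIdeal hx _))

theorem mul_mem_radD (b : TensorAlgebra k (Module.Dual k V))
    {y : TensorAlgebra k (Module.Dual k V)} (hy : y ∈ radD hδ) :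
    b * y ∈ radD hδ := mem_radD.2 fun x => by
  rw [map_mul (freeD δ)]
  exact radDIdeal_le_ker_hcFun (mem_radDIdeal_mul _ _ (mul_freeD_mem_radDIdeal hy _))

theorem isTwoSidedIdeal_radV : IsTwoSidedIdeal (radV hδ) :=
  fun a _ hs => ⟨mul_mem_radV a hs, mem_radV_mul hs a⟩

theorem isTwoSidedIdeal_radD : IsTwoSidedIdeal (radD hδ) :=
  fun a _ hs => ⟨mul_mem_radD a hs, mem_radD_mul hs a⟩

theorem triangularSubspace_radV_radD :
    triangularSubspace δ (radV hδ) (radD hδ) = radVIdeal hδ ⊔ radDIdeal hδ := by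
  refine le_antisymm (triangularSubspace_le ?_ ?_)
    (sup_le (radVIdeal_le fun x hx a => ?_) (radDIdeal_le fun y hy a => ?_))
  · intro x hx h y
    rw [mul_assoc]
    exact Submodule.mem_sup_left (freeV_mul_mem_radVIdeal hx _)
  · intro x h y hy
    exact Submodule.mem_sup_right (mul_freeD_mem_radDIdeal hy _)
  · induction a using freeDouble_triple_induction hδ with
    | add a b ha hb => rw [mul_add]; exact Submodule.add_mem _ ha hb
    | triple x' h y =>
      rw [← mul_assoc, ← mul_assoc, ← map_mul]
      exact mem_triangularSubspace_left _ (mem_radV_mul hx _) _ _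
  · induction a using freeDouble_triple_induction hδ with
    | add a b ha hb => rw [add_mul]; exact Submodule.add_mem _ ha hb
    | triple x h y' =>
      rw [mul_assoc, ← map_mul]
      exact mem_triangularSubspace_right _ _ _ (mul_mem_radD _ hy)

theorem mul_mem_radVIdeal_sup_radDIdeal (a : FreeDouble δ) {q : FreeDouble δ}
    (hq : q ∈ radVIdeal hδ ⊔ radDIdeal hδ) : a * q ∈ radVIdeal hδ ⊔ radDIdeal hδ :=
  (sup_le (c := (radVIdeal hδ ⊔ radDIdeal hδ).comap (LinearMap.mulLeft k a))
    (fun _ hq => Submodule.mem_sup_left (mul_mem_radVIdeal a _ hq))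
    (fun _ hq => Submodule.mem_sup_right (mul_mem_radDIdeal hq a))) hq

theorem mem_radVIdeal_sup_radDIdeal_mul {q : FreeDouble δ}
    (hq : q ∈ radVIdeal hδ ⊔ radDIdeal hδ) (a : FreeDouble δ) :
    q * a ∈ radVIdeal hδ ⊔ radDIdeal hδ :=
  (sup_le (c := (radVIdeal hδ ⊔ radDIdeal hδ).comap (LinearMap.mulRight k a))
    (fun _ hq => Submodule.mem_sup_left (mem_radVIdeal_mul hq a))
    (fun _ hq => Submodule.mem_sup_right (mem_radDIdeal_mul a _ hq))) hq

variable (hδ) in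
/-- The two-sided ideal of the free double spanned by the two radicals of the Harish-Chandra
pairing; it is the largest triangular ideal. -/
def radIdeal : TwoSidedIdeal (FreeDouble δ) :=
  TwoSidedIdeal.mk' (radVIdeal hδ ⊔ radDIdeal hδ : Submodule k (FreeDouble δ))
    (Submodule.zero_mem _) (fun ha hb => Submodule.add_mem _ ha hb)
    (fun ha => Submodule.neg_mem _ ha) (fun hb => mul_mem_radVIdeal_sup_radDIdeal _ hb)
    (fun ha => mem_radVIdeal_sup_radDIdeal_mul ha _)

variable (hδ) in
theorem isTriangularWith_radIdeal : IsTriangularWith δ (radIdeal hδ) (radV hδ) (radD hδ) where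
  left_le := radV_le_tensorPos
  right_le := radD_le_tensorPos
  coe_eq := by
    rw [triangularSubspace_radV_radD, radIdeal]
    exact TwoSidedIdeal.coe_mk' _ _ _ _ _ _

variable (hδ) in
theorem triangularSubspace_le_ker_hcFun {Im : Submodule k (TensorAlgebra k V)}
    {Ip : Submodule k (TensorAlgebra k (Module.Dual k V))} (left_le : Im ≤ tensorPos k V)
    (right_le : Ip ≤ tensorPos k (Module.Dual k V)) :
    triangularSubspace δ Im Ip ≤ LinearMap.ker (hcFun hδ) := by
  refine triangularSubspace_le (fun x hx h y => ?_) (fun x h y hy => ?_)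
  · rw [LinearMap.mem_ker, hcFun_triple,
      show TensorAlgebra.algebraMapInv x = 0 from left_le hx, zero_mul]
  · rw [LinearMap.mem_ker, hcFun_triple,
      show TensorAlgebra.algebraMapInv y = 0 from right_le hy, mul_zero, mul_zero]

section IsTriangularWith

variable {J : TwoSidedIdeal (FreeDouble δ)} {Im : Submodule k (TensorAlgebra k V)}
  {Ip : Submodule k (TensorAlgebra k (Module.Dual k V))}

theorem IsTriangularWith.mem_iff (hJ : IsTriangularWith δ J Im Ip) {a : FreeDouble δ} :
    a ∈ J ↔ a ∈ triangularSubspace δ Im Ip := by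
  rw [← SetLike.mem_coe, hJ.coe_eq, SetLike.mem_coe]

theorem IsTriangularWith.freeV_mem (hJ : IsTriangularWith δ J Im Ip) {x : TensorAlgebra k V}
    (hx : x ∈ Im) : freeV δ x ∈ J :=
  hJ.mem_iff.2 (by simpa using mem_triangularSubspace_left (δ := δ) Ip hx (1 : H) 1)

theorem IsTriangularWith.freeD_mem (hJ : IsTriangularWith δ J Im Ip)
    {y : TensorAlgebra k (Module.Dual k V)} (hy : y ∈ Ip) : freeD δ y ∈ J :=
  hJ.mem_iff.2 (by simpa using mem_triangularSubspace_right (δ := δ) Im 1 (1 : H) hy)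

variable (hδ) in
theorem IsTriangularWith.hcFun_eq_zero (hJ : IsTriangularWith δ J Im Ip) {a : FreeDouble δ}
    (ha : a ∈ J) : hcFun hδ a = 0 :=
  triangularSubspace_le_ker_hcFun hδ hJ.left_le hJ.right_le (hJ.mem_iff.1 ha)

variable (hδ) in
theorem IsTriangularWith.le_radV (hJ : IsTriangularWith δ J Im Ip) : Im ≤ radV hδ :=
  fun _ hx => mem_radV.2 fun _ => hJ.hcFun_eq_zero hδ (J.mul_mem_left _ _ (hJ.freeV_mem hx))

variable (hδ) in
theorem IsTriangularWith.le_radD (hJ : IsTriangularWith δ J Im Ip) : Ip ≤ radD hδ :=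
  fun _ hy => mem_radD.2 fun _ => hJ.hcFun_eq_zero hδ (J.mul_mem_right _ _ (hJ.freeD_mem hy))

end IsTriangularWith

theorem idealV_eq (hδ : IsYetterDrinfeld δ) : idealV δ = radV hδ :=
  le_antisymm (sSup_le (by rintro _ ⟨J, Ip, hJ⟩; exact hJ.le_radV hδ))
    (le_sSup ⟨_, _, isTriangularWith_radIdeal hδ⟩)

theorem idealD_eq (hδ : IsYetterDrinfeld δ) : idealD δ = radD hδ :=
  le_antisymm (sSup_le (by rintro _ ⟨J, Im, hJ⟩; exact hJ.le_radD hδ))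
    (le_sSup ⟨_, _, isTriangularWith_radIdeal hδ⟩)

theorem maxTriangular_eq (hδ : IsYetterDrinfeld δ) : maxTriangular δ = radIdeal hδ := by
  refine le_antisymm (sSup_le ?_) (le_sSup ⟨_, _, isTriangularWith_radIdeal hδ⟩)
  rintro J ⟨Im, Ip, hJ⟩
  rw [TwoSidedIdeal.le_iff, hJ.coe_eq, (isTriangularWith_radIdeal hδ).coe_eq]
  exact triangularSubspace_le (S := triangularSubspace δ (radV hδ) (radD hδ))
    (fun x hx h y => mem_triangularSubspace_left _ (hJ.le_radV hδ hx) h y)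
    (fun x h y hy => mem_triangularSubspace_right _ x h (hJ.le_radD hδ hy))

theorem isTriangularWith_maxTriangular (hδ : IsYetterDrinfeld δ) :
    IsTriangularWith δ (maxTriangular δ) (idealV δ) (idealD δ) := by
  rw [maxTriangular_eq hδ, idealV_eq hδ, idealD_eq hδ]
  exact isTriangularWith_radIdeal hδ

end MaximalTriangularIdeal

/-! ### Braided factorials -/

section TensorPower

variable {R : Type*} [CommRing R] {M : Type*} [AddCommGroup M] [Module R M]
  {N : Type*} [AddCommGroup N] [Module R N]

/-- The isomorphism `M^{⊗n} ⊗ M ≃ M^{⊗(n+1)}`. -/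
def snocEquiv {n : ℕ} : (⨂[R]^n M) ⊗[R] M ≃ₗ[R] ⨂[R]^(n + 1) M :=
  (TensorProduct.congr (LinearEquiv.refl R _)
    (PiTensorProduct.subsingletonEquiv (R := R) (s := fun _ => M) (0 : Fin 1)).symm).trans
    TensorPower.mulEquiv

theorem snocEquiv_tprod {n : ℕ} (v : Fin n → M) (a : M) :
    snocEquiv (PiTensorProduct.tprod R v ⊗ₜ a) =
      PiTensorProduct.tprod R (Fin.snoc v a : Fin (n + 1) → M) := by
  have symm_apply : (PiTensorProduct.subsingletonEquiv (R := R) (s := fun _ => M)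
      (0 : Fin 1)).symm a = PiTensorProduct.tprod R (fun _ => a) := by
    rw [LinearEquiv.symm_apply_eq, PiTensorProduct.subsingletonEquiv_apply_tprod]
  rw [snocEquiv, LinearEquiv.trans_apply, TensorProduct.congr_tmul, LinearEquiv.refl_apply,
    symm_apply]
  exact (TensorPower.tprod_mul_tprod R v fun _ : Fin 1 => a).trans
    (congrArg _ (Fin.append_right_eq_snoc v fun _ : Fin 1 => a))

theorem tensorPower_succ_ext {n : ℕ} {F G : ⨂[R]^(n + 1) M →ₗ[R] N}
    (h : ∀ x a, F (snocEquiv (x ⊗ₜ a)) = G (snocEquiv (x ⊗ₜ a))) : F = G :=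
  (LinearMap.cancel_right snocEquiv.surjective).1 (TensorProduct.ext' h)

theorem tensorPower_succ_ext_tprod {n : ℕ} {F G : ⨂[R]^(n + 1) M →ₗ[R] N}
    (h : ∀ v a, F (snocEquiv (PiTensorProduct.tprod R v ⊗ₜ a)) =
      G (snocEquiv (PiTensorProduct.tprod R v ⊗ₜ a))) : F = G :=
  PiTensorProduct.ext <| MultilinearMap.ext fun v => by
    simpa only [LinearMap.compMultilinearMap_apply, snocEquiv_tprod, Fin.snoc_init_self] using
      h (Fin.init v) (v (Fin.last n))

/-- The isomorphism `M^{⊗n} ⊗ (M ⊗ M) ≃ M^{⊗(n+2)}`. -/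
def snocEquiv₂ {n : ℕ} : (⨂[R]^n M) ⊗[R] (M ⊗[R] M) ≃ₗ[R] ⨂[R]^(n + 1 + 1) M :=
  (TensorProduct.assoc R _ M M).symm.trans
    ((TensorProduct.congr snocEquiv (LinearEquiv.refl R M)).trans snocEquiv)

@[simp]
theorem snocEquiv₂_tmul {n : ℕ} (x : ⨂[R]^n M) (a b : M) :
    snocEquiv₂ (x ⊗ₜ (a ⊗ₜ[R] b)) = snocEquiv (snocEquiv (x ⊗ₜ a) ⊗ₜ b) := rfl

theorem tensorPower_add_two_ext {n : ℕ} {F G : ⨂[R]^(n + 1 + 1) M →ₗ[R] N}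
    (h : ∀ x t, F (snocEquiv₂ (x ⊗ₜ t)) = G (snocEquiv₂ (x ⊗ₜ t))) : F = G :=
  (LinearMap.cancel_right snocEquiv₂.surjective).1 (TensorProduct.ext' h)

open TensorPower (toTensorAlgebra)

theorem toTensorAlgebra_tprod_zero (v : Fin 0 → M) :
    toTensorAlgebra (PiTensorProduct.tprod R v) = 1 := by
  rw [TensorPower.toTensorAlgebra_tprod, TensorAlgebra.tprod_apply, List.ofFn_zero, List.prod_nil]

theorem toTensorAlgebra_snocEquiv {n : ℕ} (x : ⨂[R]^n M) (a : M) :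
    toTensorAlgebra (snocEquiv (x ⊗ₜ a)) = toTensorAlgebra x * TensorAlgebra.ι R a := by
  have comp_eq : toTensorAlgebra ∘ₗ snocEquiv.toLinearMap ∘ₗ (TensorProduct.mk R _ _).flip a =
      LinearMap.mulRight R (TensorAlgebra.ι R a) ∘ₗ toTensorAlgebra (n := n) :=
    PiTensorProduct.ext <| MultilinearMap.ext fun v => by
      simp only [LinearMap.compMultilinearMap_apply, LinearMap.comp_apply, LinearMap.flip_apply,
        TensorProduct.mk_apply, LinearEquiv.coe_coe, snocEquiv_tprod, LinearMap.mulRight_apply,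
        TensorPower.toTensorAlgebra_tprod, TensorAlgebra.tprod_apply, List.ofFn_succ_last,
        List.prod_append, Fin.snoc_castSucc, Fin.snoc_last, List.prod_singleton]
  exact LinearMap.congr_fun comp_eq x

theorem algebraMapInv_comp_toTensorAlgebra_succ (n : ℕ) :
    TensorAlgebra.algebraMapInv.toLinearMap ∘ₗ toTensorAlgebra (R := R) (M := M) (n := n + 1) = 0 :=
  tensorPower_succ_ext fun x a => by
    simp [toTensorAlgebra_snocEquiv, TensorAlgebra.algebraMapInv]

theorem equivDirectSum_toTensorAlgebra {n : ℕ} (x : ⨂[R]^n M) :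
    TensorAlgebra.equivDirectSum (toTensorAlgebra x) =
      DirectSum.lof R ℕ (fun n => ⨂[R]^n M) n x := by
  rw [← AlgEquiv.eq_symm_apply]
  exact (DirectSum.toAddMonoid_of (fun _ => LinearMap.toAddMonoidHom toTensorAlgebra) _ _).symm

theorem tensorAlgebra_linearMap_ext_toTensorAlgebra {F G : TensorAlgebra R M →ₗ[R] N}
    (h : ∀ n, F ∘ₗ toTensorAlgebra (n := n) = G ∘ₗ toTensorAlgebra) : F = G := by
  refine (LinearMap.cancel_right (TensorAlgebra.equivDirectSum (R := R) (M := M)).symm.surjective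
    (f := F) (f' := G) (g := TensorAlgebra.equivDirectSum.symm.toLinearMap)).1 ?_
  refine DirectSum.linearMap_ext R fun n => LinearMap.ext fun x => ?_
  simpa [← equivDirectSum_toTensorAlgebra] using LinearMap.congr_fun (h n) x

end TensorPower

section Legs

variable {k : Type*} [Field k] {V : Type*} [AddCommGroup V] [Module k V]

/-- `F ↦ F ⊗ id_V` as an algebra homomorphism. -/
def tensorIdHom (k : Type*) [Field k] (V : Type*) [AddCommGroup V] [Module k V] (n : ℕ) :
    Module.End k (⨂[k]^n V) →ₐ[k] Module.End k (⨂[k]^(n + 1) V) :=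
  (TensorPower.mulEquiv.conjAlgEquiv k).toAlgHom.comp (Module.End.rTensorAlgHom k _ (⨂[k]^1 V))

theorem tensorIdHom_snocEquiv {n : ℕ} (F : Module.End k (⨂[k]^n V)) (x : ⨂[k]^n V) (a : V) :
    tensorIdHom k V n F (snocEquiv (x ⊗ₜ a)) = snocEquiv (F x ⊗ₜ a) := by
  change tensorId F _ = _
  simp [tensorId, snocEquiv]

variable (Ψ : V ⊗[k] V →ₗ[k] V ⊗[k] V)

theorem leg_tprod {n : ℕ} {i j : Fin n} (hij : i ≠ j) (v : Fin n → V) :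
    leg Ψ hij (PiTensorProduct.tprod k v) =
      TensorProduct.lift (insertPair hij v) (Ψ (v i ⊗ₜ[k] v j)) :=
  PiTensorProduct.lift.tprod _

theorem lift_insertPair_snoc {n : ℕ} {i j : Fin n} (hij : i ≠ j)
    (hij' : i.castSucc ≠ j.castSucc) (v : Fin n → V) (a : V) (t : V ⊗[k] V) :
    TensorProduct.lift (insertPair hij' (Fin.snoc v a)) t =
      snocEquiv (TensorProduct.lift (insertPair hij v) t ⊗ₜ a) := by
  have lift_eq : TensorProduct.lift (insertPair hij' (Fin.snoc v a)) =
      snocEquiv.toLinearMap ∘ₗ (TensorProduct.mk k _ _).flip a ∘ₗ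
        TensorProduct.lift (insertPair hij v) :=
    TensorProduct.ext' fun b c => by simp [insertPair_apply, snocEquiv_tprod]
  exact LinearMap.congr_fun lift_eq t

theorem leg_castSucc {n : ℕ} {i j : Fin n} (hij : i ≠ j) (hij' : i.castSucc ≠ j.castSucc) :
    leg Ψ hij' = tensorIdHom k V n (leg Ψ hij) :=
  tensorPower_succ_ext_tprod fun v a => by
    rw [tensorIdHom_snocEquiv, snocEquiv_tprod, leg_tprod, leg_tprod, Fin.snoc_castSucc,
      Fin.snoc_castSucc, lift_insertPair_snoc hij]

theorem adjLeg_castSucc {n : ℕ} (i : Fin n) :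
    adjLeg Ψ i.castSucc = tensorIdHom k V (n + 1) (adjLeg Ψ i) :=
  leg_castSucc Ψ (Fin.castSucc_lt_succ (i := i)).ne _

theorem lift_insertPair_snoc_snoc {n : ℕ} (v : Fin n → V) (a b : V) (t : V ⊗[k] V) :
    TensorProduct.lift (insertPair (Fin.castSucc_lt_succ (i := Fin.last n)).ne
      (Fin.snoc (Fin.snoc v a : Fin (n + 1) → V) b)) t =
      snocEquiv₂ (PiTensorProduct.tprod k v ⊗ₜ t) := by
  have lift_eq : TensorProduct.lift (insertPair (Fin.castSucc_lt_succ (i := Fin.last n)).ne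
      (Fin.snoc (Fin.snoc v a : Fin (n + 1) → V) b)) =
      snocEquiv₂.toLinearMap ∘ₗ TensorProduct.mk k _ _ (PiTensorProduct.tprod k v) :=
    TensorProduct.ext' fun c d => by
      have update_update : Function.update (Function.update
          (Fin.snoc (Fin.snoc v a : Fin (n + 1) → V) b : Fin (n + 1 + 1) → V)
          (Fin.last n).castSucc c) (Fin.last n).succ d =
          Fin.snoc (Fin.snoc v c : Fin (n + 1) → V) d := by
        rw [← Fin.snoc_update, Fin.update_snoc_last, Fin.succ_last, Fin.update_snoc_last]
      rw [TensorProduct.lift.tmul, insertPair_apply, update_update]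
      simp [snocEquiv_tprod]
  exact LinearMap.congr_fun lift_eq t

theorem adjLeg_last_snocEquiv₂ {n : ℕ} (x : ⨂[k]^n V) (t : V ⊗[k] V) :
    adjLeg Ψ (Fin.last n) (snocEquiv₂ (x ⊗ₜ t)) = snocEquiv₂ (x ⊗ₜ Ψ t) := by
  have comp_eq : adjLeg Ψ (Fin.last n) ∘ₗ snocEquiv₂.toLinearMap =
      snocEquiv₂.toLinearMap ∘ₗ LinearMap.lTensor _ Ψ := by
    refine TensorProduct.ext (PiTensorProduct.ext <| MultilinearMap.ext fun v =>
      TensorProduct.ext' fun a b => ?_)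
    simp [snocEquiv_tprod, adjLeg, leg_tprod, lift_insertPair_snoc_snoc]
  exact LinearMap.congr_fun comp_eq (x ⊗ₜ t)

theorem tensorIdHom_tensorIdHom_snocEquiv₂ {n : ℕ} (F : Module.End k (⨂[k]^n V)) (x : ⨂[k]^n V)
    (t : V ⊗[k] V) : tensorIdHom k V (n + 1) (tensorIdHom k V n F) (snocEquiv₂ (x ⊗ₜ t)) =
      snocEquiv₂ (F x ⊗ₜ t) := by
  induction t with
  | zero => simp
  | add s t hs ht => simp only [map_add, TensorProduct.tmul_add, hs, ht]
  | tmul a b => simp only [snocEquiv₂_tmul, tensorIdHom_snocEquiv]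

theorem commute_tensorIdHom_tensorIdHom_adjLeg_last {n : ℕ} (F : Module.End k (⨂[k]^n V)) :
    Commute (tensorIdHom k V (n + 1) (tensorIdHom k V n F)) (adjLeg Ψ (Fin.last n)) :=
  tensorPower_add_two_ext fun x t => by
    simp only [Module.End.mul_apply, adjLeg_last_snocEquiv₂, tensorIdHom_tensorIdHom_snocEquiv₂]

theorem braidedInt_zero : braidedInt Ψ 0 = 1 := by simp [braidedInt]

theorem braidedInt_succ (n : ℕ) : braidedInt Ψ (n + 1) =
    1 + adjLeg Ψ (Fin.last n) * tensorIdHom k V (n + 1) (braidedInt Ψ n) := by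
  have legs_succ : (List.finRange (n + 1)).reverse.map (adjLeg Ψ) = adjLeg Ψ (Fin.last n) ::
      ((List.finRange n).reverse.map (adjLeg Ψ)).map (tensorIdHom k V (n + 1)) := by
    simp [List.finRange_succ_last, adjLeg_castSucc, Function.comp_def]
  rw [braidedInt, Finset.sum_range_succ', legs_succ, braidedInt, map_sum, Finset.mul_sum]
  refine (add_comm _ _).trans ?_
  simp [List.map_take, map_list_prod]

theorem braidedFactorial_succ (n : ℕ) : braidedFactorial Ψ (n + 1) =
    tensorIdHom k V n (braidedFactorial Ψ n) * braidedInt Ψ n := rfl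

/-- The braided integer `id + Ψ_{n,n+1} + Ψ_{n-1,n} Ψ_{n,n+1} + ⋯ + Ψ_{1,2} ⋯ Ψ_{n,n+1}` on
`V^{⊗(n+1)}`, with the products taken in the order opposite to that of `braidedInt`. -/
def braidedIntRev : (n : ℕ) → Module.End k (⨂[k]^(n + 1) V)
  | 0 => 1
  | n + 1 => 1 + tensorIdHom k V (n + 1) (braidedIntRev n) * adjLeg Ψ (Fin.last n)

theorem braidedFactorial_succ_rev (n : ℕ) : braidedFactorial Ψ (n + 1) =
    braidedIntRev Ψ n * tensorIdHom k V n (braidedFactorial Ψ n) := by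
  induction n with
  | zero => rw [braidedFactorial_succ, braidedInt_zero, braidedIntRev, one_mul, mul_one]
  | succ n ih =>
    have commute_last := commute_tensorIdHom_tensorIdHom_adjLeg_last Ψ (braidedFactorial Ψ n)
    calc braidedFactorial Ψ (n + 2)
      _ = tensorIdHom k V (n + 1) (braidedFactorial Ψ (n + 1)) +
          tensorIdHom k V (n + 1) (braidedFactorial Ψ (n + 1)) *
            (adjLeg Ψ (Fin.last n) * tensorIdHom k V (n + 1) (braidedInt Ψ n)) := by
        rw [braidedFactorial_succ Ψ (n + 1), braidedInt_succ, mul_add, mul_one]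
      _ = tensorIdHom k V (n + 1) (braidedFactorial Ψ (n + 1)) +
          tensorIdHom k V (n + 1) (braidedIntRev Ψ n) *
            (tensorIdHom k V (n + 1) (tensorIdHom k V n (braidedFactorial Ψ n)) *
              adjLeg Ψ (Fin.last n)) * tensorIdHom k V (n + 1) (braidedInt Ψ n) := by
        conv_lhs => enter [2, 1]; rw [ih]
        simp only [map_mul, mul_assoc]
      _ = braidedIntRev Ψ (n + 1) * tensorIdHom k V (n + 1) (braidedFactorial Ψ (n + 1)) := by
        rw [commute_last.eq, braidedIntRev, add_mul, one_mul, mul_assoc, mul_assoc, ← map_mul,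
          ← braidedFactorial_succ, mul_assoc]

end Legs

/-! ### Comparison with the Woronowicz symmetriser -/

section Adjoint

variable {k : Type*} [Field k] {V : Type*} [AddCommGroup V] [Module k V]

open PiTensorProduct (dualDistrib)

theorem dualDistrib_snocEquiv {n : ℕ} (y : ⨂[k]^n (Module.Dual k V)) (f : Module.Dual k V)
    (x : ⨂[k]^n V) (v : V) :
    dualDistrib (snocEquiv (y ⊗ₜ f)) (snocEquiv (x ⊗ₜ v)) = dualDistrib y x * f v := by
  have bilin_eq : dualDistrib.compl₁₂ (snocEquiv.toLinearMap ∘ₗ (TensorProduct.mk k _ _).flip f)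
      (snocEquiv.toLinearMap ∘ₗ (TensorProduct.mk k _ _).flip v) =
      f v • dualDistrib (R := k) (M := fun _ : Fin n => V) :=
    PiTensorProduct.ext <| MultilinearMap.ext fun g =>
      PiTensorProduct.ext <| MultilinearMap.ext fun w => by
        simp [snocEquiv_tprod, PiTensorProduct.dualDistrib_apply, Fin.prod_univ_castSucc, mul_comm]
  exact (LinearMap.congr_fun₂ bilin_eq y x).trans (mul_comm _ _)

theorem dualDistrib_snocEquiv₂ {n : ℕ} (y : ⨂[k]^n (Module.Dual k V))
    (s : Module.Dual k V ⊗[k] Module.Dual k V) (x : ⨂[k]^n V) (t : V ⊗[k] V) :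
    dualDistrib (snocEquiv₂ (y ⊗ₜ s)) (snocEquiv₂ (x ⊗ₜ t)) =
      dualDistrib y x * TensorProduct.dualDistrib k V V s t := by
  have bilin_eq : dualDistrib.compl₁₂ (snocEquiv₂.toLinearMap ∘ₗ TensorProduct.mk k _ _ y)
      (snocEquiv₂.toLinearMap ∘ₗ TensorProduct.mk k _ _ x) =
      dualDistrib y x • TensorProduct.dualDistrib k V V :=
    TensorProduct.ext' fun f g => TensorProduct.ext' fun v w => by
      simp [dualDistrib_snocEquiv, mul_assoc]
  exact LinearMap.congr_fun₂ bilin_eq s t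

/-- `G` on `(V^*)^{⊗n}` is the adjoint of `F` on `V^{⊗n}` for the canonical pairing of these two
spaces. -/
def IsAdjoint {n : ℕ} (F : Module.End k (⨂[k]^n V)) (G : Module.End k (⨂[k]^n (Module.Dual k V))) :
    Prop := dualDistrib.compl₂ F = dualDistrib ∘ₗ G

theorem IsAdjoint.dualDistrib_apply {n : ℕ} {F : Module.End k (⨂[k]^n V)}
    {G : Module.End k (⨂[k]^n (Module.Dual k V))} (h : IsAdjoint F G)
    (y : ⨂[k]^n (Module.Dual k V)) (x : ⨂[k]^n V) :
    dualDistrib y (F x) = dualDistrib (G y) x :=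
  LinearMap.congr_fun₂ h y x

theorem isAdjoint_one {n : ℕ} : IsAdjoint (1 : Module.End k (⨂[k]^n V)) 1 := rfl

theorem IsAdjoint.add {n : ℕ} {F F' : Module.End k (⨂[k]^n V)}
    {G G' : Module.End k (⨂[k]^n (Module.Dual k V))} (h : IsAdjoint F G) (h' : IsAdjoint F' G') :
    IsAdjoint (F + F') (G + G') :=
  LinearMap.ext₂ fun y x => by simp [h.dualDistrib_apply, h'.dualDistrib_apply]

theorem IsAdjoint.mul {n : ℕ} {F F' : Module.End k (⨂[k]^n V)}
    {G G' : Module.End k (⨂[k]^n (Module.Dual k V))} (h : IsAdjoint F G) (h' : IsAdjoint F' G') :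
    IsAdjoint (F * F') (G' * G) :=
  LinearMap.ext₂ fun y x => by simp [h.dualDistrib_apply, h'.dualDistrib_apply]

theorem IsAdjoint.tensorIdHom {n : ℕ} {F : Module.End k (⨂[k]^n V)}
    {G : Module.End k (⨂[k]^n (Module.Dual k V))} (h : IsAdjoint F G) :
    IsAdjoint (tensorIdHom k V n F) (tensorIdHom k (Module.Dual k V) n G) :=
  tensorPower_succ_ext fun y f => tensorPower_succ_ext fun x v => by
    simp [tensorIdHom_snocEquiv, dualDistrib_snocEquiv, h.dualDistrib_apply]

theorem eq_zero_of_dualDistrib_right [FiniteDimensional k V] {n : ℕ} {x : ⨂[k]^n V}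
    (h : ∀ y : ⨂[k]^n (Module.Dual k V), dualDistrib y x = 0) : x = 0 :=
  (Module.forall_dual_apply_eq_zero_iff k x).1
    ((PiTensorProduct.dualDistribEquiv (R := k) (M := fun _ : Fin n => V)).surjective.forall.2 h)

theorem eq_zero_of_dualDistrib_left [FiniteDimensional k V] {n : ℕ}
    {y : ⨂[k]^n (Module.Dual k V)} (h : dualDistrib y = 0) : y = 0 :=
  (PiTensorProduct.dualDistribEquiv (R := k) (M := fun _ : Fin n => V)).map_eq_zero_iff.1 h

variable [FiniteDimensional k V] (Ψ : V ⊗[k] V →ₗ[k] V ⊗[k] V)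

theorem dualDistrib_dualBraiding (s : Module.Dual k V ⊗[k] Module.Dual k V) (t : V ⊗[k] V) :
    TensorProduct.dualDistrib k V V (dualBraiding Ψ s) t =
      TensorProduct.dualDistrib k V V s (Ψ t) :=
  LinearMap.congr_fun ((TensorProduct.dualDistribEquiv k V V).apply_symm_apply _) t

theorem isAdjoint_adjLeg_last (n : ℕ) :
    IsAdjoint (adjLeg Ψ (Fin.last n)) (adjLeg (dualBraiding Ψ) (Fin.last n)) :=
  tensorPower_add_two_ext fun y s => tensorPower_add_two_ext fun x t => by
    simp only [LinearMap.compl₂_apply, LinearMap.comp_apply, adjLeg_last_snocEquiv₂,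
      dualDistrib_snocEquiv₂, dualDistrib_dualBraiding]

theorem isAdjoint_braidedInt (n : ℕ) :
    IsAdjoint (braidedInt Ψ n) (braidedIntRev (dualBraiding Ψ) n) := by
  induction n with
  | zero =>
    rw [braidedInt_zero]
    exact isAdjoint_one
  | succ n ih =>
    rw [braidedInt_succ]
    exact isAdjoint_one.add ((isAdjoint_adjLeg_last Ψ n).mul ih.tensorIdHom)

theorem isAdjoint_braidedFactorial (n : ℕ) :
    IsAdjoint (braidedFactorial Ψ n) (braidedFactorial (dualBraiding Ψ) n) := by
  induction n with
  | zero => exact isAdjoint_one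
  | succ n ih =>
    rw [braidedFactorial_succ, braidedFactorial_succ_rev]
    exact ih.tensorIdHom.mul (isAdjoint_braidedInt Ψ n)

end Adjoint

section SkewDerivative

variable {k : Type*} [Field k] {H : Type*} [Ring H] [HopfAlgebra k H]
  {V : Type*} [AddCommGroup V] [Module k V] [Module H V] [IsScalarTower k H V]
  {δ : V →ₗ[k] H ⊗[k] V}

open TensorPower (toTensorAlgebra)

theorem mulBraid_rTensor_toTensorAlgebra (Ψ : V ⊗[k] V →ₗ[k] V ⊗[k] V) {n : ℕ} (w : V)
    (t : (⨂[k]^n V) ⊗[k] V) :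
    mulBraid Ψ w (LinearMap.rTensor V toTensorAlgebra t) =
      LinearMap.rTensor V toTensorAlgebra (snocEquiv.symm
        (adjLeg Ψ (Fin.last n) (snocEquiv (snocEquiv t ⊗ₜ w)))) := by
  induction t with
  | zero => simp
  | add s t hs ht => simp only [map_add, TensorProduct.add_tmul, hs, ht]
  | tmul x v =>
    have smul_rTensor_ι : DistribSMul.toLinearMap k _ (toTensorAlgebra x) ∘ₗ
        LinearMap.rTensor V (TensorAlgebra.ι k) =
        LinearMap.rTensor V toTensorAlgebra ∘ₗ snocEquiv.symm.toLinearMap ∘ₗ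
          snocEquiv₂.toLinearMap ∘ₗ TensorProduct.mk k _ _ x :=
      TensorProduct.ext' fun a b => by
        simp [toTensorAlgebra_snocEquiv, TensorProduct.smul_tmul']
    rw [← snocEquiv₂_tmul, adjLeg_last_snocEquiv₂]
    exact LinearMap.congr_fun smul_rTensor_ι (Ψ (v ⊗ₜ w))

theorem skewDer_toTensorAlgebra (hδ : IsYetterDrinfeld δ) (n : ℕ) :
    skewDer δ ∘ₗ toTensorAlgebra (n := n + 1) = LinearMap.rTensor V toTensorAlgebra ∘ₗ
      snocEquiv.symm.toLinearMap ∘ₗ braidedInt (inducedBraiding δ) n := by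
  induction n with
  | zero =>
    refine tensorPower_succ_ext_tprod fun x w => ?_
    rw [LinearMap.comp_apply, toTensorAlgebra_snocEquiv, toTensorAlgebra_tprod_zero, one_mul,
      skewDer_ι hδ]
    simp [braidedInt_zero]
  | succ n ih =>
    refine tensorPower_succ_ext fun x w => ?_
    have skewDer_x := LinearMap.congr_fun ih x
    simp only [LinearMap.comp_apply, LinearEquiv.coe_coe] at skewDer_x
    simp [toTensorAlgebra_snocEquiv, skewDer_mul_ι hδ, skewDer_x,
      mulBraid_rTensor_toTensorAlgebra, braidedInt_succ, tensorIdHom_snocEquiv]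

end SkewDerivative

section WoronowiczPairing

variable {k : Type*} [Field k] {H : Type*} [Ring H] [HopfAlgebra k H]
  {V : Type*} [AddCommGroup V] [Module k V] [Module H V] [IsScalarTower k H V]
  {δ : V →ₗ[k] H ⊗[k] V}

open TensorPower (toTensorAlgebra)
open PiTensorProduct (dualDistrib)

theorem hcPairing_mul_ι (hδ : IsYetterDrinfeld δ) (y : TensorAlgebra k (Module.Dual k V))
    (f : Module.Dual k V) (x : TensorAlgebra k V) :
    hcPairing hδ (y * TensorAlgebra.ι k f) x =
      hcPairing hδ y (TensorProduct.rid k _ (LinearMap.lTensor _ f (skewDer δ x))) := by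
  simp only [hcPairing_apply]
  rw [map_mul (freeD δ), mul_assoc, freeD_ι_mul_freeV hδ, mul_add, map_add, ← mul_assoc,
    hcFun_mul_freeD, hcFun_mul_contract]
  simp [TensorAlgebra.algebraMapInv]

theorem hcPairing_toTensorAlgebra_snocEquiv (hδ : IsYetterDrinfeld δ) {m n : ℕ}
    (y : ⨂[k]^m (Module.Dual k V)) (f : Module.Dual k V) :
    hcPairing hδ (toTensorAlgebra (snocEquiv (y ⊗ₜ f))) ∘ₗ toTensorAlgebra (n := n + 1) =
      TensorProduct.rid k k ∘ₗ
        TensorProduct.map (hcPairing hδ (toTensorAlgebra y) ∘ₗ toTensorAlgebra) f ∘ₗ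
          snocEquiv.symm.toLinearMap ∘ₗ braidedInt (inducedBraiding δ) n := by
  have map_eq : hcPairing hδ (toTensorAlgebra y) ∘ₗ (TensorProduct.rid k _).toLinearMap ∘ₗ
      LinearMap.lTensor _ f ∘ₗ LinearMap.rTensor V (toTensorAlgebra (n := n)) =
      TensorProduct.rid k k ∘ₗ
        TensorProduct.map (hcPairing hδ (toTensorAlgebra y) ∘ₗ toTensorAlgebra) f :=
    TensorProduct.ext' fun x v => by simp
  rw [← LinearMap.comp_assoc, ← map_eq]
  refine LinearMap.ext fun x => ?_
  have skewDer_x := LinearMap.congr_fun (skewDer_toTensorAlgebra hδ n) x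
  simp only [LinearMap.comp_apply] at skewDer_x
  simp only [LinearMap.comp_apply, toTensorAlgebra_snocEquiv, hcPairing_mul_ι, skewDer_x,
    LinearEquiv.coe_coe]

theorem dualDistrib_snocEquiv_comp_tensorIdHom {n : ℕ} (y : ⨂[k]^n (Module.Dual k V))
    (f : Module.Dual k V) (F : Module.End k (⨂[k]^n V)) :
    dualDistrib (snocEquiv (y ⊗ₜ f)) ∘ₗ tensorIdHom k V n F = TensorProduct.rid k k ∘ₗ
      TensorProduct.map (dualDistrib y ∘ₗ F) f ∘ₗ snocEquiv.symm.toLinearMap :=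
  tensorPower_succ_ext fun x v => by simp [tensorIdHom_snocEquiv, dualDistrib_snocEquiv, mul_comm]

theorem hcPairing_toTensorAlgebra (hδ : IsYetterDrinfeld δ) (n : ℕ) :
    (hcPairing hδ).compl₁₂ toTensorAlgebra toTensorAlgebra =
      dualDistrib.compl₂ (braidedFactorial (inducedBraiding δ) n) := by
  induction n with
  | zero =>
    refine PiTensorProduct.ext <| MultilinearMap.ext fun f =>
      PiTensorProduct.ext <| MultilinearMap.ext fun v => ?_
    simpa [toTensorAlgebra_tprod_zero, braidedFactorial] using hcFun_freeV hδ 1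
  | succ n ih =>
    refine tensorPower_succ_ext fun y f => ?_
    have ih_y : hcPairing hδ (toTensorAlgebra y) ∘ₗ toTensorAlgebra =
      dualDistrib y ∘ₗ braidedFactorial (inducedBraiding δ) n := LinearMap.congr_fun ih y
    change hcPairing hδ (toTensorAlgebra (snocEquiv (y ⊗ₜ f))) ∘ₗ toTensorAlgebra =
      (dualDistrib (snocEquiv (y ⊗ₜ f)) ∘ₗ tensorIdHom k V n _) ∘ₗ braidedInt _ n
    rw [hcPairing_toTensorAlgebra_snocEquiv, ih_y, dualDistrib_snocEquiv_comp_tensorIdHom]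
    rfl

theorem hcPairing_toTensorAlgebra_of_ne (hδ : IsYetterDrinfeld δ) {m n : ℕ} (hmn : m ≠ n) :
    (hcPairing hδ).compl₁₂ (toTensorAlgebra (n := m)) (toTensorAlgebra (n := n)) = 0 := by
  induction m generalizing n with
  | zero =>
    obtain ⟨n, rfl⟩ := Nat.exists_eq_succ_of_ne_zero hmn.symm
    refine PiTensorProduct.ext <| MultilinearMap.ext fun f => LinearMap.ext fun x => ?_
    have deg_zero := LinearMap.congr_fun (algebraMapInv_comp_toTensorAlgebra_succ n) x
    simpa [toTensorAlgebra_tprod_zero, hcFun_freeV] using deg_zero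
  | succ m ih =>
    refine tensorPower_succ_ext fun y f => ?_
    cases n with
    | zero =>
      refine PiTensorProduct.ext <| MultilinearMap.ext fun v => ?_
      have deg_zero := LinearMap.congr_fun (algebraMapInv_comp_toTensorAlgebra_succ m)
        (snocEquiv (y ⊗ₜ f))
      simpa [toTensorAlgebra_tprod_zero, hcFun_freeD] using deg_zero
    | succ n =>
      have ih_y : hcPairing hδ (toTensorAlgebra y) ∘ₗ toTensorAlgebra (n := n) = 0 :=
        LinearMap.congr_fun (ih (by lia)) y
      refine (hcPairing_toTensorAlgebra_snocEquiv hδ y f).trans ?_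
      rw [ih_y, TensorProduct.map_zero_left, LinearMap.zero_comp, LinearMap.comp_zero]
      rfl

theorem hcPairing_toTensorAlgebra_left (hδ : IsYetterDrinfeld δ) {n : ℕ}
    (y : ⨂[k]^n (Module.Dual k V)) (x : TensorAlgebra k V) :
    hcPairing hδ (toTensorAlgebra y) x =
      dualDistrib y
        (braidedFactorial (inducedBraiding δ) n (TensorAlgebra.equivDirectSum x n)) := by
  have linear_eq : hcPairing hδ (toTensorAlgebra y) =
      dualDistrib y ∘ₗ braidedFactorial (inducedBraiding δ) n ∘ₗ
        DirectSum.component k ℕ (fun n => ⨂[k]^n V) n ∘ₗ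
          TensorAlgebra.equivDirectSum.toLinearMap := by
    refine tensorAlgebra_linearMap_ext_toTensorAlgebra fun m => LinearMap.ext fun x => ?_
    rcases eq_or_ne n m with rfl | hnm
    · have pairing_eq : hcPairing hδ (toTensorAlgebra y) (toTensorAlgebra x) = dualDistrib y _ :=
        LinearMap.congr_fun₂ (hcPairing_toTensorAlgebra hδ n) y x
      simpa only [LinearMap.comp_apply, AlgEquiv.toLinearMap_apply, equivDirectSum_toTensorAlgebra,
        DirectSum.component.lof_self] using pairing_eq
    · have pairing_eq : hcPairing hδ (toTensorAlgebra y) (toTensorAlgebra x) = 0 :=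
        LinearMap.congr_fun₂ (hcPairing_toTensorAlgebra_of_ne hδ hnm) y x
      simpa only [LinearMap.comp_apply, AlgEquiv.toLinearMap_apply, equivDirectSum_toTensorAlgebra,
        DirectSum.component.of, dif_neg hnm.symm, map_zero, LinearMap.zero_apply] using pairing_eq
  exact LinearMap.congr_fun linear_eq x

theorem hcPairing_toTensorAlgebra_right (hδ : IsYetterDrinfeld δ) {n : ℕ}
    (y : TensorAlgebra k (Module.Dual k V)) (x : ⨂[k]^n V) :
    hcPairing hδ y (toTensorAlgebra x) =
      dualDistrib (TensorAlgebra.equivDirectSum y n)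
        (braidedFactorial (inducedBraiding δ) n x) := by
  have linear_eq : (hcPairing hδ).flip (toTensorAlgebra x) =
      dualDistrib.flip (braidedFactorial (inducedBraiding δ) n x) ∘ₗ
        DirectSum.component k ℕ (fun n => ⨂[k]^n (Module.Dual k V)) n ∘ₗ
          TensorAlgebra.equivDirectSum.toLinearMap := by
    refine tensorAlgebra_linearMap_ext_toTensorAlgebra fun m => LinearMap.ext fun y => ?_
    rcases eq_or_ne m n with rfl | hmn
    · have pairing_eq : hcPairing hδ (toTensorAlgebra y) (toTensorAlgebra x) = dualDistrib y _ :=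
        LinearMap.congr_fun₂ (hcPairing_toTensorAlgebra hδ m) y x
      simpa only [LinearMap.comp_apply, LinearMap.flip_apply, AlgEquiv.toLinearMap_apply,
        equivDirectSum_toTensorAlgebra, DirectSum.component.lof_self] using pairing_eq
    · have pairing_eq : hcPairing hδ (toTensorAlgebra y) (toTensorAlgebra x) = 0 :=
        LinearMap.congr_fun₂ (hcPairing_toTensorAlgebra_of_ne hδ hmn) y x
      simpa only [LinearMap.comp_apply, LinearMap.flip_apply, AlgEquiv.toLinearMap_apply,
        equivDirectSum_toTensorAlgebra, DirectSum.component.of, dif_neg hmn, map_zero,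
        LinearMap.zero_apply] using pairing_eq
  exact LinearMap.congr_fun linear_eq y

theorem woronowicz_eq_zero_iff {Ψ : V ⊗[k] V →ₗ[k] V ⊗[k] V} {x : TensorAlgebra k V} :
    woronowicz Ψ x = 0 ↔ ∀ n, braidedFactorial Ψ n (TensorAlgebra.equivDirectSum x n) = 0 := by
  change TensorAlgebra.equivDirectSum.symm
    (DirectSum.lmap (braidedFactorial Ψ) (TensorAlgebra.equivDirectSum x)) = 0 ↔ _
  rw [EmbeddingLike.map_eq_zero_iff]
  exact DFinsupp.ext_iff

variable [FiniteDimensional k V]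

theorem radV_eq_ker_woronowicz (hδ : IsYetterDrinfeld δ) :
    radV hδ = LinearMap.ker (woronowicz (inducedBraiding δ)) := by
  ext x
  calc x ∈ radV hδ
    _ ↔ ∀ n, (hcPairing hδ).flip x ∘ₗ toTensorAlgebra (n := n) = 0 :=
      ⟨fun h n => by rw [LinearMap.mem_ker.1 h, LinearMap.zero_comp],
        fun h => LinearMap.mem_ker.2 (tensorAlgebra_linearMap_ext_toTensorAlgebra h)⟩
    _ ↔ ∀ n, braidedFactorial (inducedBraiding δ) n (TensorAlgebra.equivDirectSum x n) = 0 :=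
      forall_congr' fun n => ⟨fun h => eq_zero_of_dualDistrib_right fun y =>
          (hcPairing_toTensorAlgebra_left hδ y x).symm.trans (LinearMap.congr_fun h y),
        fun h => LinearMap.ext fun y =>
          (hcPairing_toTensorAlgebra_left hδ y x).trans (by rw [h, map_zero]; rfl)⟩
    _ ↔ x ∈ LinearMap.ker (woronowicz (inducedBraiding δ)) :=
      woronowicz_eq_zero_iff.symm

theorem radD_eq_ker_woronowicz (hδ : IsYetterDrinfeld δ) :
    radD hδ = LinearMap.ker (woronowicz (dualBraiding (inducedBraiding δ))) := by
  ext y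
  calc y ∈ radD hδ
    _ ↔ ∀ n, hcPairing hδ y ∘ₗ toTensorAlgebra (n := n) = 0 :=
      ⟨fun h n => by rw [LinearMap.mem_ker.1 h, LinearMap.zero_comp],
        fun h => LinearMap.mem_ker.2 (tensorAlgebra_linearMap_ext_toTensorAlgebra h)⟩
    _ ↔ ∀ n, dualDistrib (braidedFactorial (dualBraiding (inducedBraiding δ)) n
          (TensorAlgebra.equivDirectSum y n)) = 0 :=
      forall_congr' fun n => by
        rw [LinearMap.ext_iff, LinearMap.ext_iff]
        refine forall_congr' fun x => ?_
        rw [LinearMap.comp_apply, hcPairing_toTensorAlgebra_right,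
          (isAdjoint_braidedFactorial _ n).dualDistrib_apply, LinearMap.zero_apply]
    _ ↔ ∀ n, braidedFactorial (dualBraiding (inducedBraiding δ)) n
          (TensorAlgebra.equivDirectSum y n) = 0 :=
      forall_congr' fun n => ⟨eq_zero_of_dualDistrib_left, fun h => by rw [h, map_zero]⟩
    _ ↔ y ∈ LinearMap.ker (woronowicz (dualBraiding (inducedBraiding δ))) :=
      woronowicz_eq_zero_iff.symm

end WoronowiczPairing

/-! ### Triangular decomposition of the minimal double -/

section QuotientBy

variable {k : Type*} [Field k] {A : Type*} [Ring A] [Algebra k A]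

theorem toQuotient_surjective (S : Submodule k A) : Function.Surjective (toQuotient S) :=
  RingCon.mkₐ_surjective _

theorem mkₐ_ringCon_eq_zero {J : TwoSidedIdeal A} {x : A} :
    J.ringCon.mkₐ k x = 0 ↔ x ∈ J :=
  (RingCon.eq J.ringCon (a := x) (b := 0)).trans (J.mem_iff x).symm

variable {S : Submodule k A}

theorem toQuotient_eq_zero_of_mem {x : A} (hx : x ∈ S) : toQuotient S x = 0 :=
  mkₐ_ringCon_eq_zero.2 (TwoSidedIdeal.subset_span hx)

theorem toQuotient_eq_zero_iff (hS : IsTwoSidedIdeal S) {x : A} :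
    toQuotient S x = 0 ↔ x ∈ S := by
  refine ⟨fun hx => ?_, toQuotient_eq_zero_of_mem⟩
  let J : TwoSidedIdeal A := TwoSidedIdeal.mk' S S.zero_mem S.add_mem S.neg_mem
    (fun h => (hS _ _ h).1) (fun h => (hS _ _ h).2)
  have coe_J : (J : Set A) = S := TwoSidedIdeal.coe_mk' _ _ _ _ _ _
  have span_le_J : TwoSidedIdeal.span (S : Set A) ≤ J := TwoSidedIdeal.span_le.2 coe_J.ge
  exact coe_J.le (span_le_J (mkₐ_ringCon_eq_zero.1 hx))

theorem exists_algEquiv_toQuotient {S' : Submodule k A} (h : S = S') :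
    ∃ e : QuotientBy S ≃ₐ[k] QuotientBy S', ∀ x, e (toQuotient S x) = toQuotient S' x := by
  subst h
  exact ⟨AlgEquiv.refl, fun _ => rfl⟩

theorem exists_algHom_toQuotient {B : Type*} [Ring B] [Algebra k B] (f : A →ₐ[k] B)
    (hf : ∀ x ∈ S, f x = 0) : ∃ g : QuotientBy S →ₐ[k] B, ∀ x, g (toQuotient S x) = f x := by
  have span_le_ker : TwoSidedIdeal.span (S : Set A) ≤ TwoSidedIdeal.ker f :=
    TwoSidedIdeal.span_le.2 fun x hx => (TwoSidedIdeal.mem_ker f).2 (hf x hx)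
  exact ⟨RingCon.liftₐ _ f (TwoSidedIdeal.ringCon_le_iff.1 span_le_ker), fun _ => rfl⟩

theorem exists_action_toQuotient {M : Type*} [AddCommGroup M] [Module k M]
    (hS : IsTwoSidedIdeal S) (α : M →ₗ[k] A →ₗ[k] A) (hα : ∀ m, ∀ x ∈ S, α m x ∈ S) :
    ∃ β : M →ₗ[k] QuotientBy S →ₗ[k] QuotientBy S,
      ∀ m x, β m (toQuotient S x) = toQuotient S (α m x) := by
  let π : A →ₗ[k] QuotientBy S := (toQuotient S).toLinearMap
  have π_surjective : Function.Surjective π := toQuotient_surjective S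
  have ker_le : LinearMap.ker π ≤ LinearMap.ker (α.flip.compr₂ π) := fun x hx =>
    LinearMap.ext fun m => toQuotient_eq_zero_of_mem (hα m x ((toQuotient_eq_zero_iff hS).1 hx))
  let quotEquiv : (A ⧸ LinearMap.ker π) ≃ₗ[k] QuotientBy S :=
    π.quotKerEquivOfSurjective π_surjective
  have quotEquiv_symm (x : A) : quotEquiv.symm (toQuotient S x) = Submodule.Quotient.mk x :=
    quotEquiv.symm_apply_eq.2 rfl
  refine ⟨((LinearMap.ker π).liftQ (α.flip.compr₂ π) ker_le ∘ₗ quotEquiv.symm.toLinearMap).flip,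
    fun m x => ?_⟩
  rw [LinearMap.flip_apply, LinearMap.comp_apply, LinearEquiv.coe_coe, quotEquiv_symm,
    Submodule.liftQ_apply]
  rfl

end QuotientBy

section QuotientAction

variable {k : Type*} [Field k] {H : Type*} [Ring H] [HopfAlgebra k H]
  {A : Type*} [Ring A] [Algebra k A] {B : Type*} [Ring B] [Algebra k B]
  {π : A →ₐ[k] B} {α : H →ₗ[k] A →ₗ[k] A} {β : H →ₗ[k] B →ₗ[k] B}

theorem sweedlerMul_flip_map (hαβ : ∀ h x, β h (π x) = π (α h x)) (h : H) (x y : A) :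
    sweedlerMul (β.flip (π x)) (β.flip (π y)) h = π (sweedlerMul (α.flip x) (α.flip y) h) := by
  have flip_map (z : A) : β.flip (π z) = π.toLinearMap ∘ₗ α.flip z :=
    LinearMap.ext fun h => hαβ h z
  rw [map_sweedlerMul, flip_map, flip_map]

theorem IsLeftModuleAlgebra.of_surjective (hα : IsLeftModuleAlgebra α)
    (hπ : Function.Surjective π) (hαβ : ∀ h x, β h (π x) = π (α h x)) :
    IsLeftModuleAlgebra β where
  one_act := hπ.forall.2 fun x => by rw [hαβ, hα.one_act]
  mul_act g h := hπ.forall.2 fun x => by rw [hαβ, hαβ, hαβ, hα.mul_act]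
  act_one h := by rw [← map_one π, hαβ, hα.act_one, AlgHom.commutes]
  act_mul h := hπ.forall₂.2 fun x y => by
    rw [← map_mul, hαβ, hα.act_mul, sweedlerMul_flip_map hαβ]

theorem IsRightModuleAlgebra.of_surjective (hα : IsRightModuleAlgebra α)
    (hπ : Function.Surjective π) (hαβ : ∀ h x, β h (π x) = π (α h x)) :
    IsRightModuleAlgebra β where
  one_act := hπ.forall.2 fun x => by rw [hαβ, hα.one_act]
  mul_act g h := hπ.forall.2 fun x => by rw [hαβ, hαβ, hαβ, hα.mul_act]
  act_one h := by rw [← map_one π, hαβ, hα.act_one, AlgHom.commutes]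
  act_mul h := hπ.forall₂.2 fun x y => by
    rw [← map_mul, hαβ, hα.act_mul, sweedlerMul_flip_map hαβ]

end QuotientAction

section TripleQuotient

variable {k : Type*} [Field k] {A B M : Type*} [Ring A] [Algebra k A] [Ring B] [Algebra k B]
  [AddCommGroup M] [Module k M] {S : Submodule k A} {T : Submodule k B}

variable (S M T) in
/-- The projection `A ⊗ M ⊗ B → A/(S) ⊗ M ⊗ B/(T)`. -/
def tripleQuotient : (A ⊗[k] M) ⊗[k] B →ₗ[k] (QuotientBy S ⊗[k] M) ⊗[k] QuotientBy T :=
  TensorProduct.map (TensorProduct.map (toQuotient S).toLinearMap LinearMap.id)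
    (toQuotient T).toLinearMap

theorem tripleQuotient_surjective : Function.Surjective (tripleQuotient M S T) :=
  TensorProduct.map_surjective
    (TensorProduct.map_surjective (toQuotient_surjective S) Function.surjective_id)
    (toQuotient_surjective T)

theorem range_sup_range_le_ker_tripleQuotient :
    LinearMap.range (TensorProduct.map (TensorProduct.map S.subtype (LinearMap.id (M := M)))
        (LinearMap.id (M := B))) ⊔
      LinearMap.range (TensorProduct.map (LinearMap.id (M := A ⊗[k] M)) T.subtype) ≤
      LinearMap.ker (tripleQuotient M S T) := by
  refine sup_le (LinearMap.range_le_ker_iff.2 ?_) (LinearMap.range_le_ker_iff.2 ?_) <;>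
    refine TensorProduct.ext_threefold fun x m y => ?_
  · simp [tripleQuotient, toQuotient_eq_zero_of_mem x.2]
  · simp [tripleQuotient, toQuotient_eq_zero_of_mem y.2]

end TripleQuotient

section MinimalDouble

variable {k : Type*} [Field k] {H : Type*} [Ring H] [HopfAlgebra k H]
  {V : Type*} [AddCommGroup V] [Module k V] [Module H V] [IsScalarTower k H V]
  {δ : V →ₗ[k] H ⊗[k] V} {Im : Submodule k (TensorAlgebra k V)}
  {Ip : Submodule k (TensorAlgebra k (Module.Dual k V))}

theorem toMinimal_eq_zero {a : FreeDouble δ} : toMinimal δ a = 0 ↔ a ∈ maxTriangular δ :=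
  mkₐ_ringCon_eq_zero

theorem tripleMul_tripleQuotient
    {im : QuotientBy Im →ₐ[k] MinimalDouble δ} {ip : QuotientBy Ip →ₐ[k] MinimalDouble δ}
    (him : ∀ x, im (toQuotient Im x) = toMinimal δ (freeV δ x))
    (hip : ∀ y, ip (toQuotient Ip y) = toMinimal δ (freeD δ y))
    (t : (TensorAlgebra k V ⊗[k] H) ⊗[k] TensorAlgebra k (Module.Dual k V)) :
    tripleMul im ((toMinimal δ).comp (freeH δ)) ip (tripleQuotient H Im Ip t) =
      toMinimal δ (tripleMul (freeV δ) (freeH δ) (freeD δ) t) := by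
  have linear_eq : tripleMul im ((toMinimal δ).comp (freeH δ)) ip ∘ₗ tripleQuotient H Im Ip =
      (toMinimal δ).toLinearMap ∘ₗ tripleMul (freeV δ) (freeH δ) (freeD δ) :=
    TensorProduct.ext_threefold fun x h y => by
      simp [tripleQuotient, tripleMul, him, hip]
  exact LinearMap.congr_fun linear_eq t

theorem tripleMul_minimalDouble_bijective (hδ : IsYetterDrinfeld δ)
    (hJ : IsTriangularWith δ (maxTriangular δ) Im Ip)
    {im : QuotientBy Im →ₐ[k] MinimalDouble δ} {ip : QuotientBy Ip →ₐ[k] MinimalDouble δ}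
    (him : ∀ x, im (toQuotient Im x) = toMinimal δ (freeV δ x))
    (hip : ∀ y, ip (toQuotient Ip y) = toMinimal δ (freeD δ y)) :
    Function.Bijective (tripleMul im ((toMinimal δ).comp (freeH δ)) ip) := by
  constructor
  · refine (injective_iff_map_eq_zero _).2 (tripleQuotient_surjective.forall.2 fun t ht => ?_)
    rw [tripleMul_tripleQuotient him hip] at ht
    obtain ⟨s, hs, hst⟩ := hJ.mem_iff.1 (toMinimal_eq_zero.1 ht)
    obtain rfl := (tripleMul_bijective hδ).1 hst
    exact range_sup_range_le_ker_tripleQuotient hs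
  · intro a
    obtain ⟨b, rfl⟩ := RingCon.mkₐ_surjective (α := k) (maxTriangular δ).ringCon a
    obtain ⟨t, rfl⟩ := (tripleMul_bijective hδ).2 b
    exact ⟨tripleQuotient H Im Ip t, tripleMul_tripleQuotient him hip t⟩

theorem toMinimal_freeH_mul_of_toQuotient {im : QuotientBy Im →ₐ[k] MinimalDouble δ}
    (him : ∀ x, im (toQuotient Im x) = toMinimal δ (freeV δ x))
    {αm : H →ₗ[k] QuotientBy Im →ₗ[k] QuotientBy Im}
    (hαm : ∀ h x, αm h (toQuotient Im x) = toQuotient Im (leftT k H V h x))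
    (h : H) (u : QuotientBy Im) :
    (toMinimal δ).comp (freeH δ) h * im u = sweedlerMul (im.toLinearMap ∘ₗ αm.flip u)
      ((toMinimal δ).comp (freeH δ)).toLinearMap h := by
  obtain ⟨x, rfl⟩ := toQuotient_surjective Im u
  have im_act : im.toLinearMap ∘ₗ αm.flip (toQuotient Im x) =
      (toMinimal δ).toLinearMap ∘ₗ (freeV δ).toLinearMap ∘ₗ (leftT k H V).flip x :=
    LinearMap.ext fun g => by simp [hαm, him]
  rw [him, AlgHom.comp_apply, ← map_mul, freeH_mul_freeV, map_sweedlerMul, im_act,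
    AlgHom.comp_toLinearMap]

theorem mul_toMinimal_freeH_of_toQuotient {ip : QuotientBy Ip →ₐ[k] MinimalDouble δ}
    (hip : ∀ y, ip (toQuotient Ip y) = toMinimal δ (freeD δ y))
    {αp : H →ₗ[k] QuotientBy Ip →ₗ[k] QuotientBy Ip}
    (hαp : ∀ h y, αp h (toQuotient Ip y) = toQuotient Ip (dualT k H V h y))
    (h : H) (u : QuotientBy Ip) :
    ip u * (toMinimal δ).comp (freeH δ) h =
      sweedlerMul ((toMinimal δ).comp (freeH δ)).toLinearMap (ip.toLinearMap ∘ₗ αp.flip u) h := by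
  obtain ⟨y, rfl⟩ := toQuotient_surjective Ip u
  have ip_act : ip.toLinearMap ∘ₗ αp.flip (toQuotient Ip y) =
      (toMinimal δ).toLinearMap ∘ₗ (freeD δ).toLinearMap ∘ₗ (dualT k H V).flip y :=
    LinearMap.ext fun g => by simp [hαp, hip]
  rw [hip, AlgHom.comp_apply, ← map_mul, freeD_mul_freeH, map_sweedlerMul, ip_act,
    AlgHom.comp_toLinearMap]

theorem exists_isTriangularDecomposition (hδ : IsYetterDrinfeld δ)
    (hJ : IsTriangularWith δ (maxTriangular δ) Im Ip)
    (hm : IsTwoSidedIdeal Im) (hp : IsTwoSidedIdeal Ip)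
    (hactm : ∀ h, ∀ x ∈ Im, leftT k H V h x ∈ Im)
    (hactp : ∀ h, ∀ y ∈ Ip, dualT k H V h y ∈ Ip) :
    ∃ (im : QuotientBy Im →ₐ[k] MinimalDouble δ) (ip : QuotientBy Ip →ₐ[k] MinimalDouble δ)
      (αm : H →ₗ[k] QuotientBy Im →ₗ[k] QuotientBy Im)
      (αp : H →ₗ[k] QuotientBy Ip →ₗ[k] QuotientBy Ip)
      (εm : QuotientBy Im →ₐ[k] k) (εp : QuotientBy Ip →ₐ[k] k),
      (∀ x, im (toQuotient Im x) = toMinimal δ (freeV δ x)) ∧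
      (∀ y, ip (toQuotient Ip y) = toMinimal δ (freeD δ y)) ∧
      (∀ h x, αm h (toQuotient Im x) = toQuotient Im (leftT k H V h x)) ∧
      (∀ h y, αp h (toQuotient Ip y) = toQuotient Ip (dualT k H V h y)) ∧
      (∀ x, εm (toQuotient Im x) = TensorAlgebra.algebraMapInv x) ∧
      (∀ y, εp (toQuotient Ip y) = TensorAlgebra.algebraMapInv y) ∧
      IsTriangularDecomposition im ((toMinimal δ).comp (freeH δ)) ip αm αp εm εp := by
  obtain ⟨im, him⟩ := exists_algHom_toQuotient ((toMinimal δ).comp (freeV δ))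
    fun x hx => toMinimal_eq_zero.2 (hJ.freeV_mem hx)
  obtain ⟨ip, hip⟩ := exists_algHom_toQuotient ((toMinimal δ).comp (freeD δ))
    fun y hy => toMinimal_eq_zero.2 (hJ.freeD_mem hy)
  obtain ⟨αm, hαm⟩ := exists_action_toQuotient hm (leftT k H V) hactm
  obtain ⟨αp, hαp⟩ := exists_action_toQuotient hp (dualT k H V) hactp
  obtain ⟨εm, hεm⟩ := exists_algHom_toQuotient (S := Im) TensorAlgebra.algebraMapInv hJ.left_le
  obtain ⟨εp, hεp⟩ := exists_algHom_toQuotient (S := Ip) TensorAlgebra.algebraMapInv hJ.right_le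
  have surjm := toQuotient_surjective Im
  have surjp := toQuotient_surjective Ip
  exact ⟨im, ip, αm, αp, εm, εp, him, hip, hαm, hαp, hεm, hεp,
    { left_action := isLeftModuleAlgebra_leftT.of_surjective surjm hαm
      right_action := isRightModuleAlgebra_dualT.of_surjective surjp hαp
      bijective := tripleMul_minimalDouble_bijective hδ hJ him hip
      left_semidirect := toMinimal_freeH_mul_of_toQuotient him hαm
      right_semidirect := mul_toMinimal_freeH_of_toQuotient hip hαp
      left_equivariant := fun h => surjm.forall.2 fun x => by
        rw [hαm, hεm, hεm, algebraMapInv_tensorAction]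
      right_equivariant := fun h => surjp.forall.2 fun y => by
        rw [hαp, hεp, hεp, algebraMapInv_tensorAction] }⟩

end MinimalDouble

end BraidedDouble

end

theorem theoremD_general {k : Type*} [Field k] {H : Type*} [Ring H] [HopfAlgebra k H]
    {V : Type*} [AddCommGroup V] [Module k V] [FiniteDimensional k V]
    [Module H V] [IsScalarTower k H V]
    (δ : V →ₗ[k] TensorProduct k H V) (hδ : BraidedDouble.IsYetterDrinfeld δ)
    (Ψ : TensorProduct k V V →ₗ[k] TensorProduct k V V)
    (hΨ : Ψ = BraidedDouble.inducedBraiding δ)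
    (Ψd : TensorProduct k (Module.Dual k V) (Module.Dual k V) →ₗ[k]
      TensorProduct k (Module.Dual k V) (Module.Dual k V))
    (hΨd : Ψd = BraidedDouble.dualBraiding Ψ) :
    BraidedDouble.IsTwoSidedIdeal (LinearMap.ker (BraidedDouble.woronowicz Ψ)) ∧
    BraidedDouble.IsTwoSidedIdeal (LinearMap.ker (BraidedDouble.woronowicz Ψd)) ∧
    BraidedDouble.idealV δ = LinearMap.ker (BraidedDouble.woronowicz Ψ) ∧
    BraidedDouble.idealD δ = LinearMap.ker (BraidedDouble.woronowicz Ψd) ∧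
    (∃ e : BraidedDouble.UV δ ≃ₐ[k] BraidedDouble.Nichols Ψ,
      ∀ x, e (BraidedDouble.toQuotient _ x) = BraidedDouble.toQuotient _ x) ∧
    (∃ e : BraidedDouble.UD δ ≃ₐ[k] BraidedDouble.Nichols Ψd,
      ∀ x, e (BraidedDouble.toQuotient _ x) = BraidedDouble.toQuotient _ x) ∧
    BraidedDouble.IsTriangularWith δ (BraidedDouble.maxTriangular δ)
      (BraidedDouble.idealV δ) (BraidedDouble.idealD δ) ∧
    ∃ (im : BraidedDouble.Nichols Ψ →ₐ[k] BraidedDouble.MinimalDouble δ)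
      (ip : BraidedDouble.Nichols Ψd →ₐ[k] BraidedDouble.MinimalDouble δ)
      (αm : H →ₗ[k] BraidedDouble.Nichols Ψ →ₗ[k] BraidedDouble.Nichols Ψ)
      (αp : H →ₗ[k] BraidedDouble.Nichols Ψd →ₗ[k] BraidedDouble.Nichols Ψd)
      (εm : BraidedDouble.Nichols Ψ →ₐ[k] k) (εp : BraidedDouble.Nichols Ψd →ₐ[k] k),
      (∀ x, im (BraidedDouble.toQuotient _ x) =
        BraidedDouble.toMinimal δ (BraidedDouble.freeV δ x)) ∧
      (∀ y, ip (BraidedDouble.toQuotient _ y) =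
        BraidedDouble.toMinimal δ (BraidedDouble.freeD δ y)) ∧
      (∀ h x, αm h (BraidedDouble.toQuotient _ x) =
        BraidedDouble.toQuotient _
          (BraidedDouble.tensorAction (BraidedDouble.leftAction k H V) h x)) ∧
      (∀ h y, αp h (BraidedDouble.toQuotient _ y) =
        BraidedDouble.toQuotient _
          (BraidedDouble.tensorAction (BraidedDouble.dualAction k H V) h y)) ∧
      (∀ x, εm (BraidedDouble.toQuotient _ x) = TensorAlgebra.algebraMapInv x) ∧
      (∀ y, εp (BraidedDouble.toQuotient _ y) = TensorAlgebra.algebraMapInv y) ∧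
      BraidedDouble.IsTriangularDecomposition im
        ((BraidedDouble.toMinimal δ).comp (BraidedDouble.freeH δ)) ip αm αp εm εp := by
  subst hΨ hΨd
  have radV_eq := BraidedDouble.radV_eq_ker_woronowicz hδ
  have radD_eq := BraidedDouble.radD_eq_ker_woronowicz hδ
  have idealV_eq := (BraidedDouble.idealV_eq hδ).trans radV_eq
  have idealD_eq := (BraidedDouble.idealD_eq hδ).trans radD_eq
  have isIdealV := radV_eq ▸ BraidedDouble.isTwoSidedIdeal_radV (hδ := hδ)
  have isIdealD := radD_eq ▸ BraidedDouble.isTwoSidedIdeal_radD (hδ := hδ)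
  have triangular := BraidedDouble.isTriangularWith_maxTriangular hδ
  exact ⟨isIdealV, isIdealD, idealV_eq, idealD_eq,
    BraidedDouble.exists_algEquiv_toQuotient idealV_eq,
    BraidedDouble.exists_algEquiv_toQuotient idealD_eq, triangular,
    BraidedDouble.exists_isTriangularDecomposition hδ (idealV_eq ▸ idealD_eq ▸ triangular)
      isIdealV isIdealD (radV_eq ▸ fun h _ hx => BraidedDouble.leftT_mem_radV (hδ := hδ) h hx)
      (radD_eq ▸ fun h _ hy => BraidedDouble.dualT_mem_radD (hδ := hδ) h hy)⟩

theorem theoremD {k : Type*} [Field k] {H : Type*} [Ring H] [HopfAlgebra k H]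
    (hS : Function.Bijective (HopfAlgebra.antipode k (A := H)))
    {V : Type*} [AddCommGroup V] [Module k V] [FiniteDimensional k V]
    [Module H V] [IsScalarTower k H V]
    (δ : V →ₗ[k] TensorProduct k H V) (hδ : BraidedDouble.IsYetterDrinfeld δ)
    (Ψ : TensorProduct k V V →ₗ[k] TensorProduct k V V)
    (hΨ : Ψ = BraidedDouble.inducedBraiding δ)
    (Ψd : TensorProduct k (Module.Dual k V) (Module.Dual k V) →ₗ[k]
      TensorProduct k (Module.Dual k V) (Module.Dual k V))
    (hΨd : Ψd = BraidedDouble.dualBraiding Ψ) :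
    -- The kernels of the Woronowicz symmetrisers are two-sided ideals, and they are the defining
    -- ideals `I(V, δ)` and `I(V^*, δ)` of the minimal double.
    BraidedDouble.IsTwoSidedIdeal (LinearMap.ker (BraidedDouble.woronowicz Ψ)) ∧
    BraidedDouble.IsTwoSidedIdeal (LinearMap.ker (BraidedDouble.woronowicz Ψd)) ∧
    BraidedDouble.idealV δ = LinearMap.ker (BraidedDouble.woronowicz Ψ) ∧
    BraidedDouble.idealD δ = LinearMap.ker (BraidedDouble.woronowicz Ψd) ∧
    -- `U(V, δ) = B(V, Ψ)` and `U(V^*, δ) = B(V^*, Ψ^*)`, as quotients of the tensor algebras.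
    (∃ e : BraidedDouble.UV δ ≃ₐ[k] BraidedDouble.Nichols Ψ,
      ∀ x, e (BraidedDouble.toQuotient _ x) = BraidedDouble.toQuotient _ x) ∧
    (∃ e : BraidedDouble.UD δ ≃ₐ[k] BraidedDouble.Nichols Ψd,
      ∀ x, e (BraidedDouble.toQuotient _ x) = BraidedDouble.toQuotient _ x) ∧
    -- The ideal factored out in the minimal double is triangular, with these components.
    BraidedDouble.IsTriangularWith δ (BraidedDouble.maxTriangular δ)
      (BraidedDouble.idealV δ) (BraidedDouble.idealD δ) ∧
    -- The minimal double has triangular decomposition `B(V, Ψ) ⋊ H ⋉ B(V^*, Ψ^*)`: the maps of the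
    -- three factors to it, the actions of `H` and the characters are those induced from
    -- `T(V)`, `H`, `T(V^*)`.
    ∃ (im : BraidedDouble.Nichols Ψ →ₐ[k] BraidedDouble.MinimalDouble δ)
      (ip : BraidedDouble.Nichols Ψd →ₐ[k] BraidedDouble.MinimalDouble δ)
      (αm : H →ₗ[k] BraidedDouble.Nichols Ψ →ₗ[k] BraidedDouble.Nichols Ψ)
      (αp : H →ₗ[k] BraidedDouble.Nichols Ψd →ₗ[k] BraidedDouble.Nichols Ψd)
      (εm : BraidedDouble.Nichols Ψ →ₐ[k] k) (εp : BraidedDouble.Nichols Ψd →ₐ[k] k),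
      (∀ x, im (BraidedDouble.toQuotient _ x) =
        BraidedDouble.toMinimal δ (BraidedDouble.freeV δ x)) ∧
      (∀ y, ip (BraidedDouble.toQuotient _ y) =
        BraidedDouble.toMinimal δ (BraidedDouble.freeD δ y)) ∧
      (∀ h x, αm h (BraidedDouble.toQuotient _ x) =
        BraidedDouble.toQuotient _
          (BraidedDouble.tensorAction (BraidedDouble.leftAction k H V) h x)) ∧
      (∀ h y, αp h (BraidedDouble.toQuotient _ y) =
        BraidedDouble.toQuotient _
          (BraidedDouble.tensorAction (BraidedDouble.dualAction k H V) h y)) ∧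
      (∀ x, εm (BraidedDouble.toQuotient _ x) = TensorAlgebra.algebraMapInv x) ∧
      (∀ y, εp (BraidedDouble.toQuotient _ y) = TensorAlgebra.algebraMapInv y) ∧
      BraidedDouble.IsTriangularDecomposition im
        ((BraidedDouble.toMinimal δ).comp (BraidedDouble.freeH δ)) ip αm αp εm εp :=
  theoremD_general δ hδ Ψ hΨ Ψd hΨd
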